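/- Let $T>0$, $H\in(\frac12,1)$, $\sigma\in(1-H,\frac12)$, let $a_1,a_2,\rho_1,\rho_2>0$ and $h_1,h_2\in\mathbb R$, and put $h(z)=h_1z+h_2$. Let $(\lambda_j)_{j\ge1}$ be positive reals with $\sum_j\lambda_j<\infty$, and let $(e_j)_{j\ge1}$ be an orthonormal basis of $L^2(\mathbb R)$ with $\sup_j\|e_j\|_\infty<\infty$. Let $B^H_j$, $j\ge1$, be fractional Brownian motions with Hurst index $H$ on a common probability space, with almost surely continuous paths (no independence is assumed). Put $f(y)=\frac{y}{\sqrt{a_1}}\mathbf 1_{\{y\le0\}}+\frac{y}{\sqrt{a_2}}\mathbf 1_{\{y>0\}}$, $\alpha=1-\frac{\rho_1a_1}{\rho_2a_2}$, $\beta=\frac{\sqrt{a_1}+\sqrt{a_2}(\alpha-1)}{\sqrt{a_1}-\sqrt{a_2}(\alpha-1)}$ and $$G(r,x,y)=\frac{\mathbf 1_{\{r>0\}}}{\sqrt{2\pi r}}\Big(\frac{\mathbf 1_{\{y\le0\}}}{\sqrt{a_1}}+\frac{\mathbf 1_{\{y>0\}}}{\sqrt{a_2}}\Big)\Big\{e^{-\frac{(f(x)-f(y))^2}{2r}}+\beta\,\mathrm{sign}(y)\,e^{-\frac{(|f(x)|+|f(y)|)^2}{2r}}\Big\}.$$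 For $u\colon[0,T]\times\mathbb R\to\mathbb R$ and $t\in[0,T]$ let $$\|u\|_{\sigma,2,t}^2=\sup_{s\in[0,t]}\|u(s,\cdot)\|_2^2+\int_0^t\Big(\int_0^s\frac{\|u(s,\cdot)-u(v,\cdot)\|_2}{(s-v)^{\sigma+1}}\,dv\Big)^2ds,$$ where $\|\cdot\|_2$ is the norm of $L^2(\mathbb R)$, and let $\mathcal B^{\sigma,2}([0,T];L^2(\mathbb R))$ be the space of Lebesgue measurable $u$ with $u(s,\cdot)$ measurable for every $s\in[0,T]$ and $\|u\|_{\sigma,2,T}<\infty$. For $g\colon[0,T]\to\mathbb R$ let $$\|g\|_{\sigma,0,T}=\sup_{0\le u<v\le T}\Big(\frac{|g(u)-g(v)|}{(v-u)^{1-\sigma}}+\int_u^v\frac{|g(u)-g(z)|}{(z-u)^{2-\sigma}}\,dz\Big),\qquad \xi=\sum_{j=1}^\infty\lambda_j\|B_j^H\|_{\sigma,0,T}.$$ The generalized Lebesgue--Stieltjes integral is $\int_a^b\varphi\,d\psi=\int_a^bD^\sigma_{a+}\varphi(x)\,D^{1-\sigma}_{b-}\psi_{b-}(x)\,dx$, where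 $\psi_{b-}(x)=\psi(b-)-\psi(x)$ and $$D^{\sigma}_{a+}\varphi(x)=\tfrac1{\Gamma(1-\sigma)}\Big(\tfrac{\varphi(x)}{(x-a)^\sigma}+\sigma\int_a^x\tfrac{\varphi(x)-\varphi(y)}{(x-y)^{1+\sigma}}dy\Big),\quad D^{\sigma}_{b-}\varphi(x)=\tfrac1{\Gamma(1-\sigma)}\Big(\tfrac{\varphi(x)}{(b-x)^\sigma}+\sigma\int_x^b\tfrac{\varphi(x)-\varphi(y)}{(y-x)^{1+\sigma}}dy\Big);$$ it is well defined if the integrals in these derivatives converge for almost every $x\in(a,b)$, $D^\sigma_{a+}\varphi\in L^1([a,b])$ and $D^{1-\sigma}_{b-}\psi_{b-}\in L^\infty([a,b])$. Put $$\varsigma_{j,t}(u)(s,x)=\int_{\mathbb R}G(t-s,x,y)\,h(u(s,y))\,e_j(y)\,dy,\qquad (\mathcal Au)(t,x)=\sum_{j=1}^\infty\lambda_j\int_0^t\varsigma_{j,t}(u)(s,x)\,dB^H_j(s).$$ There is a finite constant $C\ge 0$, depending on neither the probability space, the processes $B^H_j$, $u$ nor $t$, such that almost surely $\xi<\infty$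 and the following holds for every $u\in\mathcal B^{\sigma,2}([0,T];L^2(\mathbb R))$. 1. $\mathcal Au$ is well defined: for every $t\in[0,T]$, $$\sup_j\int_0^T\Big(\frac{\|\varsigma_{j,t}(u)(s,\cdot)\|_2}{s^\sigma}+\int_0^s\frac{\|\varsigma_{j,t}(u)(s,\cdot)-\varsigma_{j,t}(u)(v,\cdot)\|_2}{(s-v)^{\sigma+1}}\,dv\Big)ds<\infty,$$ for every $j$ and almost every $x$ the integral $\int_0^t\varsigma_{j,t}(u)(s,x)\,dB^H_j(s)$ is well defined, as a function of $x$ it is in $L^2(\mathbb R)$, and the series defining $(\mathcal Au)(t,\cdot)$ converges in $L^2(\mathbb R)$. 2. $\mathcal Au\in\mathcal B^{\sigma,2}([0,T];L^2(\mathbb R))$. 3. For every $t\in(0,T]$, $$\|\mathcal Au\|_{\sigma,2,t}^2\le C\,\xi^2\,\big(\|u\|_{\sigma,2,t}^2+1\big).$$ -/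

import Mathlib

open MeasureTheory ProbabilityTheory Filter Topology
open scoped NNReal ENNReal

noncomputable section

namespace FracHeat

/-! ### Fractional Brownian motion -/

/-- `B` is a (one-dimensional) fractional Brownian motion with Hurst index `H`: a centered Gaussian
process with the fractional covariance, taken with almost surely continuous paths. -/
structure IsFBM {Ω : Type*} [MeasurableSpace Ω] (H : ℝ) (B : ℝ≥0 → Ω → ℝ) (P : Measure Ω) :
    Prop where
  gaussian : IsGaussianProcess B P
  centered : ∀ t, ∫ ω, B t ω ∂P = 0
  covariance : ∀ s t : ℝ≥0, ∫ ω, B t ω * B s ω ∂P =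
    1 / 2 * ((t : ℝ) ^ (2 * H) + (s : ℝ) ^ (2 * H) - |(t : ℝ) - s| ^ (2 * H))
  continuous_paths : ∀ᵐ ω ∂P, Continuous fun t => B t ω

/-- The trajectory `s ↦ B s ω`, as a function of a real variable (only `s ≥ 0` matters). -/
def path {Ω : Type*} (B : ℝ≥0 → Ω → ℝ) (ω : Ω) : ℝ → ℝ := fun s => B s.toNNReal ω

/-! ### Norms and the Besov-type space -/

/-- The seminorm `‖f‖_{σ,0,t}`, with values in `[0, ∞]`. -/
def seminormZero (σ t : ℝ) (f : ℝ → ℝ) : ℝ≥0∞ :=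
  ⨆ (u : ℝ) (v : ℝ) (_ : 0 ≤ u) (_ : u < v) (_ : v ≤ t),
    (ENNReal.ofReal (|f u - f v| / (v - u) ^ (1 - σ)) +
      ∫⁻ z in Set.Ioo u v, ENNReal.ofReal (|f u - f z| / (z - u) ^ (2 - σ)))

/-- The `L²(ℝ)` norm, with values in `[0, ∞]`. -/
def normTwo (g : ℝ → ℝ) : ℝ≥0∞ := eLpNorm g 2 volume

/-- `‖u‖²_{σ,1,t}`, with values in `[0, ∞]`. -/
def sqNormOne (σ t : ℝ) (u : ℝ → ℝ → ℝ) : ℝ≥0∞ :=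
  ∫⁻ s in Set.Ioo 0 t, (∫⁻ v in Set.Ioo 0 s,
    normTwo (fun x => u s x - u v x) / ENNReal.ofReal ((s - v) ^ (σ + 1))) ^ 2

/-- `‖u‖²_{σ,2,t}`, with values in `[0, ∞]`. -/
def sqNormTwo (σ t : ℝ) (u : ℝ → ℝ → ℝ) : ℝ≥0∞ :=
  (⨆ s ∈ Set.Icc 0 t, normTwo (u s) ^ 2) + sqNormOne σ t u

/-- The space `𝓑^{σ,2}([0,T]; L²(ℝ))`: mappings that are Lebesgue measurable on `[0,T] × ℝ` (that
is, almost everywhere equal to a Borel mapping), whose value at each time of `[0,T]` is a measurable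
function of the space variable, and for which `‖u‖²_{σ,2,T}` is finite.
Values of `u` at times outside `[0,T]` are irrelevant. -/
structure MemBesov (σ T : ℝ) (u : ℝ → ℝ → ℝ) : Prop where
  measurable : AEMeasurable (Function.uncurry u)
    (((volume : Measure ℝ).restrict (Set.Icc 0 T)).prod (volume : Measure ℝ))
  measurable_section : ∀ s ∈ Set.Icc 0 T, AEStronglyMeasurable (u s) volume
  finite : sqNormTwo σ T u < ⊤

/-! ### The generalized Lebesgue-Stieltjes integral -/

/-- Left-sided Riemann-Liouville fractional derivative `D^σ_{a+} φ`. -/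
def fracDerivLeft (σ a : ℝ) (φ : ℝ → ℝ) (x : ℝ) : ℝ :=
  1 / Real.Gamma (1 - σ) *
    (φ x / (x - a) ^ σ + σ * ∫ y in a..x, (φ x - φ y) / (x - y) ^ (1 + σ))

/-- Right-sided Riemann-Liouville fractional derivative `D^σ_{b-} φ`. -/
def fracDerivRight (σ b : ℝ) (φ : ℝ → ℝ) (x : ℝ) : ℝ :=
  1 / Real.Gamma (1 - σ) *
    (φ x / (b - x) ^ σ + σ * ∫ y in x..b, (φ x - φ y) / (y - x) ^ (1 + σ))

/-- `ψ_{b-}(x) = ψ(b-) - ψ(x)`. -/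
def leftCentered (b : ℝ) (ψ : ℝ → ℝ) (x : ℝ) : ℝ := Function.leftLim ψ b - ψ x

/-- The generalized Lebesgue-Stieltjes integral `∫_a^b φ dψ`. -/
def glsIntegral (σ a b : ℝ) (φ ψ : ℝ → ℝ) : ℝ :=
  ∫ x in a..b, fracDerivLeft σ a φ x * fracDerivRight (1 - σ) b (leftCentered b ψ) x

/-- The generalized Lebesgue-Stieltjes integral `∫_a^b φ dψ` is well defined: the integrals in
`D^σ_{a+} φ` and `D^{1-σ}_{b-} ψ_{b-}` converge at almost every point of `[a,b]`, and these
derivatives are in `L¹([a,b])` and `L^∞([a,b])` respectively. -/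
structure GLSIntegrable (σ a b : ℝ) (φ ψ : ℝ → ℝ) : Prop where
  left_converges : ∀ᵐ x ∂(volume : Measure ℝ).restrict (Set.Ioo a b),
    IntervalIntegrable (fun y => (φ x - φ y) / (x - y) ^ (1 + σ)) volume a x
  left_memL1 : MemLp (fracDerivLeft σ a φ) 1 ((volume : Measure ℝ).restrict (Set.Ioo a b))
  right_converges : ∀ᵐ x ∂(volume : Measure ℝ).restrict (Set.Ioo a b),
    IntervalIntegrable (fun y => (leftCentered b ψ x - leftCentered b ψ y) /
      (y - x) ^ (1 + (1 - σ))) volume x b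
  right_memLinfty : MemLp (fracDerivRight (1 - σ) b (leftCentered b ψ)) ⊤
    ((volume : Measure ℝ).restrict (Set.Ioo a b))

/-! ### The fundamental solution and the right-hand side of the mild equation -/

/-- `f(y) = y/√a₁` for `y ≤ 0` and `f(y) = y/√a₂` for `y > 0`. -/
def f (a₁ a₂ y : ℝ) : ℝ := if y ≤ 0 then y / √a₁ else y / √a₂

/-- `α = 1 - ρ₁a₁/(ρ₂a₂)`. -/
def α (a₁ a₂ ρ₁ ρ₂ : ℝ) : ℝ := 1 - ρ₁ * a₁ / (ρ₂ * a₂)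

/-- `β = (√a₁ + √a₂(α-1)) / (√a₁ - √a₂(α-1))`. -/
def β (a₁ a₂ ρ₁ ρ₂ : ℝ) : ℝ :=
  (√a₁ + √a₂ * (α a₁ a₂ ρ₁ ρ₂ - 1)) / (√a₁ - √a₂ * (α a₁ a₂ ρ₁ ρ₂ - 1))

/-- The fundamental solution `G(r,x,y)`, equal to zero for `r ≤ 0`. -/
def G (a₁ a₂ ρ₁ ρ₂ r x y : ℝ) : ℝ :=
  if 0 < r then
    1 / √(2 * Real.pi * r) * (if y ≤ 0 then 1 / √a₁ else 1 / √a₂) *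
      (Real.exp (-(f a₁ a₂ x - f a₁ a₂ y) ^ 2 / (2 * r)) +
        β a₁ a₂ ρ₁ ρ₂ * Real.sign y *
          Real.exp (-(|f a₁ a₂ x| + |f a₁ a₂ y|) ^ 2 / (2 * r)))
  else 0

/-- `ς_t(u)(s,x) = ∫ G(t-s,x,y) h(u(s,y)) e(y) dy`, with `h(z) = h₁ z + h₂`. -/
def varsigma (a₁ a₂ ρ₁ ρ₂ h₁ h₂ : ℝ) (e : ℝ → ℝ) (u : ℝ → ℝ → ℝ) (t s x : ℝ) : ℝ :=
  ∫ y, G a₁ a₂ ρ₁ ρ₂ (t - s) x y * (h₁ * u s y + h₂) * e y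

/-- One term (without its weight) of the series: `x ↦ ∫_0^t ς_t(u)(s,x) dψ(s)`. -/
def mildTerm (σ a₁ a₂ ρ₁ ρ₂ h₁ h₂ : ℝ) (e : ℝ → ℝ) (ψ : ℝ → ℝ) (u : ℝ → ℝ → ℝ) (t x : ℝ) : ℝ :=
  glsIntegral σ 0 t (fun s => varsigma a₁ a₂ ρ₁ ρ₂ h₁ h₂ e u t s x) ψ

/-- `(𝓐u)(t,x) = ∑_j λ_j ∫_0^t ∫ G(t-s,x,y) h(u(s,y)) e_j(y) dy dψ_j(s)`, for driving
trajectories `ψ_j`. -/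
def mildOp (σ a₁ a₂ ρ₁ ρ₂ h₁ h₂ : ℝ) (lam : ℕ → ℝ) (e : ℕ → ℝ → ℝ) (ψ : ℕ → ℝ → ℝ)
    (u : ℝ → ℝ → ℝ) (t x : ℝ) : ℝ :=
  ∑' j, lam j * mildTerm σ a₁ a₂ ρ₁ ρ₂ h₁ h₂ (e j) (ψ j) u t x

/-- The integral and the series defining `𝓐u` make sense at time `t ∈ [0,T]`. -/
structure MildOpWellDefined (σ T a₁ a₂ ρ₁ ρ₂ h₁ h₂ : ℝ) (lam : ℕ → ℝ) (e : ℕ → ℝ → ℝ)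
    (ψ : ℕ → ℝ → ℝ) (u : ℝ → ℝ → ℝ) (t : ℝ) : Prop where
  /-- The condition under which the infinite-dimensional integral is defined. -/
  condition : (⨆ j, ∫⁻ s in Set.Ioo 0 T,
    (normTwo (varsigma a₁ a₂ ρ₁ ρ₂ h₁ h₂ (e j) u t s) / ENNReal.ofReal (s ^ σ) +
      ∫⁻ v in Set.Ioo 0 s,
        normTwo (fun x => varsigma a₁ a₂ ρ₁ ρ₂ h₁ h₂ (e j) u t s x -
          varsigma a₁ a₂ ρ₁ ρ₂ h₁ h₂ (e j) u t v x) /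
            ENNReal.ofReal ((s - v) ^ (σ + 1)))) < ⊤
  /-- Each term is a generalized Lebesgue-Stieltjes integral. -/
  terms : ∀ j, ∀ᵐ x ∂(volume : Measure ℝ),
    GLSIntegrable σ 0 t (fun s => varsigma a₁ a₂ ρ₁ ρ₂ h₁ h₂ (e j) u t s x) (ψ j)
  /-- Each term is in `L²(ℝ)`. -/
  terms_memL2 : ∀ j, MemLp (mildTerm σ a₁ a₂ ρ₁ ρ₂ h₁ h₂ (e j) (ψ j) u t) 2 volume
  /-- The series converges in `L²(ℝ)`, with sum `(𝓐u)(t,·)`. -/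
  converges : Tendsto (fun n : ℕ => normTwo (fun x =>
      mildOp σ a₁ a₂ ρ₁ ρ₂ h₁ h₂ lam e ψ u t x -
        ∑ j ∈ Finset.range n, lam j * mildTerm σ a₁ a₂ ρ₁ ρ₂ h₁ h₂ (e j) (ψ j) u t x))
    atTop (𝓝 0)

/-- `ξ = ∑_j λ_j ‖ψ_j‖_{σ,0,T}`, with values in `[0, ∞]`. -/
def xi (σ T : ℝ) (lam : ℕ → ℝ) (ψ : ℕ → ℝ → ℝ) : ℝ≥0∞ :=
  ∑' j, ENNReal.ofReal (lam j) * seminormZero σ T (ψ j)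

end FracHeat

end

/-!
Everything except the finiteness of `ξ` is deterministic: it holds for all continuous driving paths
`ψ j` with `ξ < ∞`, with the same constant.

**Finiteness of `ξ`.** The increments of fractional Brownian motion are Gaussian with standard
deviation `|t - s| ^ H`. For `1 - σ < γ < H` a Kolmogorov-Chentsov estimate bounds the `γ`-Hölder
constant on `[0, T]`, hence also `‖·‖_{σ,0,T}`, by a random variable whose expectation is
bounded uniformly in `j` (`exists_seminormZero_le`). As `∑ j, λ j < ∞`, the variable `ξ` has an
integrable majorant (`ae_xi_lt_top`). No independence enters.

**The kernel.** Fix `σ < θ < 1/2`. In the variables `f x` and `f y`, the kernel `G` and its first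
and second differences in time are dominated by Gaussians. With the Schur test, the operators with
kernel `G(r, ·, ·)` are bounded on `L²(ℝ)` uniformly in `r`, their first differences with step `a`
by `(a / r) ^ θ` and their second differences with steps `a`, `b` by `(a b / r²) ^ θ`, up to
constants (`exists_opBounds`).

**One integral.** Let `w` be the product of `h(u)` and a basis function, and let
`φ_t(s) = ∫ G(t - s, ·, y) w(s, y) dy`. The kernel bounds show that the `L²(ℝ)` norm of
`D^σ_{0+} φ_s(r)` is controlled by
`R_s(r) = r ^ (-σ) ‖w‖ + ∫_0^r ‖w(r) - w(q)‖ (r - q) ^ (-σ - 1) dq + (s - r) ^ (-θ) ‖w‖`, and that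
of `D^σ_{0+} (φ_s - φ_v)(r)` by `((s - v) / (v - r)) ^ θ R_v(r)` (`leftMass_evolved_le`,
`leftMass_evolved_sub_le`). The derivative of the driving path at `r` is bounded by a multiple of
`‖ψ‖_{σ,0,T}`, and moving its end point from `v` to `s` changes it by at most
`((s - v) / (v - r)) ^ θ` times that (`abs_driverDeriv_le`, `abs_driverDeriv_sub_le`). Since
`(s - r) ^ (-θ)` is square integrable, the Cauchy-Schwarz inequality bounds
`∫_0^s (s - r) ^ (-θ) R_s(r) dr` by the norm of `w`. Hence the integral is Hölder continuous of
order `θ` in time, as a function with values in `L²(ℝ)` (`exists_driven_bounds`). The comparison of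
the integrals up to `s` and up to `v` is made inside the defining formula, so the additivity of the
generalized integral in the interval is not needed.

**The sum.** Multiplication by a bounded normalized `e j` turns the norms of `u` into bounds for `w`
(`forcingBound_of_memBesov`), and the Hölder bounds, summed with weights `λ j ‖ψ j‖_{σ,0,T}`, give
the theorem because `θ > σ` (`sqNormTwo_tsum_le`, `exists_mildOp_bounds`). As `u` is only Lebesgue
measurable, it is first replaced by a Borel version, equal to `u` at almost every time, which does
not affect the integrals.
-/

namespace FracHeat

/-! ### The `L²` norm of extended nonnegative functions -/

lemma lintegral_mul_sq_le {X : Type*} [MeasurableSpace X] (μ : Measure X) {F G : X → ℝ≥0∞}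
    (hF : AEMeasurable F μ) (hG : AEMeasurable G μ) :
    (∫⁻ x, F x * G x ∂μ) ^ 2 ≤ (∫⁻ x, F x ^ 2 ∂μ) * ∫⁻ x, G x ^ 2 ∂μ := by
  have h := ENNReal.lintegral_mul_le_Lp_mul_Lq μ Real.HolderConjugate.two_two hF hG
  simp only [Pi.mul_apply, ENNReal.rpow_ofNat] at h
  calc _ ≤ ((∫⁻ x, F x ^ 2 ∂μ) ^ (1 / 2 : ℝ) * (∫⁻ x, G x ^ 2 ∂μ) ^ (1 / 2 : ℝ)) ^ 2 := by gcongr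
    _ = _ := by
      rw [mul_pow, ← ENNReal.rpow_natCast, ← ENNReal.rpow_natCast, ← ENNReal.rpow_mul,
        ← ENNReal.rpow_mul]
      norm_num

/-- The `L²(ℝ)` norm of a function with values in `[0, ∞]`. -/
noncomputable def l2 (F : ℝ → ℝ≥0∞) : ℝ≥0∞ := (∫⁻ x, F x ^ 2) ^ (1 / 2 : ℝ)

lemma l2_sq (F : ℝ → ℝ≥0∞) : l2 F ^ 2 = ∫⁻ x, F x ^ 2 := by
  rw [l2, ← ENNReal.rpow_natCast, ← ENNReal.rpow_mul]; norm_num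

lemma normTwo_eq_l2 (g : ℝ → ℝ) : normTwo g = l2 fun x => ‖g x‖ₑ := by
  rw [normTwo, eLpNorm_eq_lintegral_rpow_enorm_toReal (by norm_num) (by norm_num), l2]
  simp

lemma normTwo_sq (g : ℝ → ℝ) : normTwo g ^ 2 = ∫⁻ x, ‖g x‖ₑ ^ 2 := by
  rw [normTwo_eq_l2, l2_sq]

lemma l2_mono_ae {F G : ℝ → ℝ≥0∞} (h : ∀ᵐ x, F x ≤ G x) : l2 F ≤ l2 G := by
  unfold l2
  gcongr ?_ ^ _
  exact lintegral_mono_ae (h.mono fun x hx => by gcongr)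

lemma l2_mono {F G : ℝ → ℝ≥0∞} (h : ∀ x, F x ≤ G x) : l2 F ≤ l2 G :=
  l2_mono_ae (Eventually.of_forall h)

lemma l2_add_le {F G : ℝ → ℝ≥0∞} (hF : AEMeasurable F) (hG : AEMeasurable G) :
    l2 (fun x => F x + G x) ≤ l2 F + l2 G := by
  have h := ENNReal.lintegral_Lp_add_le hF hG (p := 2) (by norm_num)
  simpa [l2] using h

lemma l2_const_mul {c : ℝ≥0∞} (hc : c ≠ ⊤) (F : ℝ → ℝ≥0∞) :
    l2 (fun x => c * F x) = c * l2 F := by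
  simp only [l2, mul_pow]
  rw [lintegral_const_mul' _ _ (by finiteness), ENNReal.mul_rpow_of_nonneg _ _ (by norm_num),
    ← ENNReal.rpow_natCast, ← ENNReal.rpow_mul]
  norm_num

lemma ae_lt_top_of_l2 {F : ℝ → ℝ≥0∞} (hF : AEMeasurable F) (h : l2 F ≠ ⊤) :
    ∀ᵐ x, F x < ⊤ := by
  have : ∫⁻ x, F x ^ 2 ≠ ⊤ := by rw [← l2_sq]; finiteness
  filter_upwards [ae_lt_top' (hF.pow_const 2) this] with x hx
  by_contra hc
  simp only [not_lt, top_le_iff] at hc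
  simp [hc] at hx

/-- Minkowski's integral inequality in `L²`: the square of the left-hand side is a triple integral,
to which Tonelli's theorem and the Cauchy-Schwarz inequality apply. -/
lemma l2_lintegral_le {Y : Type*} [MeasurableSpace Y] (ν : Measure Y) [SFinite ν]
    {F : ℝ → Y → ℝ≥0∞} (hF : Measurable (Function.uncurry F)) :
    l2 (fun x => ∫⁻ y, F x y ∂ν) ≤ ∫⁻ y, l2 (fun x => F x y) ∂ν := by
  have hm : ∀ x, Measurable (F x) := fun x => hF.comp measurable_prodMk_left
  have hm' : ∀ y, Measurable fun x => F x y := fun y => hF.comp measurable_prodMk_right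
  have h1 : ∀ x, (∫⁻ y, F x y ∂ν) ^ 2 = ∫⁻ y, ∫⁻ y', F x y * F x y' ∂ν ∂ν := by
    intro x
    simp_rw [lintegral_const_mul _ (hm x)]
    rw [lintegral_mul_const _ (hm x), sq]
  have h2 : l2 (fun x => ∫⁻ y, F x y ∂ν) ^ 2 ≤ (∫⁻ y, l2 (fun x => F x y) ∂ν) ^ 2 := by
    rw [l2_sq]
    simp_rw [h1]
    rw [lintegral_lintegral_swap]
    · calc _ = ∫⁻ y, ∫⁻ y', ∫⁻ x, F x y * F x y' ∂volume ∂ν ∂ν := by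
            refine lintegral_congr fun y => ?_
            rw [lintegral_lintegral_swap]
            exact (((hm' y).comp measurable_fst).mul hF).aemeasurable
        _ ≤ ∫⁻ y, ∫⁻ y', l2 (fun x => F x y) * l2 (fun x => F x y') ∂ν ∂ν := by
            refine lintegral_mono fun y => lintegral_mono fun y' => ?_
            rw [← ENNReal.pow_le_pow_left_iff two_ne_zero, mul_pow, l2_sq, l2_sq]
            exact lintegral_mul_sq_le _ (hm' y).aemeasurable (hm' y').aemeasurable
        _ = _ := by
            have hl : Measurable fun y => l2 fun x => F x y := by
              unfold l2
              exact (Measurable.lintegral_prod_left (hF.pow_const 2)).pow_const _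
            simp_rw [lintegral_const_mul _ hl]
            rw [lintegral_mul_const _ hl, sq]
    · apply Measurable.aemeasurable
      apply Measurable.lintegral_prod_right'
        (f := fun p : (ℝ × Y) × Y => F p.1.1 p.1.2 * F p.1.1 p.2)
      exact (hF.comp measurable_fst).mul
        (hF.comp ((measurable_fst.comp measurable_fst).prodMk measurable_snd))
  exact (ENNReal.pow_le_pow_left_iff two_ne_zero).1 h2

lemma l2_tsum_le {F : ℕ → ℝ → ℝ≥0∞} (hF : ∀ j, Measurable (F j)) :
    l2 (fun x => ∑' j, F j x) ≤ ∑' j, l2 (F j) := by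
  have h := l2_lintegral_le Measure.count (F := fun x j => F j x)
    (measurable_from_prod_countable_left fun j => hF j)
  simpa [lintegral_count] using h

/-- The Schur test: a nonnegative kernel whose row and column integrals are bounded acts boundedly
on `L²`. -/
lemma schur_test {k : ℝ → ℝ → ℝ≥0∞} (hk : Measurable (Function.uncurry k)) {a b : ℝ≥0∞}
    (ha : ∀ x, ∫⁻ y, k x y ≤ a) (hb : ∀ y, ∫⁻ x, k x y ≤ b) {F : ℝ → ℝ≥0∞} (hF : Measurable F) :
    l2 (fun x => ∫⁻ y, k x y * F y) ^ 2 ≤ a * b * l2 F ^ 2 := by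
  rw [l2_sq, l2_sq]
  have hm : ∀ x, Measurable (k x) := fun x => hk.comp measurable_prodMk_left
  calc ∫⁻ x, (∫⁻ y, k x y * F y) ^ 2 ≤ ∫⁻ x, a * ∫⁻ y, k x y * F y ^ 2 := by
        refine lintegral_mono fun x => ?_
        -- split the kernel as the product of its square roots
        have h := lintegral_mul_sq_le volume (F := fun y => k x y ^ (1 / 2 : ℝ))
          (G := fun y => k x y ^ (1 / 2 : ℝ) * F y) ((hm x).pow_const _).aemeasurable
          (((hm x).pow_const _).mul hF).aemeasurable
        have e1 : ∀ c : ℝ≥0∞, (c ^ (1 / 2 : ℝ)) ^ 2 = c := fun c => by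
          rw [← ENNReal.rpow_natCast, ← ENNReal.rpow_mul]; norm_num
        simp only [← mul_assoc, ← sq, mul_pow, e1] at h
        exact h.trans (by gcongr; exact ha x)
    _ = a * ∫⁻ y, ∫⁻ x, k x y * F y ^ 2 := by
        have hkF : Measurable (Function.uncurry fun x y => k x y * F y ^ 2) :=
          hk.mul ((hF.comp measurable_snd).pow_const 2)
        have h2 : Measurable fun x => ∫⁻ y, k x y * F y ^ 2 := hkF.lintegral_prod_right'
        rw [lintegral_const_mul _ h2,
          lintegral_lintegral_swap hkF.aemeasurable]
    _ ≤ a * ∫⁻ y, b * F y ^ 2 := by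
        gcongr with y
        rw [lintegral_mul_const _ (hk.of_uncurry_right)]
        gcongr
        exact hb y
    _ = _ := by rw [lintegral_const_mul _ (hF.pow_const 2), mul_assoc]

/-! ### Integrals of powers -/

lemma lintegral_rpow_Ioo {a b p : ℝ} (hab : a ≤ b) (hp : -1 < p) :
    ∫⁻ z in Set.Ioo a b, ENNReal.ofReal ((z - a) ^ p) =
      ENNReal.ofReal ((b - a) ^ (p + 1) / (p + 1)) := by
  have hint : IntervalIntegrable (fun z : ℝ => (z - a) ^ p) volume a b := by
    simpa using
      (intervalIntegral.intervalIntegrable_rpow' (a := 0) (b := b - a) hp).comp_sub_right a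
  rw [← ofReal_integral_eq_lintegral_ofReal]
  · rw [← integral_Ioc_eq_integral_Ioo, ← intervalIntegral.integral_of_le hab,
      intervalIntegral.integral_comp_sub_right (fun z => z ^ p), integral_rpow (Or.inl hp)]
    simp [Real.zero_rpow (by linarith : p + 1 ≠ 0)]
  · exact ((intervalIntegrable_iff_integrableOn_Ioc_of_le hab).1 hint).mono_set
      Set.Ioo_subset_Ioc_self
  · exact (ae_restrict_mem measurableSet_Ioo).mono fun z hz =>
      Real.rpow_nonneg (sub_nonneg.2 hz.1.le) _

lemma lintegral_rpow_Ioo' {a b p : ℝ} (hab : a ≤ b) (hp : -1 < p) :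
    ∫⁻ z in Set.Ioo a b, ENNReal.ofReal ((b - z) ^ p) =
      ENNReal.ofReal ((b - a) ^ (p + 1) / (p + 1)) := by
  have h := (Measure.measurePreserving_neg (volume : Measure ℝ)).setLIntegral_comp_preimage_emb
    (MeasurableEquiv.neg ℝ).measurableEmbedding
    (fun z => ENNReal.ofReal ((z - (-b)) ^ p)) (Set.Ioo (-b) (-a))
  have h2 := lintegral_rpow_Ioo (neg_le_neg hab) hp
  rw [h2] at h
  simpa [neg_add_eq_sub, ← sub_eq_add_neg] using h

/-! ### Hölder continuity of fractional Brownian motion -/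

/-- A continuous function whose increments over the dyadic intervals of length `T / 2 ^ n` are at
most `A * 2 ^ (-γ n)` is `γ`-Hölder on `[0, T]`, with a constant proportional to `A`. -/
lemma holder_of_dyadic {g : ℝ → ℝ} {T A γ : ℝ} (hT : 0 < T) (hγ : 0 < γ) (hg : Continuous g)
    (hA : 0 ≤ A)
    (h : ∀ n k : ℕ, k < 2 ^ n →
      |g ((k + 1 : ℕ) * (T / 2 ^ n)) - g (k * (T / 2 ^ n))| ≤ A * ((1 / 2 : ℝ) ^ γ) ^ n)
    {x y : ℝ} (hx : 0 ≤ x) (hxy : x < y) (hy : y ≤ T) :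
    |g x - g y| ≤ (1 + 2 / (1 - (1 / 2 : ℝ) ^ γ)) * (2 / T) ^ γ * A * (y - x) ^ γ := by
  set ρ : ℝ := (1 / 2 : ℝ) ^ γ with hρ
  have hρ0 : 0 < ρ := by positivity
  have hρ1 : ρ < 1 := Real.rpow_lt_one (by norm_num) (by norm_num) hγ
  -- `p n z` is the dyadic approximation of `z` from below at level `n`
  let p : ℕ → ℝ → ℝ := fun n z => (⌊z * 2 ^ n / T⌋₊ : ℝ) * (T / 2 ^ n)
  have happ : ∀ z, 0 ≤ z → z ≤ T → ∀ n, |g (p n z) - g z| ≤ A * ρ ^ n / (1 - ρ) := by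
    intro z hz0 hzT n
    have hstep : ∀ n, dist (g (p n z)) (g (p (n + 1) z)) ≤ A * ρ ^ n := by
      intro n
      set k := ⌊z * 2 ^ n / T⌋₊ with hk
      have hz2 : z * 2 ^ (n + 1) / T = 2 * (z * 2 ^ n / T) := by ring
      have hnn : 0 ≤ z * 2 ^ n / T := by positivity
      have h1 : (k : ℝ) ≤ z * 2 ^ n / T := Nat.floor_le hnn
      have h2 : z * 2 ^ n / T < k + 1 := Nat.lt_floor_add_one _
      have hle : z * 2 ^ n / T ≤ 2 ^ n := by
        rw [div_le_iff₀ hT]; nlinarith [pow_pos (two_pos : (0 : ℝ) < 2) n]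
      have hcase : ⌊z * 2 ^ (n + 1) / T⌋₊ = 2 * k ∨ ⌊z * 2 ^ (n + 1) / T⌋₊ = 2 * k + 1 := by
        have ha : 2 * k ≤ ⌊z * 2 ^ (n + 1) / T⌋₊ := by
          apply Nat.le_floor; push_cast; linarith
        have hb : ⌊z * 2 ^ (n + 1) / T⌋₊ < 2 * k + 2 := by
          rw [Nat.floor_lt (by positivity)]; push_cast; linarith
        omega
      have hpn : p n z = (2 * k : ℕ) * (T / 2 ^ (n + 1)) := by
        simp only [p, ← hk]; push_cast; rw [pow_succ]; field_simp
      rcases hcase with hc | hc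
      · have : p (n + 1) z = p n z := by rw [hpn]; simp only [p, hc]
        rw [this, dist_self]; positivity
      · have hk2 : 2 * k < 2 ^ (n + 1) := by
          have h3 : (⌊z * 2 ^ (n + 1) / T⌋₊ : ℝ) ≤ z * 2 ^ (n + 1) / T :=
            Nat.floor_le (by positivity)
          rw [hc, hz2] at h3
          have h4 : ((2 * k + 1 : ℕ) : ℝ) ≤ ((2 ^ (n + 1) : ℕ) : ℝ) := by
            push_cast at h3 ⊢; rw [pow_succ]; linarith
          have := Nat.cast_le.1 h4
          omega
        have h5 : p (n + 1) z = (2 * k + 1 : ℕ) * (T / 2 ^ (n + 1)) := by simp only [p, hc]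
        rw [dist_comm, Real.dist_eq, h5, hpn]
        refine (h (n + 1) (2 * k) hk2).trans ?_
        rw [pow_succ]
        have : 0 ≤ ρ ^ n := by positivity
        nlinarith [mul_nonneg hA this]
    have hlim : Tendsto (fun n => g (p n z)) atTop (𝓝 (g z)) := by
      refine (hg.tendsto z).comp ?_
      have hsq : Tendsto (fun n : ℕ => z - T / 2 ^ n) atTop (𝓝 z) := by
        have : Tendsto (fun n : ℕ => T * (1 / 2 : ℝ) ^ n) atTop (𝓝 (T * 0)) :=
          (tendsto_pow_atTop_nhds_zero_of_lt_one (by norm_num) (by norm_num)).const_mul T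
        simpa [div_eq_mul_inv] using this.const_sub z
      refine tendsto_of_tendsto_of_tendsto_of_le_of_le hsq tendsto_const_nhds (fun n => ?_)
        (fun n => ?_)
      · have h2 : z * 2 ^ n / T < (⌊z * 2 ^ n / T⌋₊ : ℝ) + 1 := Nat.lt_floor_add_one _
        have h3 : z = z * 2 ^ n / T * (T / 2 ^ n) := by field_simp
        have h4 : (0 : ℝ) < T / 2 ^ n := by positivity
        simp only [p]
        nlinarith
      · have h1 : (⌊z * 2 ^ n / T⌋₊ : ℝ) ≤ z * 2 ^ n / T := Nat.floor_le (by positivity)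
        have h3 : z = z * 2 ^ n / T * (T / 2 ^ n) := by field_simp
        have h4 : (0 : ℝ) < T / 2 ^ n := by positivity
        simp only [p]
        nlinarith
    exact dist_le_of_le_geometric_of_tendsto ρ A hρ1 hstep hlim n
  -- the dyadic scale of `y - x`
  obtain ⟨n, hn1, hn2⟩ := exists_nat_pow_near_of_lt_one (x := (y - x) / T) (y := (1 / 2 : ℝ))
    (div_pos (by linarith) hT) ((div_le_one hT).2 (by linarith)) (by norm_num) (by norm_num)
  have hmid : |g (p n y) - g (p n x)| ≤ A * ρ ^ n := by
    have hyx : y * 2 ^ n / T ≤ x * 2 ^ n / T + 1 := by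
      have : (y - x) / T * 2 ^ n ≤ 1 := by
        calc (y - x) / T * 2 ^ n ≤ (1 / 2) ^ n * 2 ^ n := by gcongr
          _ = 1 := by rw [← mul_pow]; norm_num
      calc y * 2 ^ n / T = x * 2 ^ n / T + (y - x) / T * 2 ^ n := by ring
        _ ≤ _ := by gcongr
    have hx0 : 0 ≤ x * 2 ^ n / T := by positivity
    have h1 : ⌊y * 2 ^ n / T⌋₊ ≤ ⌊x * 2 ^ n / T⌋₊ + 1 := by
      rw [← Nat.floor_add_one hx0]; exact Nat.floor_mono hyx
    have h2 : ⌊x * 2 ^ n / T⌋₊ ≤ ⌊y * 2 ^ n / T⌋₊ := by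
      apply Nat.floor_mono; gcongr
    have h3 : ⌊y * 2 ^ n / T⌋₊ = ⌊x * 2 ^ n / T⌋₊ ∨
        ⌊y * 2 ^ n / T⌋₊ = ⌊x * 2 ^ n / T⌋₊ + 1 := by omega
    rcases h3 with h3 | h3
    · simp only [p, h3, sub_self, abs_zero]; positivity
    · have h4 : ⌊x * 2 ^ n / T⌋₊ < 2 ^ n := by
        have h5 : (⌊y * 2 ^ n / T⌋₊ : ℝ) ≤ y * 2 ^ n / T :=
          Nat.floor_le (by have : 0 ≤ y := by linarith
                           positivity)
        have h6 : y * 2 ^ n / T ≤ 2 ^ n := by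
          rw [div_le_iff₀ hT]; nlinarith [pow_pos (two_pos : (0 : ℝ) < 2) n]
        have h7 : ⌊y * 2 ^ n / T⌋₊ ≤ 2 ^ n := by exact_mod_cast h5.trans h6
        omega
      simp only [p, h3]
      exact h n _ h4
  have hx' := happ x hx (by linarith) n
  have hy' := happ y (by linarith) hy n
  have hρn : ρ ^ n ≤ (2 / T) ^ γ * (y - x) ^ γ := by
    have e1 : ρ ^ n = ((1 / 2 : ℝ) ^ n) ^ γ := by
      rw [hρ, ← Real.rpow_natCast, ← Real.rpow_natCast, ← Real.rpow_mul (by norm_num),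
        ← Real.rpow_mul (by norm_num), mul_comm]
    rw [e1, ← Real.mul_rpow (by positivity) (by linarith)]
    refine Real.rpow_le_rpow (by positivity) ?_ hγ.le
    rw [pow_succ] at hn1
    calc (1 / 2 : ℝ) ^ n ≤ 2 * ((y - x) / T) := by linarith
      _ = _ := by ring
  have hsum : |g x - g y| ≤ (1 + 2 / (1 - ρ)) * (A * ρ ^ n) := by
    have e : g x - g y = -(g (p n x) - g x) - (g (p n y) - g (p n x)) + (g (p n y) - g y) := by
      ring
    have h0 : |g x - g y| ≤ |g (p n x) - g x| + |g (p n y) - g (p n x)| + |g (p n y) - g y| := by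
      rw [e]
      refine (abs_add_le _ _).trans ?_
      gcongr
      refine (abs_sub _ _).trans ?_
      rw [abs_neg]
    calc _ ≤ A * ρ ^ n / (1 - ρ) + A * ρ ^ n + A * ρ ^ n / (1 - ρ) := by linarith
      _ = _ := by ring
  refine hsum.trans ?_
  have : 0 ≤ 2 / (1 - ρ) := div_nonneg (by norm_num) (by linarith)
  calc (1 + 2 / (1 - ρ)) * (A * ρ ^ n)
      ≤ (1 + 2 / (1 - ρ)) * (A * ((2 / T) ^ γ * (y - x) ^ γ)) := by gcongr
    _ = _ := by ring

/-- A function that is Hölder of order `γ > 1 - σ` has finite seminorm `‖·‖_{σ,0,T}`. -/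
lemma seminormZero_le_of_holder {σ T γ : ℝ} (hγ : 1 - σ < γ) :
    ∃ c : ℝ≥0, ∀ (g : ℝ → ℝ) (K : ℝ), 0 ≤ K →
      (∀ x y, 0 ≤ x → x < y → y ≤ T → |g x - g y| ≤ K * (y - x) ^ γ) →
      seminormZero σ T g ≤ c * ENNReal.ofReal K := by
  refine ⟨(|T| ^ (γ - (1 - σ)) + |T| ^ (γ - (1 - σ)) / (γ - (1 - σ))).toNNReal,
    fun g K hK h => ?_⟩
  have hδ : 0 < γ - (1 - σ) := by linarith
  unfold seminormZero
  refine iSup₂_le fun u v => iSup_le fun hu => iSup_le fun huv => iSup_le fun hv => ?_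
  have huT : v - u ≤ |T| := (by linarith : v - u ≤ T).trans (le_abs_self T)
  have hpow : (v - u) ^ (γ - (1 - σ)) ≤ |T| ^ (γ - (1 - σ)) :=
    Real.rpow_le_rpow (by linarith) huT hδ.le
  have h1 : |g u - g v| / (v - u) ^ (1 - σ) ≤ K * |T| ^ (γ - (1 - σ)) := by
    rw [div_le_iff₀ (Real.rpow_pos_of_pos (by linarith) _)]
    calc |g u - g v| ≤ K * (v - u) ^ γ := h u v hu huv hv
      _ = K * (v - u) ^ (γ - (1 - σ)) * (v - u) ^ (1 - σ) := by
        rw [mul_assoc, ← Real.rpow_add (by linarith)]; congr 2; ring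
      _ ≤ _ := by
        have : 0 ≤ (v - u) ^ (1 - σ) := Real.rpow_nonneg (by linarith) _
        gcongr
  have h2 : ∫⁻ z in Set.Ioo u v, ENNReal.ofReal (|g u - g z| / (z - u) ^ (2 - σ)) ≤
      ENNReal.ofReal (K * (|T| ^ (γ - (1 - σ)) / (γ - (1 - σ)))) := by
    calc _ ≤ ∫⁻ z in Set.Ioo u v, ENNReal.ofReal K *
          ENNReal.ofReal ((z - u) ^ (γ - (1 - σ) - 1)) := by
          refine setLIntegral_mono' measurableSet_Ioo fun z hz => ?_
          rw [← ENNReal.ofReal_mul hK]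
          apply ENNReal.ofReal_le_ofReal
          have hz' : 0 < z - u := by linarith [hz.1]
          rw [div_le_iff₀ (Real.rpow_pos_of_pos hz' _), mul_assoc, ← Real.rpow_add hz']
          rw [show γ - (1 - σ) - 1 + (2 - σ) = γ by ring]
          exact h u z hu hz.1 (hz.2.le.trans hv)
      _ = ENNReal.ofReal K * ENNReal.ofReal ((v - u) ^ (γ - (1 - σ)) / (γ - (1 - σ))) := by
          rw [lintegral_const_mul' _ _ (by finiteness),
            lintegral_rpow_Ioo huv.le (by linarith)]
          norm_num
      _ ≤ _ := by
          rw [← ENNReal.ofReal_mul hK]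
          apply ENNReal.ofReal_le_ofReal
          gcongr
  calc _ ≤ ENNReal.ofReal (K * |T| ^ (γ - (1 - σ))) +
        ENNReal.ofReal (K * (|T| ^ (γ - (1 - σ)) / (γ - (1 - σ)))) :=
        add_le_add (ENNReal.ofReal_le_ofReal h1) h2
    _ = _ := by
        rw [← ENNReal.ofReal_add (by positivity) (by positivity), ← mul_add,
          ENNReal.ofReal_mul hK, mul_comm]
        rfl

section

variable {Ω : Type*} [MeasurableSpace Ω] {P : Measure Ω} {H : ℝ} {B : ℝ≥0 → Ω → ℝ}

/-- The increments are Gaussian, and the covariance gives their variance. -/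
lemma IsFBM.map_increment (hB : IsFBM H B P) (hH : 0 < H) (s t : ℝ≥0) :
    P.map (fun ω => B t ω - B s ω) = gaussianReal 0 (|(t : ℝ) - s| ^ (2 * H)).toNNReal := by
  have hg : HasGaussianLaw (fun ω => B t ω - B s ω) P := hB.gaussian.hasGaussianLaw_fun_sub
  have i : ∀ t, Integrable (B t) P := fun t => (hB.gaussian.hasGaussianLaw_eval t).integrable
  have l2 : ∀ t, MemLp (B t) 2 P := fun t => (hB.gaussian.hasGaussianLaw_eval t).memLp_two
  have := hB.gaussian.isProbabilityMeasure
  have hmean : ∫ ω, (B t ω - B s ω) ∂P = 0 := by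
    rw [integral_sub (i t) (i s), hB.centered, hB.centered, sub_zero]
  have h0 : (0 : ℝ) ^ (2 * H) = 0 := Real.zero_rpow (by positivity)
  rw [hg.map_eq_gaussianReal, hmean, variance_of_integral_eq_zero hg.aemeasurable hmean]
  congr 2
  have e : ∀ ω, (B t ω - B s ω) ^ 2 = B t ω * B t ω - 2 * (B t ω * B s ω) + B s ω * B s ω :=
    fun ω => by ring
  simp_rw [e]
  rw [integral_add, integral_sub, integral_const_mul, hB.covariance, hB.covariance, hB.covariance]
  · simp only [sub_self, abs_zero, h0]
    ring
  · exact (l2 t).integrable_mul (l2 t)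
  · exact ((l2 t).integrable_mul (l2 s)).const_mul 2
  · exact ((l2 t).integrable_mul (l2 t)).sub (((l2 t).integrable_mul (l2 s)).const_mul 2)
  · exact (l2 s).integrable_mul (l2 s)

lemma IsFBM.lintegral_increment (hB : IsFBM H B P) (hH : 0 < H) (s t : ℝ≥0) (p : ℕ) :
    ∫⁻ ω, ‖B t ω - B s ω‖ₑ ^ p ∂P =
      ENNReal.ofReal (|(t : ℝ) - s| ^ H) ^ p * ∫⁻ x, ‖x‖ₑ ^ p ∂(gaussianReal 0 1) := by
  have hg : HasGaussianLaw (fun ω => B t ω - B s ω) P := hB.gaussian.hasGaussianLaw_fun_sub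
  have hm : Measurable fun x : ℝ => ‖x‖ₑ ^ p := by fun_prop
  have h1 := lintegral_map' (μ := P) (g := fun ω => B t ω - B s ω) hm.aemeasurable hg.aemeasurable
  rw [← h1, hB.map_increment hH]
  have h2 := gaussianReal_map_const_mul (μ := 0) (v := 1) (|(t : ℝ) - s| ^ H)
  have h3 : (|(t : ℝ) - s| ^ (2 * H)).toNNReal =
      (.mk ((|(t : ℝ) - s| ^ H) ^ 2) (sq_nonneg _) : ℝ≥0) * 1 := by
    ext
    rw [Real.coe_toNNReal _ (by positivity), mul_one, NNReal.coe_mk, mul_comm,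
      Real.rpow_mul (abs_nonneg _), Real.rpow_two]
  rw [mul_zero] at h2
  rw [h3, ← h2, lintegral_map hm (by fun_prop),
    ← lintegral_const_mul' _ _ (by finiteness)]
  refine lintegral_congr fun x => ?_
  rw [enorm_mul, mul_pow, Real.enorm_of_nonneg (by positivity)]

lemma lintegral_gaussian_pow_lt_top (p : ℕ) : ∫⁻ x, ‖x‖ₑ ^ p ∂(gaussianReal 0 1) < ⊤ := by
  have h := (memLp_id_gaussianReal (μ := 0) (v := 1) p).eLpNorm_lt_top
  rcases Nat.eq_zero_or_pos p with rfl | hp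
  · simp
  · rw [eLpNorm_lt_top_iff_lintegral_rpow_enorm_lt_top (by simpa using hp.ne') (by simp)] at h
    simpa using h

/-- The seminorm `‖·‖_{σ,0,T}` of the paths of a fractional Brownian motion of Hurst index
`H > 1 - σ` is bounded by a random variable whose expectation has a bound that does not depend on
the process. -/
lemma exists_seminormZero_le {σ T : ℝ} (P : Measure Ω) [IsProbabilityMeasure P]
    (hT : 0 < T) (hH : 0 < H) (hσ : σ < 1) (hσH : 1 - σ < H) :
    ∃ K : ℝ≥0∞, K < ⊤ ∧ ∀ B : ℝ≥0 → Ω → ℝ, IsFBM H B P → ∃ S : Ω → ℝ≥0∞, AEMeasurable S P ∧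
      ∫⁻ ω, S ω ∂P ≤ K ∧ ∀ ω, (Continuous fun t => B t ω) →
        seminormZero σ T (path B ω) ≤ S ω := by
  obtain ⟨γ, hγ1, hγ2⟩ := exists_between hσH
  have hγ : 0 < γ := by linarith
  -- with this moment `p`, the expected `p`-th powers of the scaled increments at level `n` sum up
  -- to a multiple of `2 ^ n * (2 ^ (-n (H - γ))) ^ p`, a convergent geometric series
  obtain ⟨p, hp⟩ := exists_nat_gt (1 / (H - γ))
  have hp0 : p ≠ 0 := by
    rintro rfl
    have : 0 < 1 / (H - γ) := by have := sub_pos.2 hγ2; positivity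
    simp at hp; linarith
  have hpH : 1 < p * (H - γ) := by rwa [div_lt_iff₀ (by linarith)] at hp
  obtain ⟨c, hc⟩ := seminormZero_le_of_holder (T := T) hγ1
  set ρ : ℝ := (1 / 2 : ℝ) ^ γ with hρ
  have hρ0 : 0 < ρ := by positivity
  have hρ1 : ρ < 1 := Real.rpow_lt_one (by norm_num) (by norm_num) hγ
  set M : ℝ := (1 + 2 / (1 - ρ)) * (2 / T) ^ γ with hM
  have hM0 : 0 < M := by
    have : 0 ≤ 2 / (1 - ρ) := div_nonneg (by norm_num) (by linarith)
    positivity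
  set m := ∫⁻ x, ‖x‖ₑ ^ p ∂(gaussianReal 0 1) with hm
  set q : ℝ := 2 * ((1 / 2 : ℝ) ^ (H - γ)) ^ p with hq
  have hq0 : 0 ≤ q := by positivity
  have hq1 : q < 1 := by
    have : ((1 / 2 : ℝ) ^ (H - γ)) ^ p < (1 / 2) ^ (1 : ℝ) := by
      rw [← Real.rpow_natCast, ← Real.rpow_mul (by norm_num)]
      exact Real.rpow_lt_rpow_of_exponent_gt (by norm_num) (by norm_num) (by linarith)
    rw [Real.rpow_one] at this
    linarith
  set D := ENNReal.ofReal ((T ^ H) ^ p) * m * ∑' n : ℕ, ENNReal.ofReal q ^ n with hD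
  have hDtop : D < ⊤ := by
    have h1 : ENNReal.ofReal q < 1 := by
      rw [← ENNReal.ofReal_one]; exact (ENNReal.ofReal_lt_ofReal_iff one_pos).2 hq1
    have h2 : (1 - ENNReal.ofReal q)⁻¹ < ⊤ := ENNReal.inv_lt_top.2 (tsub_pos_of_lt h1)
    rw [hD, ENNReal.tsum_geometric]
    exact ENNReal.mul_lt_top (ENNReal.mul_lt_top (by finiteness) (lintegral_gaussian_pow_lt_top p))
      h2
  -- `c + 1` instead of `c`, so that the bound is infinite where the dyadic sum is
  refine ⟨(c + 1) * ENNReal.ofReal M * (1 + D), by finiteness, fun B hB => ?_⟩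
  let t : ℕ → ℕ → ℝ≥0 := fun n k => .mk (k * (T / 2 ^ n)) (by positivity)
  have ht : ∀ n k, (t n k : ℝ) = k * (T / 2 ^ n) := fun _ _ => rfl
  let S : Ω → ℝ≥0∞ := fun ω => ∑' n : ℕ, ∑ k ∈ Finset.range (2 ^ n),
    (ENNReal.ofReal ((ρ ^ n)⁻¹) * ‖B (t n (k + 1)) ω - B (t n k) ω‖ₑ) ^ p
  have hterm : ∀ n k, AEMeasurable
      (fun ω => (ENNReal.ofReal ((ρ ^ n)⁻¹) * ‖B (t n (k + 1)) ω - B (t n k) ω‖ₑ) ^ p) P := by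
    intro n k
    have h1 := hB.gaussian.aemeasurable (t n (k + 1))
    have h2 := hB.gaussian.aemeasurable (t n k)
    exact ((h1.sub h2).enorm.const_mul _).pow_const _
  have hSm : AEMeasurable S P :=
    AEMeasurable.tsum fun n => Finset.aemeasurable_fun_sum _ fun k _ => hterm n k
  refine ⟨fun ω => (c + 1) * ENNReal.ofReal M * (1 + S ω), (hSm.const_add 1).const_mul _, ?_, ?_⟩
  · rw [lintegral_const_mul' _ _ (by finiteness), lintegral_add_left measurable_const]
    simp only [lintegral_const, measure_univ, mul_one]
    gcongr
    rw [lintegral_tsum fun n => Finset.aemeasurable_fun_sum _ fun k _ => hterm n k, hD,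
      ← ENNReal.tsum_mul_left]
    refine ENNReal.tsum_le_tsum fun n => ?_
    rw [lintegral_finsetSum' _ fun k _ => hterm n k]
    have hinc : ∀ k, ∫⁻ ω, (ENNReal.ofReal ((ρ ^ n)⁻¹) *
        ‖B (t n (k + 1)) ω - B (t n k) ω‖ₑ) ^ p ∂P =
        ENNReal.ofReal (((ρ ^ n)⁻¹ * (T / 2 ^ n) ^ H) ^ p) * m := by
      intro k
      simp_rw [mul_pow]
      rw [lintegral_const_mul' _ _ (by finiteness), hB.lintegral_increment hH, ← hm, ← mul_assoc,
        ENNReal.ofReal_mul (by positivity), ENNReal.ofReal_pow (by positivity),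
        ENNReal.ofReal_pow (by positivity)]
      congr 4
      rw [ht, ht]
      push_cast
      rw [← sub_mul, add_sub_cancel_left, one_mul, abs_of_pos (by positivity)]
    simp_rw [hinc]
    rw [Finset.sum_const, Finset.card_range, nsmul_eq_mul, ← ENNReal.ofReal_pow hq0, mul_right_comm,
      ← mul_assoc, ← ENNReal.ofReal_mul (by positivity), ← ENNReal.ofReal_natCast (2 ^ n),
      ← ENNReal.ofReal_mul (by positivity)]
    apply le_of_eq
    congr 2
    have e1 : (T / 2 ^ n) ^ H = T ^ H * ((1 / 2 : ℝ) ^ H) ^ n := by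
      rw [Real.div_rpow hT.le (by positivity), ← Real.rpow_natCast ((1 / 2 : ℝ) ^ H),
        ← Real.rpow_mul (by norm_num), mul_comm H, Real.rpow_mul (by norm_num), Real.rpow_natCast,
        one_div_pow, Real.div_rpow one_pos.le (by positivity), Real.one_rpow]
      ring
    have e2 : (1 / 2 : ℝ) ^ (H - γ) = ρ⁻¹ * (1 / 2) ^ H := by
      rw [Real.rpow_sub (by norm_num), hρ]; ring
    rw [e1, hq, e2]
    push_cast
    ring
  · intro ω hω
    rcases eq_or_ne (S ω) ⊤ with hS | hS
    · simp only [hS, add_top]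
      rw [ENNReal.mul_top (mul_ne_zero (by simp) (by simpa using hM0))]
      exact le_top
    have hcont : Continuous (path B ω) := hω.comp continuous_real_toNNReal
    have hA : 0 ≤ 1 + (S ω).toReal := by positivity
    have hdy : ∀ n k : ℕ, k < 2 ^ n →
        |path B ω ((k + 1 : ℕ) * (T / 2 ^ n)) - path B ω (k * (T / 2 ^ n))| ≤
          (1 + (S ω).toReal) * ρ ^ n := by
      intro n k hk
      have hle : (ENNReal.ofReal ((ρ ^ n)⁻¹) * ‖B (t n (k + 1)) ω - B (t n k) ω‖ₑ) ^ p ≤ S ω :=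
        (Finset.single_le_sum (f := fun k => (ENNReal.ofReal ((ρ ^ n)⁻¹) *
          ‖B (t n (k + 1)) ω - B (t n k) ω‖ₑ) ^ p) (fun _ _ => zero_le)
          (Finset.mem_range.2 hk)).trans (ENNReal.le_tsum n)
      have htp : ∀ k : ℕ, path B ω (k * (T / 2 ^ n)) = B (t n k) ω := by
        intro k
        simp only [path]
        congr 1
        ext
        rw [ht]
        exact Real.coe_toNNReal _ (by positivity)
      rw [htp, htp]
      set d := B (t n (k + 1)) ω - B (t n k) ω
      have h1 : ((ρ ^ n)⁻¹ * |d|) ^ p ≤ (S ω).toReal := by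
        rw [← ENNReal.ofReal_le_iff_le_toReal hS, ENNReal.ofReal_pow (by positivity),
          ENNReal.ofReal_mul (by positivity), ← Real.enorm_eq_ofReal_abs]
        exact hle
      have h2 : (ρ ^ n)⁻¹ * |d| ≤ 1 + (S ω).toReal := by
        rcases le_total ((ρ ^ n)⁻¹ * |d|) 1 with h | h
        · linarith [ENNReal.toReal_nonneg (a := S ω)]
        · linarith [le_self_pow₀ h hp0]
      rwa [inv_mul_le_iff₀ (by positivity), mul_comm] at h2
    have hh := hc (path B ω) (M * (1 + (S ω).toReal)) (by positivity) fun x y hx hxy hy =>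
      holder_of_dyadic hT hγ hcont hA hdy hx hxy hy
    refine hh.trans ?_
    rw [ENNReal.ofReal_mul hM0.le, ENNReal.ofReal_add one_pos.le ENNReal.toReal_nonneg,
      ENNReal.ofReal_toReal hS, ENNReal.ofReal_one, ← mul_assoc]
    exact mul_le_mul' (mul_le_mul' le_self_add le_rfl) le_rfl

/-- Almost surely `ξ` is finite, because it has an integrable majorant. -/
lemma ae_xi_lt_top {σ T : ℝ} [IsProbabilityMeasure P] (hT : 0 < T) (hH : 0 < H) (hσ : σ < 1)
    (hσH : 1 - σ < H) {lam : ℕ → ℝ} (hlam : Summable lam)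
    {B : ℕ → ℝ≥0 → Ω → ℝ} (hB : ∀ j, IsFBM H (B j) P) :
    ∀ᵐ ω ∂P, xi σ T lam (fun j => path (B j) ω) < ⊤ := by
  obtain ⟨K, hK, h⟩ := exists_seminormZero_le P hT hH hσ hσH
  choose S hSm hSK hS using fun j => h (B j) (hB j)
  have hm : ∀ j, AEMeasurable (fun ω => ENNReal.ofReal (lam j) * S j ω) P :=
    fun j => (hSm j).const_mul _
  have hint : ∫⁻ ω, ∑' j, ENNReal.ofReal (lam j) * S j ω ∂P ≠ ⊤ := by
    rw [lintegral_tsum hm]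
    have hb : ∑' j, ENNReal.ofReal (lam j) * K ≠ ⊤ := by
      rw [ENNReal.tsum_mul_right]
      exact ENNReal.mul_ne_top (hlam.tsum_ofReal_ne_top) hK.ne
    refine ne_top_of_le_ne_top hb (ENNReal.tsum_le_tsum fun j => ?_)
    rw [lintegral_const_mul' _ _ (by finiteness)]
    gcongr
    exact hSK j
  filter_upwards [ae_lt_top' (AEMeasurable.tsum hm) hint,
    ae_all_iff.2 fun j => (hB j).continuous_paths] with ω hω hc
  refine lt_of_le_of_lt (ENNReal.tsum_le_tsum fun j => ?_) hω
  gcongr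
  exact hS j ω (hc j)

end

/-! ### The Gaussian kernel and its differences in time -/

/-- The function `r ↦ r ^ p * exp (-z² / (2r))`; the heat kernel is a multiple of the case
`p = -1/2`, and the derivative in `r` of a member of the family is a combination of two others. -/
noncomputable def heatPow (p z r : ℝ) : ℝ := r ^ p * Real.exp (-z ^ 2 / (2 * r))

lemma hasDerivAt_heatPow (p z : ℝ) {r : ℝ} (hr : 0 < r) :
    HasDerivAt (heatPow p z) (p * heatPow (p - 1) z r + z ^ 2 / 2 * heatPow (p - 2) z r) r := by
  have h1 := Real.hasDerivAt_rpow_const (x := r) (p := p) (Or.inl hr.ne')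
  have h2 : HasDerivAt (fun r => -z ^ 2 / (2 * r)) (z ^ 2 / 2 * (r ^ 2)⁻¹) r := by
    have := ((hasDerivAt_inv hr.ne').const_mul (-z ^ 2 / 2))
    refine (this.congr_deriv ?_).congr_of_eventuallyEq (Eventually.of_forall fun s => ?_)
    · ring
    · simp only; rw [mul_comm 2 s, div_mul_eq_div_div_swap]; ring
  refine (h1.mul h2.exp).congr_deriv ?_
  simp only [heatPow]
  rw [Real.rpow_sub hr p 2, Real.rpow_two]
  ring

lemma abs_heatPow_le {p z r ρ : ℝ} (hp : p ≤ 0) (hr : 0 < r) (h1 : r ≤ ρ) (h2 : ρ ≤ 3 * r) :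
    |heatPow p z ρ| ≤ r ^ p * (Real.exp (-z ^ 2 / (12 * r)) * Real.exp (-z ^ 2 / (12 * r))) := by
  have hρ : 0 < ρ := by linarith
  rw [heatPow, abs_of_nonneg (by positivity), ← Real.exp_add]
  have e : -z ^ 2 / (2 * ρ) ≤ -z ^ 2 / (12 * r) + -z ^ 2 / (12 * r) := by
    have : z ^ 2 / (6 * r) ≤ z ^ 2 / (2 * ρ) :=
      div_le_div_of_nonneg_left (sq_nonneg z) (by positivity) (by linarith)
    calc -z ^ 2 / (2 * ρ) = -(z ^ 2 / (2 * ρ)) := by ring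
      _ ≤ -(z ^ 2 / (6 * r)) := by linarith
      _ = _ := by field_simp; ring
  exact mul_le_mul (Real.rpow_le_rpow_of_nonpos hr h1 hp) (Real.exp_le_exp.2 e)
    (Real.exp_pos _).le (by positivity)

/-- The square of a Gaussian with variance of order `r` absorbs the polynomial factors produced by
differentiation. -/
lemma sq_mul_exp_le {z r : ℝ} (hr : 0 < r) :
    z ^ 2 * Real.exp (-z ^ 2 / (12 * r)) ≤ 12 * r ∧
      z ^ 4 * Real.exp (-z ^ 2 / (12 * r)) ≤ 288 * r ^ 2 := by
  set q := z ^ 2 / (12 * r) with hq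
  have hq0 : 0 ≤ q := by positivity
  have hz : z ^ 2 = 12 * r * q := by rw [hq]; field_simp
  have hneg : -z ^ 2 / (12 * r) = -q := by rw [hq]; ring
  have h1 : q ≤ Real.exp q := by linarith [Real.add_one_le_exp q]
  have h2 : q ^ 2 / 2 ≤ Real.exp q := by linarith [Real.quadratic_le_exp_of_nonneg hq0]
  have h3 : Real.exp q * Real.exp (-q) = 1 := by rw [← Real.exp_add]; simp
  have h4 : 0 < Real.exp (-q) := Real.exp_pos _
  rw [hneg, show z ^ 4 = (z ^ 2) ^ 2 by ring, hz]
  constructor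
  · calc 12 * r * q * Real.exp (-q) ≤ 12 * r * Real.exp q * Real.exp (-q) := by gcongr
      _ = 12 * r * (Real.exp q * Real.exp (-q)) := by ring
      _ = _ := by rw [h3, mul_one]
  · calc (12 * r * q) ^ 2 * Real.exp (-q) = 288 * r ^ 2 * (q ^ 2 / 2) * Real.exp (-q) := by ring
      _ ≤ 288 * r ^ 2 * Real.exp q * Real.exp (-q) := by gcongr
      _ = 288 * r ^ 2 * (Real.exp q * Real.exp (-q)) := by ring
      _ = _ := by rw [h3, mul_one]

/-- A Gaussian majorant of the heat kernel at time `r` and, up to the natural powers of `r`, of its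
first two derivatives in time on `[r, 3r]`. -/
noncomputable def gaussMaj (r z : ℝ) : ℝ := r ^ (-(1 / 2) : ℝ) * Real.exp (-z ^ 2 / (12 * r))

lemma gaussMaj_nonneg {r : ℝ} (hr : 0 ≤ r) (z : ℝ) : 0 ≤ gaussMaj r z := by
  unfold gaussMaj; positivity

/-- The first derivative in time of the heat kernel. The constant `91` is the one needed for the
second derivative, and serves in all bounds for the kernel. -/
lemma abs_heatPow_deriv_le {z r ρ : ℝ} (hr : 0 < r) (h1 : r ≤ ρ) (h2 : ρ ≤ 3 * r) :
    |-(1 / 2) * heatPow (-(1 / 2) - 1) z ρ + z ^ 2 / 2 * heatPow (-(1 / 2) - 2) z ρ| ≤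
      91 / r * gaussMaj r z := by
  have hA := abs_heatPow_le (p := -(1 / 2) - 1) (z := z) (by norm_num) hr h1 h2
  have hB := abs_heatPow_le (p := -(1 / 2) - 2) (z := z) (by norm_num) hr h1 h2
  obtain ⟨hz, -⟩ := sq_mul_exp_le (z := z) hr
  rw [Real.rpow_sub hr, Real.rpow_one] at hA
  rw [Real.rpow_sub hr, Real.rpow_two] at hB
  unfold gaussMaj
  set E := Real.exp (-z ^ 2 / (12 * r))
  set R := r ^ (-(1 / 2) : ℝ)
  have hR : 0 < R := by positivity
  have hE : 0 < E := Real.exp_pos _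
  have hE1 : E ≤ 1 := Real.exp_le_one_iff.2 (by rw [neg_div]; simp; positivity)
  calc _ ≤ 1 / 2 * |heatPow (-(1 / 2) - 1) z ρ| + z ^ 2 / 2 * |heatPow (-(1 / 2) - 2) z ρ| := by
        refine (abs_add_le _ _).trans ?_
        rw [abs_mul, abs_mul, abs_neg, abs_of_pos (by norm_num : (0 : ℝ) < 1 / 2),
          abs_of_nonneg (by positivity : 0 ≤ z ^ 2 / 2)]
    _ ≤ 1 / 2 * (R / r * (E * E)) + z ^ 2 / 2 * (R / r ^ 2 * (E * E)) := by gcongr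
    _ = (1 / 2 * (R / r)) * E * E + (z ^ 2 * E) / 2 * (R / r ^ 2) * E := by ring
    _ ≤ (1 / 2 * (R / r)) * E * 1 + (12 * r) / 2 * (R / r ^ 2) * E := by gcongr
    _ = (13 / 2) / r * (R * E) := by field_simp; ring
    _ ≤ 91 / r * (R * E) := by gcongr; norm_num

/-- An increment of the first derivative in time, by the mean value theorem and a bound for the
second derivative. -/
lemma abs_heatPow_deriv_sub_le {z r ρ b : ℝ} (hr : 0 < r) (h1 : r ≤ ρ) (hb : 0 ≤ b)
    (h2 : ρ + b ≤ 3 * r) :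
    |(-(1 / 2) * heatPow (-(1 / 2) - 1) z (ρ + b) +
        z ^ 2 / 2 * heatPow (-(1 / 2) - 2) z (ρ + b)) -
      (-(1 / 2) * heatPow (-(1 / 2) - 1) z ρ + z ^ 2 / 2 * heatPow (-(1 / 2) - 2) z ρ)| ≤
      91 / r ^ 2 * gaussMaj r z * b := by
  have key := Convex.norm_image_sub_le_of_norm_hasDerivWithin_le (𝕜 := ℝ)
    (f := fun s => -(1 / 2) * heatPow (-(1 / 2) - 1) z s + z ^ 2 / 2 * heatPow (-(1 / 2) - 2) z s)
    (s := Set.Icc ρ (ρ + b)) (x := ρ) (y := ρ + b) (C := 91 / r ^ 2 * gaussMaj r z)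
    (fun s hs => (((hasDerivAt_heatPow _ z (by linarith [hs.1])).const_mul _).add
      ((hasDerivAt_heatPow _ z (by linarith [hs.1])).const_mul _)).hasDerivWithinAt)
    ?_ (convex_Icc _ _) ⟨le_rfl, by linarith⟩ ⟨by linarith, le_rfl⟩
  · simpa [abs_of_nonneg hb] using key
  intro s hs
  have hs1 : r ≤ s := h1.trans hs.1
  have hs2 : s ≤ 3 * r := hs.2.trans h2
  have hA := abs_heatPow_le (p := -(1 / 2) - 2) (z := z) (by norm_num) hr hs1 hs2
  have hB := abs_heatPow_le (p := -(1 / 2) - 3) (z := z) (by norm_num) hr hs1 hs2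
  have hC := abs_heatPow_le (p := -(1 / 2) - 4) (z := z) (by norm_num) hr hs1 hs2
  obtain ⟨hz, hz4⟩ := sq_mul_exp_le (z := z) hr
  rw [Real.rpow_sub hr, Real.rpow_two] at hA
  rw [Real.rpow_sub hr, Real.rpow_ofNat] at hB hC
  have i1 : (-(1 / 2) - 1 - 1 : ℝ) = -(1 / 2) - 2 := by norm_num
  have i2 : (-(1 / 2) - 1 - 2 : ℝ) = -(1 / 2) - 3 := by norm_num
  have i3 : (-(1 / 2) - 2 - 1 : ℝ) = -(1 / 2) - 3 := by norm_num
  have i4 : (-(1 / 2) - 2 - 2 : ℝ) = -(1 / 2) - 4 := by norm_num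
  rw [i1, i2, i3, i4, Real.norm_eq_abs]
  unfold gaussMaj
  set E := Real.exp (-z ^ 2 / (12 * r))
  set R := r ^ (-(1 / 2) : ℝ)
  set A := heatPow (-(1 / 2) - 2) z s
  set B := heatPow (-(1 / 2) - 3) z s
  set D := heatPow (-(1 / 2) - 4) z s
  have hR : 0 < R := by positivity
  have hE : 0 < E := Real.exp_pos _
  have hE1 : E ≤ 1 := Real.exp_le_one_iff.2 (by rw [neg_div]; simp; positivity)
  calc _ = |3 / 4 * A + -(3 / 2 * z ^ 2 * B) + z ^ 4 / 4 * D| := by congr 1; ring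
    _ ≤ 3 / 4 * |A| + 3 / 2 * z ^ 2 * |B| + z ^ 4 / 4 * |D| := by
        refine (abs_add_le _ _).trans (add_le_add ((abs_add_le _ _).trans (add_le_add ?_ ?_)) ?_)
        · rw [abs_mul, abs_of_pos (by norm_num : (0 : ℝ) < 3 / 4)]
        · rw [abs_neg, abs_mul, abs_of_nonneg (by positivity : 0 ≤ 3 / 2 * z ^ 2)]
        · rw [abs_mul, abs_of_nonneg (by positivity : 0 ≤ z ^ 4 / 4)]
    _ ≤ 3 / 4 * (R / r ^ 2 * (E * E)) + 3 / 2 * z ^ 2 * (R / r ^ 3 * (E * E)) +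
        z ^ 4 / 4 * (R / r ^ 4 * (E * E)) := by gcongr
    _ = 3 / 4 * (R / r ^ 2) * E * E + 3 / 2 * (z ^ 2 * E) * (R / r ^ 3) * E +
        (z ^ 4 * E) / 4 * (R / r ^ 4) * E := by ring
    _ ≤ 3 / 4 * (R / r ^ 2) * E * 1 + 3 / 2 * (12 * r) * (R / r ^ 3) * E +
        (288 * r ^ 2) / 4 * (R / r ^ 4) * E := by gcongr
    _ = (363 / 4) / r ^ 2 * (R * E) := by field_simp; ring
    _ ≤ 91 / r ^ 2 * (R * E) := by gcongr; norm_num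

lemma abs_heatPow_zero_le {z r : ℝ} (hr : 0 < r) :
    |heatPow (-(1 / 2)) z r| ≤ 91 * gaussMaj r z := by
  have h := abs_heatPow_le (p := -(1 / 2)) (z := z) (by norm_num) hr le_rfl (by linarith)
  have hE1 : Real.exp (-z ^ 2 / (12 * r)) ≤ 1 :=
    Real.exp_le_one_iff.2 (by rw [neg_div]; simp; positivity)
  unfold gaussMaj
  set E := Real.exp (-z ^ 2 / (12 * r))
  have hE : 0 < E := Real.exp_pos _
  have hR : 0 < r ^ (-(1 / 2) : ℝ) := by positivity
  calc _ ≤ _ := h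
    _ ≤ r ^ (-(1 / 2) : ℝ) * (E * 1) := by gcongr
    _ ≤ _ := by rw [mul_one]; nlinarith [mul_pos hR hE]

lemma abs_heatPow_sub_le {z r a : ℝ} (hr : 0 < r) (ha : 0 ≤ a) (har : a ≤ r) :
    |heatPow (-(1 / 2)) z r - heatPow (-(1 / 2)) z (r + a)| ≤ 91 * (a / r) * gaussMaj r z := by
  have key := Convex.norm_image_sub_le_of_norm_hasDerivWithin_le (𝕜 := ℝ)
    (f := heatPow (-(1 / 2)) z) (s := Set.Icc r (r + a)) (x := r) (y := r + a)
    (C := 91 / r * gaussMaj r z)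
    (fun s hs => (hasDerivAt_heatPow _ z (by linarith [hs.1])).hasDerivWithinAt)
    (fun s hs => abs_heatPow_deriv_le hr hs.1 (by linarith [hs.2])) (convex_Icc _ _)
    ⟨le_rfl, by linarith⟩ ⟨by linarith, le_rfl⟩
  rw [Real.norm_eq_abs, Real.norm_eq_abs, add_sub_cancel_left, abs_of_nonneg ha] at key
  rw [abs_sub_comm]
  calc _ ≤ _ := key
    _ = _ := by ring

lemma abs_heatPow_sub_sub_le {z r a b : ℝ} (hr : 0 < r) (ha : 0 ≤ a) (har : a ≤ r) (hb : 0 ≤ b)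
    (hbr : b ≤ r) :
    |heatPow (-(1 / 2)) z r - heatPow (-(1 / 2)) z (r + a) -
      (heatPow (-(1 / 2)) z (r + b) - heatPow (-(1 / 2)) z (r + a + b))| ≤
      91 * (a * b / r ^ 2) * gaussMaj r z := by
  have key := Convex.norm_image_sub_le_of_norm_hasDerivWithin_le (𝕜 := ℝ)
    (f := fun s => heatPow (-(1 / 2)) z (s + b) - heatPow (-(1 / 2)) z s)
    (s := Set.Icc r (r + a)) (x := r) (y := r + a) (C := 91 / r ^ 2 * gaussMaj r z * b)
    (fun s hs => (((hasDerivAt_heatPow _ z (by linarith [hs.1])).comp_add_const s b).sub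
      (hasDerivAt_heatPow _ z (by linarith [hs.1]))).hasDerivWithinAt)
    (fun s hs => abs_heatPow_deriv_sub_le hr hs.1 hb (by linarith [hs.2])) (convex_Icc _ _)
    ⟨le_rfl, by linarith⟩ ⟨by linarith, le_rfl⟩
  rw [Real.norm_eq_abs, Real.norm_eq_abs, add_sub_cancel_left, abs_of_nonneg ha] at key
  calc _ = _ := by congr 1; ring
    _ ≤ _ := key
    _ = _ := by ring

lemma lintegral_gaussMaj {r : ℝ} (hr : 0 < r) :
    ∫⁻ z, ENNReal.ofReal (gaussMaj r z) = ENNReal.ofReal √(12 * Real.pi) := by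
  have e : ∀ z, gaussMaj r z = r ^ (-(1 / 2) : ℝ) * Real.exp (-(1 / (12 * r)) * z ^ 2) := by
    intro z; unfold gaussMaj; congr 2; ring
  have hi : Integrable fun z => gaussMaj r z := by
    simp_rw [e]
    exact (integrable_exp_neg_mul_sq (by positivity)).const_mul _
  rw [← ofReal_integral_eq_lintegral_ofReal hi
    (Eventually.of_forall fun z => gaussMaj_nonneg hr.le z)]
  simp_rw [e]
  rw [integral_const_mul, integral_gaussian]
  congr 1
  rw [show Real.pi / (1 / (12 * r)) = r * (12 * Real.pi) by field_simp, Real.sqrt_mul hr.le,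
    ← mul_assoc, Real.sqrt_eq_rpow r, ← Real.rpow_add hr]
  norm_num

/-! ### The operators with kernel `G` -/

section

variable {a₁ a₂ ρ₁ ρ₂ : ℝ}

lemma measurable_f : Measurable (f a₁ a₂) := by
  unfold f
  exact Measurable.ite measurableSet_Iic (by fun_prop) (by fun_prop)

lemma measurable_sign : Measurable Real.sign := by
  unfold Real.sign
  exact Measurable.ite measurableSet_Iio (by fun_prop)
    (Measurable.ite measurableSet_Ioi (by fun_prop) (by fun_prop))

lemma measurable_G : Measurable fun p : ℝ × ℝ × ℝ => G a₁ a₂ ρ₁ ρ₂ p.1 p.2.1 p.2.2 := by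
  unfold G
  have hf := measurable_f (a₁ := a₁) (a₂ := a₂)
  have hs := measurable_sign
  refine Measurable.ite (measurableSet_lt measurable_const measurable_fst) ?_ measurable_const
  refine Measurable.mul (Measurable.mul (by fun_prop)
    (Measurable.ite (measurableSet_le (by fun_prop) measurable_const) (by fun_prop) (by fun_prop)))
    (by fun_prop)

/-- A lower bound for the derivative of `f` controls the change of variables `z = f y`. -/
lemma lintegral_comp_f_le (ha₁ : 0 < a₁) (ha₂ : 0 < a₂) (F : ℝ → ℝ≥0∞) (hF : Measurable F) :
    ∫⁻ y, F (f a₁ a₂ y) ≤ ENNReal.ofReal (√a₁ + √a₂) * ∫⁻ z, F z := by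
  have hdiv : ∀ a : ℝ, 0 < a → ∫⁻ y, F (y / √a) = ENNReal.ofReal √a * ∫⁻ z, F z := by
    intro a ha
    have ha' : (√a)⁻¹ ≠ 0 := by positivity
    have h := Real.map_volume_mul_right ha'
    have h2 : ∫⁻ y, F (y * (√a)⁻¹) = ∫⁻ z, F z ∂(Measure.map (· * (√a)⁻¹) volume) :=
      (lintegral_map hF (by fun_prop)).symm
    simp_rw [div_eq_mul_inv]
    rw [h2, h, lintegral_smul_measure, inv_inv, abs_of_nonneg (Real.sqrt_nonneg _), smul_eq_mul]
  calc ∫⁻ y, F (f a₁ a₂ y) ≤ ∫⁻ y, (F (y / √a₁) + F (y / √a₂)) := by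
        refine lintegral_mono fun y => ?_
        unfold f
        split_ifs
        · exact le_self_add
        · exact le_add_self
    _ = _ := by
        have hm : Measurable fun y => F (y / √a₁) := hF.comp (by fun_prop)
        rw [lintegral_add_left hm, hdiv a₁ ha₁, hdiv a₂ ha₂,
          ENNReal.ofReal_add (by positivity) (by positivity), add_mul]

/-- The bound for the row and column integrals of the Gaussian majorant in the variables `f x`,
`f y`. -/
noncomputable def gaussMass (a₁ a₂ : ℝ) : ℝ≥0 := (√a₁ + √a₂).toNNReal * (√(12 * Real.pi)).toNNReal

lemma lintegral_gaussMaj_f_le (ha₁ : 0 < a₁) (ha₂ : 0 < a₂) {r : ℝ} (hr : 0 < r) (c : ℝ) :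
    ∫⁻ y, ENNReal.ofReal (gaussMaj r (c - f a₁ a₂ y)) ≤ gaussMass a₁ a₂ := by
  have hm : Measurable fun z => ENNReal.ofReal (gaussMaj r z) := by unfold gaussMaj; fun_prop
  refine (lintegral_comp_f_le ha₁ ha₂ (fun z => ENNReal.ofReal (gaussMaj r (c - z)))
    (hm.comp (by fun_prop))).trans ?_
  rw [lintegral_sub_left_eq_self (fun z => ENNReal.ofReal (gaussMaj r z)) c, lintegral_gaussMaj hr]
  rfl

lemma gaussMaj_neg (r z : ℝ) : gaussMaj r (-z) = gaussMaj r z := by simp [gaussMaj]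

/-- The Gaussian kernel in the variables `f x` and `f y` which dominates `G`. -/
noncomputable def majKernel (a₁ a₂ r x y : ℝ) : ℝ≥0∞ :=
  ENNReal.ofReal (gaussMaj r (f a₁ a₂ x - f a₁ a₂ y))

lemma measurable_majKernel (r : ℝ) : Measurable (Function.uncurry (majKernel a₁ a₂ r)) := by
  have hf := measurable_f (a₁ := a₁) (a₂ := a₂)
  have hm : Measurable (gaussMaj r) := by unfold gaussMaj; fun_prop
  unfold majKernel
  exact (hm.comp ((hf.comp measurable_fst).sub (hf.comp measurable_snd))).ennreal_ofReal

lemma l2_majKernel_le (ha₁ : 0 < a₁) (ha₂ : 0 < a₂) {r : ℝ} (hr : 0 < r) {F : ℝ → ℝ≥0∞}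
    (hF : Measurable F) :
    l2 (fun x => ∫⁻ y, majKernel a₁ a₂ r x y * F y) ≤ gaussMass a₁ a₂ * l2 F := by
  have h := schur_test (measurable_majKernel (a₁ := a₁) (a₂ := a₂) r)
    (a := gaussMass a₁ a₂) (b := gaussMass a₁ a₂)
    (fun x => lintegral_gaussMaj_f_le ha₁ ha₂ hr _) (fun y => ?_) hF
  · rw [← sq, ← mul_pow] at h
    exact (ENNReal.pow_le_pow_left_iff two_ne_zero).1 h
  · refine le_trans (le_of_eq ?_) (lintegral_gaussMaj_f_le ha₁ ha₂ hr (f a₁ a₂ y))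
    refine lintegral_congr fun x => ?_
    rw [majKernel, ← gaussMaj_neg, neg_sub]

lemma normTwo_integral_le (ha₁ : 0 < a₁) (ha₂ : 0 < a₂) {r κ : ℝ} (hr : 0 < r) (hκ : 0 ≤ κ)
    {k : ℝ → ℝ → ℝ} (hk : ∀ x y, |k x y| ≤ κ * gaussMaj r (f a₁ a₂ x - f a₁ a₂ y)) {g : ℝ → ℝ}
    (hg : Measurable g) :
    normTwo (fun x => ∫ y, k x y * g y) ≤ ENNReal.ofReal κ * gaussMass a₁ a₂ * normTwo g := by
  rw [normTwo_eq_l2, normTwo_eq_l2, mul_assoc]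
  calc _ ≤ l2 (fun x => ENNReal.ofReal κ * ∫⁻ y, majKernel a₁ a₂ r x y * ‖g y‖ₑ) := by
        refine l2_mono fun x => (enorm_integral_le_lintegral_enorm _).trans ?_
        rw [← lintegral_const_mul' _ _ (by finiteness)]
        refine lintegral_mono fun y => ?_
        rw [enorm_mul, ← mul_assoc, majKernel, ← ENNReal.ofReal_mul hκ, Real.enorm_eq_ofReal_abs]
        gcongr
        exact hk x y
    _ ≤ _ := by
        rw [l2_const_mul (by finiteness)]
        gcongr
        exact l2_majKernel_le ha₁ ha₂ hr hg.enorm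

/-- `G` is a bounded combination of two heat kernels. -/
lemma G_eq {r : ℝ} (hr : 0 < r) (x y : ℝ) :
    G a₁ a₂ ρ₁ ρ₂ r x y = 1 / √(2 * Real.pi) * (if y ≤ 0 then 1 / √a₁ else 1 / √a₂) *
      (heatPow (-(1 / 2)) (f a₁ a₂ x - f a₁ a₂ y) r +
        β a₁ a₂ ρ₁ ρ₂ * Real.sign y * heatPow (-(1 / 2)) (|f a₁ a₂ x| + |f a₁ a₂ y|) r) := by
  rw [G, if_pos hr, Real.sqrt_mul (by positivity), heatPow, heatPow, Real.rpow_neg hr.le,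
    ← Real.sqrt_eq_rpow]
  field_simp

/-- A bound for the coefficients of the two heat kernels in `G`. -/
noncomputable def coefBound (a₁ a₂ ρ₁ ρ₂ : ℝ) : ℝ := (1 / √a₁ + 1 / √a₂) * (1 + |β a₁ a₂ ρ₁ ρ₂|)

lemma coefBound_nonneg : 0 ≤ coefBound a₁ a₂ ρ₁ ρ₂ := by unfold coefBound; positivity

/-- Bounds for time differences of the heat kernel carry over to `G`, because
`|f x - f y| ≤ |f x| + |f y|`. Here `D` is the difference of the heat kernel under consideration. -/
lemma abs_combination_le {D : ℝ → ℝ} {κ r : ℝ} (hr : 0 < r) (hκ : 0 ≤ κ)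
    (hD : ∀ z, |D z| ≤ κ * gaussMaj r z) (x y : ℝ) :
    |1 / √(2 * Real.pi) * (if y ≤ 0 then 1 / √a₁ else 1 / √a₂) *
      (D (f a₁ a₂ x - f a₁ a₂ y) +
        β a₁ a₂ ρ₁ ρ₂ * Real.sign y * D (|f a₁ a₂ x| + |f a₁ a₂ y|))| ≤
      coefBound a₁ a₂ ρ₁ ρ₂ * κ * gaussMaj r (f a₁ a₂ x - f a₁ a₂ y) := by
  set X := f a₁ a₂ x
  set Y := f a₁ a₂ y
  have h1 : 1 / √(2 * Real.pi) ≤ 1 := by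
    rw [div_le_one (by positivity), Real.one_le_sqrt]; linarith [Real.pi_gt_three]
  have h2 : (if y ≤ 0 then 1 / √a₁ else 1 / √a₂) ≤ 1 / √a₁ + 1 / √a₂ := by
    have : 0 ≤ 1 / √a₁ := by positivity
    have : 0 ≤ 1 / √a₂ := by positivity
    split_ifs <;> linarith
  have h2' : 0 ≤ (if y ≤ 0 then 1 / √a₁ else 1 / √a₂) := by split_ifs <;> positivity
  have h3 : gaussMaj r (|X| + |Y|) ≤ gaussMaj r (X - Y) := by
    unfold gaussMaj
    have h4 : (X - Y) ^ 2 ≤ (|X| + |Y|) ^ 2 := by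
      rw [← sq_abs (X - Y)]
      exact pow_le_pow_left₀ (abs_nonneg _) (abs_sub _ _) 2
    gcongr
  have h5 : |Real.sign y| ≤ 1 := by
    rcases Real.sign_apply_eq y with h | h | h <;> simp [h]
  have h6 := gaussMaj_nonneg hr.le (X - Y)
  have h7 : |D (X - Y) + β a₁ a₂ ρ₁ ρ₂ * Real.sign y * D (|X| + |Y|)| ≤
      (1 + |β a₁ a₂ ρ₁ ρ₂|) * (κ * gaussMaj r (X - Y)) := by
    refine (abs_add_le _ _).trans ?_
    rw [abs_mul, abs_mul, add_mul, one_mul]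
    have h8 : |D (|X| + |Y|)| ≤ κ * gaussMaj r (X - Y) := (hD _).trans (by gcongr)
    refine add_le_add (hD _) ?_
    calc _ ≤ |β a₁ a₂ ρ₁ ρ₂| * 1 * (κ * gaussMaj r (X - Y)) := by gcongr
      _ = _ := by ring
  rw [abs_mul, abs_mul, abs_of_nonneg h2', abs_of_nonneg (by positivity : 0 ≤ 1 / √(2 * Real.pi))]
  calc _ ≤ 1 * (1 / √a₁ + 1 / √a₂) * ((1 + |β a₁ a₂ ρ₁ ρ₂|) * (κ * gaussMaj r (X - Y))) := by
        gcongr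
    _ = _ := by unfold coefBound; ring

lemma abs_G_le {r : ℝ} (hr : 0 < r) (x y : ℝ) :
    |G a₁ a₂ ρ₁ ρ₂ r x y| ≤
      coefBound a₁ a₂ ρ₁ ρ₂ * 91 * gaussMaj r (f a₁ a₂ x - f a₁ a₂ y) := by
  rw [G_eq hr]
  exact abs_combination_le (D := fun z => heatPow (-(1 / 2)) z r) hr (by norm_num)
    (fun z => abs_heatPow_zero_le hr) x y

lemma abs_G_sub_le {r a : ℝ} (hr : 0 < r) (ha : 0 ≤ a) (har : a ≤ r) (x y : ℝ) :
    |G a₁ a₂ ρ₁ ρ₂ r x y - G a₁ a₂ ρ₁ ρ₂ (r + a) x y| ≤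
      coefBound a₁ a₂ ρ₁ ρ₂ * (91 * (a / r)) * gaussMaj r (f a₁ a₂ x - f a₁ a₂ y) := by
  rw [G_eq hr, G_eq (by linarith)]
  refine le_trans (le_of_eq ?_) (abs_combination_le (ρ₁ := ρ₁) (ρ₂ := ρ₂)
    (D := fun z => heatPow (-(1 / 2)) z r - heatPow (-(1 / 2)) z (r + a)) hr (by positivity)
    (fun z => abs_heatPow_sub_le hr ha har) x y)
  congr 1
  ring

lemma abs_G_sub_sub_le {r a b : ℝ} (hr : 0 < r) (ha : 0 ≤ a) (har : a ≤ r) (hb : 0 ≤ b)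
    (hbr : b ≤ r) (x y : ℝ) :
    |G a₁ a₂ ρ₁ ρ₂ r x y - G a₁ a₂ ρ₁ ρ₂ (r + a) x y -
      (G a₁ a₂ ρ₁ ρ₂ (r + b) x y - G a₁ a₂ ρ₁ ρ₂ (r + a + b) x y)| ≤
      coefBound a₁ a₂ ρ₁ ρ₂ * (91 * (a * b / r ^ 2)) *
        gaussMaj r (f a₁ a₂ x - f a₁ a₂ y) := by
  rw [G_eq hr, G_eq (by linarith), G_eq (by linarith), G_eq (by linarith)]
  refine le_trans (le_of_eq ?_) (abs_combination_le (ρ₁ := ρ₁) (ρ₂ := ρ₂)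
    (D := fun z => heatPow (-(1 / 2)) z r - heatPow (-(1 / 2)) z (r + a) -
      (heatPow (-(1 / 2)) z (r + b) - heatPow (-(1 / 2)) z (r + a + b))) hr (by positivity)
    (fun z => abs_heatPow_sub_sub_le hr ha har hb hbr) x y)
  congr 1
  ring

/-- The operator with kernel `G(r, ·, ·)`. -/
noncomputable def opG (a₁ a₂ ρ₁ ρ₂ r : ℝ) (g : ℝ → ℝ) (x : ℝ) : ℝ :=
  ∫ y, G a₁ a₂ ρ₁ ρ₂ r x y * g y

lemma opG_of_nonpos {r : ℝ} (hr : r ≤ 0) (g : ℝ → ℝ) (x : ℝ) : opG a₁ a₂ ρ₁ ρ₂ r g x = 0 := by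
  simp [opG, G, hr.not_gt]

lemma stronglyMeasurable_opG {r : ℝ} {g : ℝ → ℝ} (hg : Measurable g) :
    StronglyMeasurable (opG a₁ a₂ ρ₁ ρ₂ r g) := by
  have hG := measurable_G (a₁ := a₁) (a₂ := a₂) (ρ₁ := ρ₁) (ρ₂ := ρ₂)
  have h : Measurable fun p : ℝ × ℝ => G a₁ a₂ ρ₁ ρ₂ r p.1 p.2 * g p.2 :=
    (hG.comp (measurable_const.prodMk measurable_id)).mul (hg.comp measurable_snd)
  exact h.stronglyMeasurable.integral_prod_right'

lemma integrable_G_mul (ha₁ : 0 < a₁) (ha₂ : 0 < a₂) {r : ℝ} {g : ℝ → ℝ} (hg : Measurable g)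
    (hg2 : normTwo g ≠ ⊤) (x : ℝ) : Integrable fun y => G a₁ a₂ ρ₁ ρ₂ r x y * g y := by
  have hG := measurable_G (a₁ := a₁) (a₂ := a₂) (ρ₁ := ρ₁) (ρ₂ := ρ₂)
  have hGx : Measurable fun y => G a₁ a₂ ρ₁ ρ₂ r x y :=
    hG.comp (measurable_const.prodMk (measurable_const.prodMk measurable_id))
  refine ⟨(hGx.mul hg).aestronglyMeasurable, ?_⟩
  rcases le_or_gt r 0 with hr | hr
  · simp [G, hr.not_gt, HasFiniteIntegral]
  rw [hasFiniteIntegral_iff_enorm]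
  have hsq : (∫⁻ y, ‖G a₁ a₂ ρ₁ ρ₂ r x y * g y‖ₑ) ^ 2 < ⊤ := by
    simp_rw [enorm_mul]
    refine (lintegral_mul_sq_le _ hGx.enorm.aemeasurable hg.enorm.aemeasurable).trans_lt ?_
    rw [← normTwo_sq g]
    refine ENNReal.mul_lt_top ?_ (ENNReal.pow_lt_top (lt_top_iff_ne_top.2 hg2))
    -- the kernel is bounded and has finite mass, hence it is square integrable in `y`
    set κ := coefBound a₁ a₂ ρ₁ ρ₂ * 91
    have hκ : 0 ≤ κ := mul_nonneg coefBound_nonneg (by norm_num)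
    calc ∫⁻ y, ‖G a₁ a₂ ρ₁ ρ₂ r x y‖ₑ ^ 2
        ≤ ∫⁻ y, ENNReal.ofReal (κ ^ 2 * r ^ (-(1 / 2) : ℝ)) *
            ENNReal.ofReal (gaussMaj r (f a₁ a₂ x - f a₁ a₂ y)) := by
          refine lintegral_mono fun y => ?_
          rw [Real.enorm_eq_ofReal_abs, ← ENNReal.ofReal_pow (abs_nonneg _),
            ← ENNReal.ofReal_mul (by positivity)]
          apply ENNReal.ofReal_le_ofReal
          set m := gaussMaj r (f a₁ a₂ x - f a₁ a₂ y) with hm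
          have hm0 : 0 ≤ m := gaussMaj_nonneg hr.le _
          have hm1 : m ≤ r ^ (-(1 / 2) : ℝ) := by
            have : Real.exp (-(f a₁ a₂ x - f a₁ a₂ y) ^ 2 / (12 * r)) ≤ 1 :=
              Real.exp_le_one_iff.2 (by rw [neg_div]; simp; positivity)
            rw [hm, gaussMaj]
            exact mul_le_of_le_one_right (by positivity) this
          calc _ ≤ (κ * m) ^ 2 := by gcongr; exact abs_G_le hr x y
            _ = κ ^ 2 * m * m := by ring
            _ ≤ _ := by gcongr
      _ < ⊤ := by
          rw [lintegral_const_mul' _ _ (by finiteness)]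
          exact ENNReal.mul_lt_top (by finiteness)
            ((lintegral_gaussMaj_f_le ha₁ ha₂ hr _).trans_lt (by finiteness))
  by_contra hc
  simp only [not_lt, top_le_iff] at hc
  rw [hc] at hsq
  simp at hsq

lemma opG_sub (ha₁ : 0 < a₁) (ha₂ : 0 < a₂) {r : ℝ} {g g' : ℝ → ℝ} (hg : Measurable g)
    (hg2 : normTwo g ≠ ⊤) (hg' : Measurable g') (hg2' : normTwo g' ≠ ⊤) (x : ℝ) :
    opG a₁ a₂ ρ₁ ρ₂ r (fun y => g y - g' y) x =
      opG a₁ a₂ ρ₁ ρ₂ r g x - opG a₁ a₂ ρ₁ ρ₂ r g' x := by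
  unfold opG
  rw [← integral_sub (integrable_G_mul ha₁ ha₂ hg hg2 x) (integrable_G_mul ha₁ ha₂ hg' hg2' x)]
  simp_rw [mul_sub]

lemma normTwo_add_le {g g' : ℝ → ℝ} (hg : AEStronglyMeasurable g)
    (hg' : AEStronglyMeasurable g') :
    normTwo (fun x => g x + g' x) ≤ normTwo g + normTwo g' :=
  eLpNorm_add_le hg hg' (by norm_num)

lemma normTwo_sub_le {g g' : ℝ → ℝ} (hg : AEStronglyMeasurable g)
    (hg' : AEStronglyMeasurable g') :
    normTwo (fun x => g x - g' x) ≤ normTwo g + normTwo g' :=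
  eLpNorm_sub_le hg hg' (by norm_num)

/-- The operators with kernel `G` are uniformly bounded on `L²(ℝ)`, and their first and second
differences in time satisfy Hölder bounds of every order `θ ≤ 1`. -/
structure OpBounds (a₁ a₂ ρ₁ ρ₂ θ : ℝ) (K : ℝ≥0) : Prop where
  bound : ∀ (r : ℝ) (g : ℝ → ℝ), Measurable g → normTwo g ≠ ⊤ →
    normTwo (opG a₁ a₂ ρ₁ ρ₂ r g) ≤ K * normTwo g
  diff : ∀ (r a : ℝ) (g : ℝ → ℝ), 0 < r → 0 ≤ a → Measurable g → normTwo g ≠ ⊤ →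
    normTwo (fun x => opG a₁ a₂ ρ₁ ρ₂ r g x - opG a₁ a₂ ρ₁ ρ₂ (r + a) g x) ≤
      K * ENNReal.ofReal ((a / r) ^ θ) * normTwo g
  diff_diff : ∀ (r a b : ℝ) (g : ℝ → ℝ), 0 < r → 0 ≤ a → 0 ≤ b → Measurable g → normTwo g ≠ ⊤ →
    normTwo (fun x => opG a₁ a₂ ρ₁ ρ₂ r g x - opG a₁ a₂ ρ₁ ρ₂ (r + a) g x -
      (opG a₁ a₂ ρ₁ ρ₂ (r + b) g x - opG a₁ a₂ ρ₁ ρ₂ (r + a + b) g x)) ≤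
      K * ENNReal.ofReal ((a * b / r ^ 2) ^ θ) * normTwo g

/-- For time steps at most `r` the Hölder bounds follow from the Lipschitz bounds for the kernel and
the Schur test; for longer steps they follow from the triangle inequality. -/
lemma exists_opBounds (ρ₁ ρ₂ : ℝ) (ha₁ : 0 < a₁) (ha₂ : 0 < a₂) {θ : ℝ} (hθ0 : 0 < θ)
    (hθ1 : θ ≤ 1) : ∃ K : ℝ≥0, OpBounds a₁ a₂ ρ₁ ρ₂ θ K := by
  set c := coefBound a₁ a₂ ρ₁ ρ₂
  have hc : 0 ≤ c := coefBound_nonneg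
  set K₀ : ℝ≥0 := (c * 91).toNNReal * gaussMass a₁ a₂ with hK₀
  have hK₀' : ∀ κ : ℝ, 0 ≤ κ → ENNReal.ofReal (c * (91 * κ)) * gaussMass a₁ a₂ =
      K₀ * ENNReal.ofReal κ := by
    intro κ hκ
    rw [← mul_assoc, ENNReal.ofReal_mul (by positivity), hK₀, mul_right_comm]
    rfl
  have hb : ∀ (r : ℝ) (g : ℝ → ℝ), Measurable g →
      normTwo (opG a₁ a₂ ρ₁ ρ₂ r g) ≤ K₀ * normTwo g := by
    intro r g hg
    rcases le_or_gt r 0 with hr | hr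
    · have : opG a₁ a₂ ρ₁ ρ₂ r g = 0 := funext fun x => opG_of_nonpos hr g x
      simp [this, normTwo]
    · have h := normTwo_integral_le ha₁ ha₂ hr (κ := c * 91) (by positivity)
        (fun x y => abs_G_le (ρ₁ := ρ₁) (ρ₂ := ρ₂) hr x y) hg
      rw [← mul_one (91 : ℝ), hK₀' 1 zero_le_one, ENNReal.ofReal_one, mul_one] at h
      exact h
  have hone : ∀ κ : ℝ, 1 ≤ κ → 1 ≤ ENNReal.ofReal (κ ^ θ) := fun κ hκ => by
    rw [← ENNReal.ofReal_one]
    exact ENNReal.ofReal_le_ofReal (Real.one_le_rpow hκ hθ0.le)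
  have hpow : ∀ κ : ℝ, 0 ≤ κ → κ ≤ 1 → ENNReal.ofReal κ ≤ ENNReal.ofReal (κ ^ θ) :=
    fun κ h0 h1 => ENNReal.ofReal_le_ofReal (Real.self_le_rpow_of_le_one h0 h1 hθ1)
  have hd : ∀ (r a : ℝ) (g : ℝ → ℝ), 0 < r → 0 ≤ a → Measurable g → normTwo g ≠ ⊤ →
      normTwo (fun x => opG a₁ a₂ ρ₁ ρ₂ r g x - opG a₁ a₂ ρ₁ ρ₂ (r + a) g x) ≤
        2 * K₀ * ENNReal.ofReal ((a / r) ^ θ) * normTwo g := by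
    intro r a g hr ha hg hg2
    rcases le_total a r with har | har
    · have e : (fun x => opG a₁ a₂ ρ₁ ρ₂ r g x - opG a₁ a₂ ρ₁ ρ₂ (r + a) g x) =
          fun x => ∫ y, (G a₁ a₂ ρ₁ ρ₂ r x y - G a₁ a₂ ρ₁ ρ₂ (r + a) x y) * g y := by
        funext x
        simp_rw [sub_mul]
        rw [integral_sub (integrable_G_mul ha₁ ha₂ hg hg2 x) (integrable_G_mul ha₁ ha₂ hg hg2 x)]
        rfl
      have hκ : 0 ≤ a / r := by positivity
      have h := normTwo_integral_le ha₁ ha₂ hr (κ := c * (91 * (a / r))) (by positivity)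
        (fun x y => abs_G_sub_le (ρ₁ := ρ₁) (ρ₂ := ρ₂) hr ha har x y) hg
      rw [e]
      refine h.trans ?_
      rw [hK₀' _ hκ]
      gcongr ?_ * ?_ * _
      · exact le_mul_of_one_le_left zero_le (by norm_num)
      · exact hpow _ hκ ((div_le_one hr).2 har)
    · refine (normTwo_sub_le (stronglyMeasurable_opG hg).aestronglyMeasurable
        (stronglyMeasurable_opG hg).aestronglyMeasurable).trans ?_
      calc _ ≤ K₀ * normTwo g + K₀ * normTwo g := add_le_add (hb _ _ hg) (hb _ _ hg)
        _ = 2 * K₀ * 1 * normTwo g := by ring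
        _ ≤ _ := by
          gcongr
          exact hone _ ((one_le_div hr).2 har)
  refine ⟨4 * K₀, fun r g hg hg2 => (hb r g hg).trans ?_, fun r a g hr ha hg hg2 =>
    (hd r a g hr ha hg hg2).trans ?_, fun r a b g hr ha hb0 hg hg2 => ?_⟩
  · push_cast
    gcongr
    exact le_mul_of_one_le_left zero_le (by norm_num)
  · push_cast
    gcongr
    norm_num
  have hmeas : ∀ r r', AEStronglyMeasurable
      (fun x => opG a₁ a₂ ρ₁ ρ₂ r g x - opG a₁ a₂ ρ₁ ρ₂ r' g x) := fun r r' =>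
    (stronglyMeasurable_opG hg).aestronglyMeasurable.sub
      (stronglyMeasurable_opG hg).aestronglyMeasurable
  -- if one step is longer than `r`, a single difference in the other step suffices
  have hlong : ∀ a b : ℝ, 0 ≤ a → 0 ≤ b → r ≤ a →
      normTwo (fun x => opG a₁ a₂ ρ₁ ρ₂ r g x - opG a₁ a₂ ρ₁ ρ₂ (r + b) g x) +
        normTwo (fun x => opG a₁ a₂ ρ₁ ρ₂ (r + a) g x - opG a₁ a₂ ρ₁ ρ₂ (r + a + b) g x) ≤
      (4 * K₀ : ℝ≥0) * ENNReal.ofReal ((a * b / r ^ 2) ^ θ) * normTwo g := by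
    intro a b ha hb0 har
    have h1 := hd r b g hr hb0 hg hg2
    have h2 := hd (r + a) b g (by linarith) hb0 hg hg2
    have hle : b / r ≤ a * b / r ^ 2 := by
      rw [div_le_div_iff₀ hr (by positivity)]
      nlinarith [mul_nonneg (mul_nonneg hb0 hr.le) (sub_nonneg.2 har)]
    have h3 : ENNReal.ofReal ((b / r) ^ θ) ≤ ENNReal.ofReal ((a * b / r ^ 2) ^ θ) :=
      ENNReal.ofReal_le_ofReal (Real.rpow_le_rpow (by positivity) hle hθ0.le)
    have h4 : ENNReal.ofReal ((b / (r + a)) ^ θ) ≤ ENNReal.ofReal ((a * b / r ^ 2) ^ θ) := by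
      refine le_trans (ENNReal.ofReal_le_ofReal (Real.rpow_le_rpow (by positivity) ?_ hθ0.le)) h3
      gcongr
      linarith
    calc _ ≤ 2 * K₀ * ENNReal.ofReal ((a * b / r ^ 2) ^ θ) * normTwo g +
          2 * K₀ * ENNReal.ofReal ((a * b / r ^ 2) ^ θ) * normTwo g :=
          add_le_add (h1.trans (by gcongr)) (h2.trans (by gcongr))
      _ = _ := by push_cast; ring
  rcases le_total a r with har | har
  · rcases le_total b r with hbr | hbr
    · have e : (fun x => opG a₁ a₂ ρ₁ ρ₂ r g x - opG a₁ a₂ ρ₁ ρ₂ (r + a) g x -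
          (opG a₁ a₂ ρ₁ ρ₂ (r + b) g x - opG a₁ a₂ ρ₁ ρ₂ (r + a + b) g x)) =
          fun x => ∫ y, (G a₁ a₂ ρ₁ ρ₂ r x y - G a₁ a₂ ρ₁ ρ₂ (r + a) x y -
            (G a₁ a₂ ρ₁ ρ₂ (r + b) x y - G a₁ a₂ ρ₁ ρ₂ (r + a + b) x y)) * g y := by
        funext x
        have hi : ∀ r, Integrable fun y => G a₁ a₂ ρ₁ ρ₂ r x y * g y :=
          fun r => integrable_G_mul ha₁ ha₂ hg hg2 x
        have hi2 : ∀ r r', Integrable fun y =>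
            G a₁ a₂ ρ₁ ρ₂ r x y * g y - G a₁ a₂ ρ₁ ρ₂ r' x y * g y :=
          fun r r' => (hi r).sub (hi r')
        simp_rw [sub_mul]
        rw [integral_sub (hi2 _ _) (hi2 _ _), integral_sub (hi _) (hi _),
          integral_sub (hi _) (hi _)]
        rfl
      have hκ : 0 ≤ a * b / r ^ 2 := by positivity
      have h := normTwo_integral_le ha₁ ha₂ hr (κ := c * (91 * (a * b / r ^ 2))) (by positivity)
        (fun x y => abs_G_sub_sub_le (ρ₁ := ρ₁) (ρ₂ := ρ₂) hr ha har hb0 hbr x y) hg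
      rw [e]
      refine h.trans ?_
      rw [hK₀' _ hκ]
      push_cast
      gcongr ?_ * ?_ * _
      · exact le_mul_of_one_le_left zero_le (by norm_num)
      · refine hpow _ hκ ((div_le_one (by positivity)).2 ?_)
        nlinarith
    · refine (normTwo_sub_le (hmeas _ _) (hmeas _ _)).trans ?_
      have h := hlong b a hb0 ha hbr
      rwa [mul_comm b a, add_right_comm r b a] at h
  · have e : (fun x => opG a₁ a₂ ρ₁ ρ₂ r g x - opG a₁ a₂ ρ₁ ρ₂ (r + a) g x -
          (opG a₁ a₂ ρ₁ ρ₂ (r + b) g x - opG a₁ a₂ ρ₁ ρ₂ (r + a + b) g x)) =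
        fun x => (opG a₁ a₂ ρ₁ ρ₂ r g x - opG a₁ a₂ ρ₁ ρ₂ (r + b) g x) -
          (opG a₁ a₂ ρ₁ ρ₂ (r + a) g x - opG a₁ a₂ ρ₁ ρ₂ (r + a + b) g x) := by
      funext x; ring
    rw [e]
    exact (normTwo_sub_le (hmeas _ _) (hmeas _ _)).trans (hlong a b ha hb0 har)

end

/-! ### Measurability of parametric integrals -/

lemma measurable_intervalIntegral {X : Type*} [MeasurableSpace X] {F : X → ℝ → ℝ}
    (hF : Measurable (Function.uncurry F)) {a b : X → ℝ} (ha : Measurable a) (hb : Measurable b) :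
    Measurable fun x => ∫ y in a x..b x, F x y := by
  have h : ∀ {a b : X → ℝ}, Measurable a → Measurable b →
      Measurable fun x => ∫ y in Set.Ioc (a x) (b x), F x y := by
    intro a b ha hb
    simp_rw [← integral_indicator measurableSet_Ioc]
    have hs : MeasurableSet {p : X × ℝ | p.2 ∈ Set.Ioc (a p.1) (b p.1)} :=
      (measurableSet_lt (ha.comp measurable_fst) measurable_snd).inter
        (measurableSet_le measurable_snd (hb.comp measurable_fst))
    exact ((hF.indicator hs).stronglyMeasurable.integral_prod_right').measurable
  unfold intervalIntegral
  exact (h ha hb).sub (h hb ha)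

lemma measurable_lintegral_Ioo {X : Type*} [MeasurableSpace X] {F : X → ℝ → ℝ≥0∞}
    (hF : Measurable (Function.uncurry F)) {a b : X → ℝ} (ha : Measurable a) (hb : Measurable b) :
    Measurable fun x => ∫⁻ y in Set.Ioo (a x) (b x), F x y := by
  simp_rw [← lintegral_indicator measurableSet_Ioo]
  have hs : MeasurableSet {p : X × ℝ | p.2 ∈ Set.Ioo (a p.1) (b p.1)} :=
    (measurableSet_lt (ha.comp measurable_fst) measurable_snd).inter
      (measurableSet_lt measurable_snd (hb.comp measurable_fst))
  exact (hF.indicator hs).lintegral_prod_right'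

/-! ### The right-sided derivative of the driving path -/

/-- The derivative `D^{1-σ}_{b-} ψ_{b-}`, which is integrated against `D^σ_{0+} φ`. -/
noncomputable def driverDeriv (σ : ℝ) (ψ : ℝ → ℝ) (b r : ℝ) : ℝ :=
  fracDerivRight (1 - σ) b (leftCentered b ψ) r

section

variable {σ T : ℝ} {ψ : ℝ → ℝ}

lemma leftCentered_eq (hψ : Continuous ψ) (b x : ℝ) : leftCentered b ψ x = ψ b - ψ x := by
  rw [leftCentered, hψ.continuousAt.continuousWithinAt.leftLim_eq]

lemma driverDeriv_eq (hψ : Continuous ψ) (b r : ℝ) :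
    driverDeriv σ ψ b r = 1 / Real.Gamma σ * ((ψ b - ψ r) / (b - r) ^ (1 - σ) +
      (1 - σ) * ∫ y in r..b, (ψ y - ψ r) / (y - r) ^ (2 - σ)) := by
  simp only [driverDeriv, fracDerivRight, leftCentered_eq hψ, sub_sub_cancel]
  simp only [sub_sub_sub_cancel_left]
  rw [show 1 + (1 - σ) = 2 - σ by ring]

lemma measurable_driverDeriv (hψ : Continuous ψ) :
    Measurable fun p : ℝ × ℝ => driverDeriv σ ψ p.1 p.2 := by
  have hm := hψ.measurable
  simp_rw [driverDeriv_eq hψ]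
  have h := measurable_intervalIntegral (X := ℝ × ℝ)
    (F := fun p y => (ψ y - ψ p.2) / (y - p.2) ^ (2 - σ)) (by unfold Function.uncurry; fun_prop)
    measurable_snd measurable_fst
  fun_prop

lemma abs_sub_le_of_seminormZero (hfin : seminormZero σ T ψ ≠ ⊤) {u v : ℝ} (hu : 0 ≤ u)
    (huv : u < v) (hv : v ≤ T) :
    |ψ v - ψ u| ≤ (seminormZero σ T ψ).toReal * (v - u) ^ (1 - σ) := by
  have h : ENNReal.ofReal (|ψ u - ψ v| / (v - u) ^ (1 - σ)) ≤ seminormZero σ T ψ := by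
    unfold seminormZero
    refine le_trans ?_ (le_iSup₂_of_le u v (le_iSup₂_of_le hu huv (le_iSup_of_le hv le_rfl)))
    exact le_self_add
  rw [ENNReal.ofReal_le_iff_le_toReal hfin,
    div_le_iff₀ (Real.rpow_pos_of_pos (sub_pos.2 huv) _)] at h
  rwa [abs_sub_comm]

lemma lintegral_le_seminormZero {u v : ℝ} (hu : 0 ≤ u) (huv : u < v) (hv : v ≤ T) :
    ∫⁻ z in Set.Ioo u v, ENNReal.ofReal (|ψ u - ψ z| / (z - u) ^ (2 - σ)) ≤
      seminormZero σ T ψ := by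
  unfold seminormZero
  refine le_trans ?_ (le_iSup₂_of_le u v (le_iSup₂_of_le hu huv (le_iSup_of_le hv le_rfl)))
  exact le_add_self

lemma integrable_driver (hψ : Continuous ψ) (hfin : seminormZero σ T ψ ≠ ⊤) {u v : ℝ}
    (hu : 0 ≤ u) (huv : u < v) (hv : v ≤ T) :
    IntervalIntegrable (fun z => (ψ z - ψ u) / (z - u) ^ (2 - σ)) volume u v ∧
      ∫ z in u..v, |ψ z - ψ u| / (z - u) ^ (2 - σ) ≤ (seminormZero σ T ψ).toReal := by
  have hm := hψ.measurable
  have e : ∀ z ∈ Set.Ioo u v, ENNReal.ofReal (|ψ u - ψ z| / (z - u) ^ (2 - σ)) =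
      ‖(ψ z - ψ u) / (z - u) ^ (2 - σ)‖ₑ := by
    intro z hz
    have : 0 < z - u := sub_pos.2 hz.1
    rw [Real.enorm_eq_ofReal_abs, abs_div, abs_of_nonneg (by positivity : 0 ≤ (z - u) ^ (2 - σ)),
      abs_sub_comm]
  have hle := lintegral_le_seminormZero (σ := σ) (ψ := ψ) hu huv hv
  rw [setLIntegral_congr_fun measurableSet_Ioo e] at hle
  have hint : IntegrableOn (fun z => (ψ z - ψ u) / (z - u) ^ (2 - σ)) (Set.Ioo u v) :=
    ⟨(by fun_prop : Measurable fun z => (ψ z - ψ u) / (z - u) ^ (2 - σ)).aestronglyMeasurable,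
      hle.trans_lt (lt_top_iff_ne_top.2 hfin)⟩
  refine ⟨(intervalIntegrable_iff_integrableOn_Ioo_of_le huv.le).2 hint, ?_⟩
  rw [intervalIntegral.integral_of_le huv.le, integral_Ioc_eq_integral_Ioo,
    ← ENNReal.ofReal_le_iff_le_toReal hfin, ofReal_integral_eq_lintegral_ofReal]
  · refine le_trans (le_of_eq (setLIntegral_congr_fun measurableSet_Ioo fun z hz => ?_)) hle
    rw [← e z hz, abs_sub_comm]
  · refine (integrable_congr (ae_restrict_of_forall_mem measurableSet_Ioo fun z hz => ?_)).1
      hint.norm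
    have : 0 < z - u := sub_pos.2 hz.1
    rw [Real.norm_eq_abs, abs_div, abs_of_nonneg (by positivity : 0 ≤ (z - u) ^ (2 - σ))]
  · refine ae_restrict_of_forall_mem measurableSet_Ioo fun z hz => ?_
    have : 0 < z - u := sub_pos.2 hz.1
    simp only [Pi.zero_apply]
    positivity

lemma abs_integral_driver_le (hψ : Continuous ψ) (hfin : seminormZero σ T ψ ≠ ⊤) {u v : ℝ}
    (hu : 0 ≤ u) (huv : u < v) (hv : v ≤ T) :
    |∫ z in u..v, (ψ z - ψ u) / (z - u) ^ (2 - σ)| ≤ (seminormZero σ T ψ).toReal := by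
  refine (intervalIntegral.abs_integral_le_integral_abs huv.le).trans
    (le_trans (le_of_eq ?_) (integrable_driver hψ hfin hu huv hv).2)
  refine intervalIntegral.integral_congr fun z hz => ?_
  rw [Set.uIcc_of_le huv.le] at hz
  have : 0 ≤ z - u := sub_nonneg.2 hz.1
  rw [abs_div, abs_of_nonneg (by positivity : 0 ≤ (z - u) ^ (2 - σ))]

/-- The derivative of the driving path is bounded by its seminorm; for this bound the seminorm is
designed. -/
lemma abs_driverDeriv_le (hσ0 : 0 < σ) (hσ1 : σ < 1) (hψ : Continuous ψ)
    (hfin : seminormZero σ T ψ ≠ ⊤) {b r : ℝ} (hr : 0 ≤ r) (hrb : r < b) (hb : b ≤ T) :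
    |driverDeriv σ ψ b r| ≤ 2 / Real.Gamma σ * (seminormZero σ T ψ).toReal := by
  set L := (seminormZero σ T ψ).toReal with hL
  have hL0 : 0 ≤ L := ENNReal.toReal_nonneg
  have hG : 0 < Real.Gamma σ := Real.Gamma_pos_of_pos hσ0
  have hbr : 0 < b - r := sub_pos.2 hrb
  have hp : 0 < (b - r) ^ (1 - σ) := by positivity
  have h1 : |(ψ b - ψ r) / (b - r) ^ (1 - σ)| ≤ L := by
    rw [abs_div, abs_of_pos hp, div_le_iff₀ hp]
    exact abs_sub_le_of_seminormZero hfin hr hrb hb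
  have h2 := abs_integral_driver_le hψ hfin hr hrb hb
  rw [driverDeriv_eq hψ, abs_mul, abs_of_pos (by positivity)]
  calc _ ≤ 1 / Real.Gamma σ * (L + 1 * L) := by
        gcongr
        refine (abs_add_le _ _).trans (add_le_add h1 ?_)
        rw [abs_mul, abs_of_pos (by linarith : 0 < 1 - σ)]
        gcongr
        linarith
    _ = _ := by ring

/-- Moving the right end point from `v` to `s` changes the derivative of the driving path by little
at points far from `v`: once the boundary terms are combined, only increments of `ψ` from `v`
remain. -/
lemma abs_driverDeriv_sub_le (hσ0 : 0 < σ) (hσ1 : σ < 1) (hψ : Continuous ψ)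
    (hfin : seminormZero σ T ψ ≠ ⊤) {θ : ℝ} (hθ0 : 0 ≤ θ) (hθ : θ ≤ 1 - σ) {r v s : ℝ}
    (hr : 0 ≤ r) (hrv : r < v) (hvs : v < s) (hs : s ≤ T) :
    |driverDeriv σ ψ s r - driverDeriv σ ψ v r| ≤
      2 / Real.Gamma σ * (seminormZero σ T ψ).toReal * ((s - v) / (v - r)) ^ θ := by
  set L := (seminormZero σ T ψ).toReal with hL
  have hL0 : 0 ≤ L := ENNReal.toReal_nonneg
  have hG : 0 < Real.Gamma σ := Real.Gamma_pos_of_pos hσ0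
  have hvr : 0 < v - r := sub_pos.2 hrv
  have hsv : 0 < s - v := sub_pos.2 hvs
  have hsr : 0 < s - r := by linarith
  have hσ' : 0 < 1 - σ := by linarith
  have hpos : ∀ y ∈ Set.uIcc v s, 0 < y - r := fun y hy => by
    rw [Set.uIcc_of_le hvs.le] at hy; linarith [hy.1]
  have hc : ContinuousOn (fun y : ℝ => (y - r) ^ (2 - σ)) (Set.uIcc v s) :=
    ContinuousOn.rpow_const (by fun_prop) fun y hy => Or.inl (hpos y hy).ne'
  have hne : ∀ y ∈ Set.uIcc v s, (y - r) ^ (2 - σ) ≠ 0 := fun y hy =>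
    (Real.rpow_pos_of_pos (hpos y hy) _).ne'
  have hsplit : ∫ y in r..s, (ψ y - ψ r) / (y - r) ^ (2 - σ) =
      (∫ y in r..v, (ψ y - ψ r) / (y - r) ^ (2 - σ)) +
        ∫ y in v..s, (ψ y - ψ r) / (y - r) ^ (2 - σ) := by
    refine (intervalIntegral.integral_add_adjacent_intervals
      (integrable_driver hψ hfin hr hrv (by linarith)).1 ?_).symm
    exact (ContinuousOn.div (by fun_prop) hc hne).intervalIntegrable
  -- after the end point is moved, `ψ y - ψ r` is split at `ψ v`; the second part is explicit and
  -- cancels the change of the boundary term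
  have hsplit2 : ∫ y in v..s, (ψ y - ψ r) / (y - r) ^ (2 - σ) =
      (∫ y in v..s, (ψ y - ψ v) / (y - r) ^ (2 - σ)) +
        (ψ v - ψ r) * ∫ y in v..s, (y - r) ^ (-(2 - σ)) := by
    rw [← intervalIntegral.integral_const_mul, ← intervalIntegral.integral_add]
    · refine intervalIntegral.integral_congr fun y hy => ?_
      rw [Real.rpow_neg (hpos y hy).le]
      ring
    · exact (ContinuousOn.div (by fun_prop) hc hne).intervalIntegrable
    · exact (ContinuousOn.mul continuousOn_const (ContinuousOn.rpow_const (by fun_prop)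
        fun y hy => Or.inl (hpos y hy).ne')).intervalIntegrable
  have hpow : (1 - σ) * ∫ y in v..s, (y - r) ^ (-(2 - σ)) =
      ((v - r) ^ (1 - σ))⁻¹ - ((s - r) ^ (1 - σ))⁻¹ := by
    rw [intervalIntegral.integral_comp_sub_right (fun z => z ^ (-(2 - σ))), integral_rpow]
    · rw [show -(2 - σ) + 1 = -(1 - σ) by ring, Real.rpow_neg hsr.le, Real.rpow_neg hvr.le]
      field_simp
      ring
    · right
      refine ⟨by linarith, ?_⟩
      rw [Set.uIcc_of_le (by linarith)]
      intro h
      linarith [h.1]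
  set I := ∫ y in v..s, (ψ y - ψ v) / (y - r) ^ (2 - σ) with hI
  have hid : driverDeriv σ ψ s r - driverDeriv σ ψ v r =
      1 / Real.Gamma σ * ((ψ s - ψ v) / (s - r) ^ (1 - σ) + (1 - σ) * I) := by
    rw [driverDeriv_eq hψ, driverDeriv_eq hψ, hsplit, hsplit2, ← mul_sub]
    congr 1
    have : (1 - σ) * ((ψ v - ψ r) * ∫ y in v..s, (y - r) ^ (-(2 - σ))) =
        (ψ v - ψ r) * (((v - r) ^ (1 - σ))⁻¹ - ((s - r) ^ (1 - σ))⁻¹) := by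
      rw [← hpow]; ring
    rw [mul_add, mul_add, this]
    ring
  set m := (s - v) / (s - r) with hm
  have hm0 : 0 < m := by positivity
  have hm1 : m ≤ 1 := (div_le_one hsr).2 (by linarith)
  have hmθ : m ^ (1 - σ) ≤ ((s - v) / (v - r)) ^ θ :=
    (Real.rpow_le_rpow_of_exponent_ge hm0 hm1 hθ).trans
      (Real.rpow_le_rpow hm0.le (by rw [hm]; gcongr) hθ0)
  have h1 : |(ψ s - ψ v) / (s - r) ^ (1 - σ)| ≤ L * m ^ (1 - σ) := by
    have hp : 0 < (s - r) ^ (1 - σ) := by positivity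
    rw [abs_div, abs_of_pos hp, hm, Real.div_rpow hsv.le hsr.le, ← mul_div_assoc]
    gcongr
    exact abs_sub_le_of_seminormZero hfin (by linarith) hvs hs
  have h2 : |I| ≤ L * m ^ (1 - σ) := by
    obtain ⟨hi1, hi2⟩ := integrable_driver hψ hfin (by linarith : 0 ≤ v) hvs hs
    have hi3 : IntervalIntegrable (fun z => |ψ z - ψ v| / (z - v) ^ (2 - σ)) volume v s := by
      refine hi1.abs.congr fun z hz => ?_
      rw [Set.uIoc_of_le hvs.le] at hz
      have : 0 < z - v := sub_pos.2 hz.1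
      rw [abs_div, abs_of_pos (by positivity : 0 < (z - v) ^ (2 - σ))]
    calc |I| ≤ ∫ y in v..s, |(ψ y - ψ v) / (y - r) ^ (2 - σ)| :=
          intervalIntegral.abs_integral_le_integral_abs hvs.le
      _ ≤ ∫ y in v..s, m ^ (2 - σ) * (|ψ y - ψ v| / (y - v) ^ (2 - σ)) := by
          refine intervalIntegral.integral_mono_on_of_le_Ioo hvs.le ?_ (hi3.const_mul _) ?_
          · exact (ContinuousOn.div (by fun_prop) hc hne).abs.intervalIntegrable
          · intro y hy
            have hyv : 0 < y - v := sub_pos.2 hy.1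
            have hyr : 0 < y - r := by linarith
            have hle : (y - v) / (y - r) ≤ m := by
              rw [hm, div_le_div_iff₀ hyr hsr]
              nlinarith [hy.2, hvr]
            have hle2 : (y - v) ^ (2 - σ) / (y - r) ^ (2 - σ) ≤ m ^ (2 - σ) := by
              rw [← Real.div_rpow hyv.le hyr.le]
              exact Real.rpow_le_rpow (by positivity) hle (by linarith)
            rw [abs_div, abs_of_pos (by positivity : 0 < (y - r) ^ (2 - σ))]
            calc _ = (y - v) ^ (2 - σ) / (y - r) ^ (2 - σ) *
                  (|ψ y - ψ v| / (y - v) ^ (2 - σ)) := by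
                  have : (y - v) ^ (2 - σ) ≠ 0 := by positivity
                  field_simp
              _ ≤ _ := by gcongr
      _ ≤ m ^ (1 - σ) * L := by
          rw [intervalIntegral.integral_const_mul]
          have : m ^ (2 - σ) ≤ m ^ (1 - σ) :=
            Real.rpow_le_rpow_of_exponent_ge hm0 hm1 (by linarith)
          calc _ ≤ m ^ (2 - σ) * L := by gcongr
            _ ≤ _ := by gcongr
      _ = _ := mul_comm _ _
  rw [hid, abs_mul, abs_of_pos (by positivity)]
  calc _ ≤ 1 / Real.Gamma σ * (L * m ^ (1 - σ) + 1 * (L * m ^ (1 - σ))) := by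
        gcongr
        refine (abs_add_le _ _).trans (add_le_add h1 ?_)
        rw [abs_mul, abs_of_pos hσ']
        gcongr
        linarith
    _ = 2 / Real.Gamma σ * L * m ^ (1 - σ) := by ring
    _ ≤ _ := by gcongr

end

/-! ### Majorants of the left-sided derivative -/

/-- A majorant, up to the factor `1 / Γ(1 - σ)`, of `|D^σ_{0+} Φ(·, x)|` at the time `r`. -/
noncomputable def leftMaj (σ : ℝ) (Φ : ℝ → ℝ → ℝ) (r x : ℝ) : ℝ≥0∞ :=
  ‖Φ r x‖ₑ / ENNReal.ofReal (r ^ σ) +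
    ∫⁻ q in Set.Ioo 0 r, ‖Φ r x - Φ q x‖ₑ / ENNReal.ofReal ((r - q) ^ (σ + 1))

/-- The increment part of `leftMass`; its square integral over time is `sqNormOne`. -/
noncomputable def incrMass (σ : ℝ) (Φ : ℝ → ℝ → ℝ) (r : ℝ) : ℝ≥0∞ :=
  ∫⁻ q in Set.Ioo 0 r, normTwo (fun x => Φ r x - Φ q x) / ENNReal.ofReal ((r - q) ^ (σ + 1))

/-- The counterpart of `leftMaj` in which absolute values are replaced by norms of `L²(ℝ)`. -/
noncomputable def leftMass (σ : ℝ) (Φ : ℝ → ℝ → ℝ) (r : ℝ) : ℝ≥0∞ :=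
  normTwo (Φ r) / ENNReal.ofReal (r ^ σ) + incrMass σ Φ r

section

variable {σ : ℝ} {Φ : ℝ → ℝ → ℝ}

lemma measurable_leftMaj (hΦ : Measurable (Function.uncurry Φ)) :
    Measurable (Function.uncurry (leftMaj σ Φ)) := by
  have h2 : Measurable fun p : (ℝ × ℝ) × ℝ => Φ p.1.1 p.1.2 - Φ p.2 p.1.2 :=
    (hΦ.comp measurable_fst).sub
      (hΦ.comp (measurable_snd.prodMk (measurable_snd.comp measurable_fst)))
  have h := measurable_lintegral_Ioo (X := ℝ × ℝ) (F := fun p q => ‖Φ p.1 p.2 - Φ q p.2‖ₑ /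
    ENNReal.ofReal ((p.1 - q) ^ (σ + 1)))
    (h2.enorm.div (by fun_prop)) (measurable_const (a := (0 : ℝ))) measurable_fst
  exact (hΦ.enorm.div (by fun_prop)).add h

lemma measurable_normTwo_sub (hΦ : Measurable (Function.uncurry Φ)) :
    Measurable fun p : ℝ × ℝ => normTwo fun x => Φ p.1 x - Φ p.2 x := by
  simp_rw [normTwo_eq_l2, l2]
  have h2 : Measurable fun p : (ℝ × ℝ) × ℝ => Φ p.1.1 p.2 - Φ p.1.2 p.2 :=
    (hΦ.comp ((measurable_fst.comp measurable_fst).prodMk measurable_snd)).sub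
      (hΦ.comp ((measurable_snd.comp measurable_fst).prodMk measurable_snd))
  exact (Measurable.lintegral_prod_right' (h2.enorm.pow_const 2)).pow_const _

lemma measurable_incrMass (hΦ : Measurable (Function.uncurry Φ)) : Measurable (incrMass σ Φ) :=
  measurable_lintegral_Ioo (X := ℝ) ((measurable_normTwo_sub hΦ).div (by fun_prop))
    measurable_const measurable_id

lemma l2_leftMaj_le (hΦ : Measurable (Function.uncurry Φ)) {r : ℝ} (hr : 0 < r) :
    l2 (leftMaj σ Φ r) ≤ leftMass σ Φ r := by
  have hm : ∀ r, Measurable (Φ r) := fun r => hΦ.comp measurable_prodMk_left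
  have h2 : Measurable fun p : ℝ × ℝ => ‖Φ r p.1 - Φ p.2 p.1‖ₑ /
      ENNReal.ofReal ((r - p.2) ^ (σ + 1)) :=
    (((hm r).comp measurable_fst).sub (hΦ.comp measurable_swap)).enorm.div (by fun_prop)
  have h3 := h2.lintegral_prod_right' (ν := volume.restrict (Set.Ioo 0 r))
  have hdiv : ∀ (a : ℝ), 0 < a → ∀ F : ℝ → ℝ≥0∞,
      l2 (fun x => F x / ENNReal.ofReal a) = l2 F / ENNReal.ofReal a := by
    intro a ha F
    simp_rw [div_eq_mul_inv, mul_comm _ (ENNReal.ofReal a)⁻¹]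
    exact l2_const_mul (ENNReal.inv_ne_top.2 (by simpa using ha)) F
  unfold leftMaj leftMass incrMass
  refine (l2_add_le ((hm r).enorm.div (by fun_prop)).aemeasurable h3.aemeasurable).trans
    (add_le_add (le_of_eq ?_) ((l2_lintegral_le _ h2).trans
      (setLIntegral_mono' measurableSet_Ioo fun q hq => le_of_eq ?_)))
  · rw [normTwo_eq_l2]
    exact hdiv _ (by positivity) _
  · rw [hdiv _ (Real.rpow_pos_of_pos (sub_pos.2 hq.2) _), normTwo_eq_l2]

lemma enorm_div_pos (a : ℝ) {b : ℝ} (hb : 0 < b) : ‖a / b‖ₑ = ‖a‖ₑ / ENNReal.ofReal b := by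
  rw [Real.enorm_eq_ofReal_abs, Real.enorm_eq_ofReal_abs, abs_div, abs_of_pos hb,
    ENNReal.ofReal_div_of_pos hb]

lemma enorm_fracDerivLeft_le (hσ0 : 0 < σ) (hσ1 : σ < 1) {r : ℝ} (hr : 0 < r) (x : ℝ) :
    ‖fracDerivLeft σ 0 (fun s => Φ s x) r‖ₑ ≤
      ENNReal.ofReal (1 / Real.Gamma (1 - σ)) * leftMaj σ Φ r x := by
  have hG : 0 < Real.Gamma (1 - σ) := Real.Gamma_pos_of_pos (by linarith)
  unfold fracDerivLeft leftMaj
  rw [enorm_mul, Real.enorm_of_nonneg (by positivity), sub_zero]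
  gcongr
  refine (enorm_add_le _ _).trans (add_le_add (le_of_eq (enorm_div_pos _ (by positivity))) ?_)
  rw [enorm_mul, Real.enorm_of_nonneg hσ0.le, intervalIntegral.integral_of_le hr.le,
    integral_Ioc_eq_integral_Ioo]
  calc _ ≤ 1 * ∫⁻ y in Set.Ioo 0 r, ‖(Φ r x - Φ y x) / (r - y) ^ (1 + σ)‖ₑ := by
        gcongr
        · rw [← ENNReal.ofReal_one]; exact ENNReal.ofReal_le_ofReal hσ1.le
        · exact enorm_integral_le_lintegral_enorm _
    _ = _ := by
        rw [one_mul]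
        refine setLIntegral_congr_fun measurableSet_Ioo fun y hy => ?_
        rw [enorm_div_pos _ (Real.rpow_pos_of_pos (sub_pos.2 hy.2) _), add_comm]

/-- If the increments of `Φ` are controlled by those of `w` and by a Hölder term, then the mass of
`Φ` is controlled by that of `w`. -/
lemma leftMass_le {w : ℝ → ℝ → ℝ} {θ T : ℝ} (hσθ : σ < θ) {A W : ℝ≥0∞} {m r : ℝ} (hr : 0 < r)
    (hrT : r ≤ T) (h1 : normTwo (Φ r) ≤ A * W)
    (h2 : ∀ q ∈ Set.Ioo 0 r, normTwo (fun x => Φ r x - Φ q x) ≤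
      A * (normTwo (fun x => w r x - w q x) + ENNReal.ofReal ((r - q) ^ θ * m) * W))
    (hA : A ≠ ⊤) (hW : W ≠ ⊤) :
    leftMass σ Φ r ≤ A * (1 + ENNReal.ofReal (T ^ (θ - σ) / (θ - σ))) *
      (ENNReal.ofReal (r ^ (-σ)) * W + incrMass σ w r + ENNReal.ofReal m * W) := by
  have hδ : 0 < θ - σ := by linarith
  set c := ENNReal.ofReal (T ^ (θ - σ) / (θ - σ)) with hc
  have hinv : ∀ (a p : ℝ), 0 < a → (ENNReal.ofReal (a ^ p))⁻¹ = ENNReal.ofReal (a ^ (-p)) := by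
    intro a p ha
    rw [Real.rpow_neg ha.le, ENNReal.ofReal_inv_of_pos (by positivity)]
  have hfirst : normTwo (Φ r) / ENNReal.ofReal (r ^ σ) ≤ A * (ENNReal.ofReal (r ^ (-σ)) * W) := by
    rw [div_eq_mul_inv, hinv _ _ hr]
    calc _ ≤ A * W * ENNReal.ofReal (r ^ (-σ)) := by gcongr
      _ = _ := by ring
  have hsecond : incrMass σ Φ r ≤ A * (incrMass σ w r + c * (ENNReal.ofReal m * W)) := by
    unfold incrMass
    calc _ ≤ ∫⁻ q in Set.Ioo 0 r, A * (normTwo (fun x => w r x - w q x) /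
            ENNReal.ofReal ((r - q) ^ (σ + 1)) +
            ENNReal.ofReal m * W * ENNReal.ofReal ((r - q) ^ (θ - σ - 1))) := by
          refine setLIntegral_mono' measurableSet_Ioo fun q hq => ?_
          have hq' : 0 < r - q := sub_pos.2 hq.2
          have e : ENNReal.ofReal ((r - q) ^ (θ - σ - 1)) =
              ENNReal.ofReal ((r - q) ^ θ) * (ENNReal.ofReal ((r - q) ^ (σ + 1)))⁻¹ := by
            rw [hinv _ _ hq', ← ENNReal.ofReal_mul (by positivity), ← Real.rpow_add hq']
            congr 2
            ring
          rw [e, div_eq_mul_inv, div_eq_mul_inv]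
          calc _ ≤ A * (normTwo (fun x => w r x - w q x) + ENNReal.ofReal ((r - q) ^ θ * m) * W) *
                (ENNReal.ofReal ((r - q) ^ (σ + 1)))⁻¹ := by gcongr; exact h2 q hq
            _ = _ := by
              rw [ENNReal.ofReal_mul (by positivity)]
              ring
      _ = A * (incrMass σ w r + ENNReal.ofReal m * W *
            ENNReal.ofReal (r ^ (θ - σ) / (θ - σ))) := by
          have hmeas : Measurable fun q =>
              ENNReal.ofReal m * W * ENNReal.ofReal ((r - q) ^ (θ - σ - 1)) := by fun_prop
          rw [lintegral_const_mul' _ _ hA, lintegral_add_right _ hmeas,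
            lintegral_const_mul' _ _ (by finiteness), lintegral_rpow_Ioo' hr.le (by linarith)]
          simp only [sub_zero, sub_add_cancel]
          rfl
      _ ≤ _ := by
          rw [mul_comm (ENNReal.ofReal m * W)]
          have hle : ENNReal.ofReal (r ^ (θ - σ) / (θ - σ)) ≤ c := by rw [hc]; gcongr
          exact mul_le_mul' le_rfl (add_le_add le_rfl (mul_le_mul' hle le_rfl))
  unfold leftMass
  calc _ ≤ A * (ENNReal.ofReal (r ^ (-σ)) * W) +
        A * (incrMass σ w r + c * (ENNReal.ofReal m * W)) := add_le_add hfirst hsecond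
    _ ≤ A * (ENNReal.ofReal (r ^ (-σ)) * W) + A * (incrMass σ w r + c * (ENNReal.ofReal m * W)) +
        A * (c * (ENNReal.ofReal (r ^ (-σ)) * W) + c * incrMass σ w r + ENNReal.ofReal m * W) :=
        -- the added terms complete the product of the two sums
        le_self_add
    _ = _ := by ring

/-! ### The evolved forcing -/

/-- The function `φ_t(s, x) = ∫ G(t-s, x, y) w(s, y) dy`, the integrand of the mild equation for
the forcing `w`. -/
noncomputable def evolved (a₁ a₂ ρ₁ ρ₂ : ℝ) (w : ℝ → ℝ → ℝ) (t s x : ℝ) : ℝ :=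
  opG a₁ a₂ ρ₁ ρ₂ (t - s) (w s) x

variable {a₁ a₂ ρ₁ ρ₂ θ T : ℝ} {w : ℝ → ℝ → ℝ} {K : ℝ≥0}

lemma measurable_evolved_triple (hw : Measurable (Function.uncurry w)) :
    Measurable fun p : ℝ × ℝ × ℝ => evolved a₁ a₂ ρ₁ ρ₂ w p.1 p.2.1 p.2.2 := by
  have hG := measurable_G (a₁ := a₁) (a₂ := a₂) (ρ₁ := ρ₁) (ρ₂ := ρ₂)
  have h : Measurable fun p : (ℝ × ℝ × ℝ) × ℝ =>
      G a₁ a₂ ρ₁ ρ₂ (p.1.1 - p.1.2.1) p.1.2.2 p.2 * w p.1.2.1 p.2 := by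
    refine (hG.comp (Measurable.prodMk ?_ (Measurable.prodMk ?_ measurable_snd))).mul
      (hw.comp (Measurable.prodMk ?_ measurable_snd)) <;> fun_prop
  exact h.stronglyMeasurable.integral_prod_right'.measurable

lemma measurable_evolved (hw : Measurable (Function.uncurry w)) (t : ℝ) :
    Measurable (Function.uncurry (evolved a₁ a₂ ρ₁ ρ₂ w t)) :=
  (measurable_evolved_triple hw).comp (measurable_const.prodMk measurable_id)

/-- The sum of the three contributions to the mass of `evolved w s` at the time `r < s`. -/
noncomputable def massBound (σ θ : ℝ) (w : ℝ → ℝ → ℝ) (W : ℝ≥0∞) (s r : ℝ) : ℝ≥0∞ :=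
  ENNReal.ofReal (r ^ (-σ)) * W + incrMass σ w r + ENNReal.ofReal ((s - r) ^ (-θ)) * W

/-- The constant `1 + ∫_0^T r^(θ-σ-1) dr`. -/
noncomputable def massConst (σ θ T : ℝ) : ℝ≥0 := 1 + (T ^ (θ - σ) / (θ - σ)).toNNReal

/-- An increment of `evolved w s` over `[q, r]` is the evolution of the increment of `w` plus a
first difference in time of the operators, applied to `w q`. -/
lemma leftMass_evolved_le (hK : OpBounds a₁ a₂ ρ₁ ρ₂ θ K) (ha₁ : 0 < a₁) (ha₂ : 0 < a₂)
    (hσθ : σ < θ) (hw : Measurable (Function.uncurry w)) (hfin : ∀ r, normTwo (w r) ≠ ⊤)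
    {W : ℝ≥0∞} (hW : W ≠ ⊤) {r s : ℝ} (hr : 0 < r) (hrs : r < s) (hs : s ≤ T)
    (hWs : ∀ q ∈ Set.Icc 0 s, normTwo (w q) ≤ W) :
    leftMass σ (evolved a₁ a₂ ρ₁ ρ₂ w s) r ≤
      K * massConst σ θ T * massBound σ θ w W s r := by
  have hm : ∀ r, Measurable (w r) := fun r => hw.comp measurable_prodMk_left
  have hsr : 0 < s - r := sub_pos.2 hrs
  refine leftMass_le hσθ hr (by linarith) ?_ (fun q hq => ?_) (by finiteness) hW
  · exact (hK.bound _ _ (hm r) (hfin r)).trans (by gcongr; exact hWs r ⟨hr.le, hrs.le⟩)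
  · have hqr : 0 < r - q := sub_pos.2 hq.2
    have hsub2 : normTwo (fun x => w r x - w q x) ≠ ⊤ :=
      ne_top_of_le_ne_top (ENNReal.add_ne_top.2 ⟨hfin r, hfin q⟩)
        (normTwo_sub_le (hm r).aestronglyMeasurable (hm q).aestronglyMeasurable)
    have e : (fun x => evolved a₁ a₂ ρ₁ ρ₂ w s r x - evolved a₁ a₂ ρ₁ ρ₂ w s q x) =
        fun x => opG a₁ a₂ ρ₁ ρ₂ (s - r) (fun y => w r y - w q y) x +
          (opG a₁ a₂ ρ₁ ρ₂ (s - r) (w q) x - opG a₁ a₂ ρ₁ ρ₂ (s - r + (r - q)) (w q) x) := by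
      funext x
      rw [opG_sub ha₁ ha₂ (hm r) (hfin r) (hm q) (hfin q), sub_add_sub_cancel s r q]
      simp only [evolved]
      ring
    rw [e]
    refine (normTwo_add_le
      (stronglyMeasurable_opG ((hm r).sub (hm q))).aestronglyMeasurable
      ((stronglyMeasurable_opG (hm q)).aestronglyMeasurable.sub
        (stronglyMeasurable_opG (hm q)).aestronglyMeasurable)).trans ?_
    rw [mul_add]
    refine add_le_add (hK.bound _ _ ((hm r).sub (hm q)) hsub2) ?_
    refine (hK.diff _ _ _ hsr hqr.le (hm q) (hfin q)).trans ?_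
    rw [mul_assoc, Real.div_rpow hqr.le hsr.le, Real.rpow_neg hsr.le, ← div_eq_mul_inv]
    gcongr
    exact hWs q ⟨hq.1.le, by linarith [hq.2]⟩

/-- Moving the end point from `v` to `s` costs the factor `((s - v) / (v - r)) ^ θ`. An increment of
the difference over `[q, r]` is a first difference in time of the operators, applied to the
increment of `w`, plus a second difference applied to `w q`. -/
lemma leftMass_evolved_sub_le (hK : OpBounds a₁ a₂ ρ₁ ρ₂ θ K) (ha₁ : 0 < a₁) (ha₂ : 0 < a₂)
    (hσθ : σ < θ) (hw : Measurable (Function.uncurry w)) (hfin : ∀ r, normTwo (w r) ≠ ⊤)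
    {W : ℝ≥0∞} (hW : W ≠ ⊤) {r v s : ℝ} (hr : 0 < r) (hrv : r < v) (hvs : v < s) (hs : s ≤ T)
    (hWs : ∀ q ∈ Set.Icc 0 s, normTwo (w q) ≤ W) :
    leftMass σ (fun r x => evolved a₁ a₂ ρ₁ ρ₂ w s r x - evolved a₁ a₂ ρ₁ ρ₂ w v r x) r ≤
      K * ENNReal.ofReal ((s - v) ^ θ * (v - r) ^ (-θ)) * massConst σ θ T *
        massBound σ θ w W v r := by
  have hm : ∀ r, Measurable (w r) := fun r => hw.comp measurable_prodMk_left
  have hvr : 0 < v - r := sub_pos.2 hrv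
  have hsv : 0 < s - v := sub_pos.2 hvs
  have e0 : ∀ (q x : ℝ), evolved a₁ a₂ ρ₁ ρ₂ w s q x - evolved a₁ a₂ ρ₁ ρ₂ w v q x =
      -(opG a₁ a₂ ρ₁ ρ₂ (v - q) (w q) x - opG a₁ a₂ ρ₁ ρ₂ (v - q + (s - v)) (w q) x) := by
    intro q x
    simp only [evolved]
    rw [show v - q + (s - v) = s - q by ring]
    ring
  have eneg : ∀ g : ℝ → ℝ, normTwo (fun x => -g x) = normTwo g := fun g => eLpNorm_neg g 2 volume
  have hκ : ENNReal.ofReal (((s - v) / (v - r)) ^ θ) =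
      ENNReal.ofReal ((s - v) ^ θ * (v - r) ^ (-θ)) := by
    rw [Real.div_rpow hsv.le hvr.le, Real.rpow_neg hvr.le, ← div_eq_mul_inv]
  refine leftMass_le hσθ hr (by linarith) ?_ (fun q hq => ?_) (by finiteness) hW
  · simp_rw [e0]
    rw [eneg]
    refine (hK.diff _ _ _ hvr hsv.le (hm r) (hfin r)).trans ?_
    rw [hκ]
    gcongr
    exact hWs r ⟨hr.le, by linarith⟩
  · have hqr : 0 < r - q := sub_pos.2 hq.2
    have hsub2 : normTwo (fun x => w r x - w q x) ≠ ⊤ :=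
      ne_top_of_le_ne_top (ENNReal.add_ne_top.2 ⟨hfin r, hfin q⟩)
        (normTwo_sub_le (hm r).aestronglyMeasurable (hm q).aestronglyMeasurable)
    have e : (fun x => (evolved a₁ a₂ ρ₁ ρ₂ w s r x - evolved a₁ a₂ ρ₁ ρ₂ w v r x) -
          (evolved a₁ a₂ ρ₁ ρ₂ w s q x - evolved a₁ a₂ ρ₁ ρ₂ w v q x)) =
        fun x => -((opG a₁ a₂ ρ₁ ρ₂ (v - r) (fun y => w r y - w q y) x -
            opG a₁ a₂ ρ₁ ρ₂ (v - r + (s - v)) (fun y => w r y - w q y) x) +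
          (opG a₁ a₂ ρ₁ ρ₂ (v - r) (w q) x - opG a₁ a₂ ρ₁ ρ₂ (v - r + (s - v)) (w q) x -
            (opG a₁ a₂ ρ₁ ρ₂ (v - r + (r - q)) (w q) x -
              opG a₁ a₂ ρ₁ ρ₂ (v - r + (s - v) + (r - q)) (w q) x))) := by
      funext x
      rw [e0, e0, opG_sub ha₁ ha₂ (hm r) (hfin r) (hm q) (hfin q),
        opG_sub ha₁ ha₂ (hm r) (hfin r) (hm q) (hfin q), show v - r + (r - q) = v - q by ring,
        show v - r + (s - v) + (r - q) = v - q + (s - v) by ring]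
      ring
    have hmo : ∀ a {g : ℝ → ℝ}, Measurable g → AEStronglyMeasurable (opG a₁ a₂ ρ₁ ρ₂ a g) :=
      fun a g hg => (stronglyMeasurable_opG hg).aestronglyMeasurable
    rw [e, eneg]
    refine (normTwo_add_le ((hmo _ ((hm r).sub (hm q))).sub (hmo _ ((hm r).sub (hm q))))
      (((hmo _ (hm q)).sub (hmo _ (hm q))).sub ((hmo _ (hm q)).sub (hmo _ (hm q))))).trans ?_
    rw [mul_add]
    refine add_le_add ((hK.diff _ _ _ hvr hsv.le ((hm r).sub (hm q)) hsub2).trans ?_)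
      ((hK.diff_diff _ _ _ _ hvr hsv.le hqr.le (hm q) (hfin q)).trans ?_)
    · rw [hκ]
      rfl
    · have e3 : ENNReal.ofReal (((s - v) * (r - q) / (v - r) ^ 2) ^ θ) =
          ENNReal.ofReal ((s - v) ^ θ * (v - r) ^ (-θ)) *
            ENNReal.ofReal ((r - q) ^ θ * (v - r) ^ (-θ)) := by
        rw [← ENNReal.ofReal_mul (by positivity)]
        congr 1
        rw [Real.div_rpow (by positivity) (by positivity), Real.mul_rpow hsv.le hqr.le,
          Real.rpow_neg hvr.le, sq, Real.mul_rpow hvr.le hvr.le]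
        field_simp
      rw [e3, mul_assoc, mul_assoc, mul_assoc]
      gcongr
      exact hWs q ⟨hq.1.le, by linarith [hq.2]⟩

end

/-! ### Time integrals of the mass -/

section

variable {σ θ T : ℝ} {w : ℝ → ℝ → ℝ}

/-- The forcing `w` is measurable, takes values in `L²(ℝ)`, and up to the time `s` both parts of
its norm are bounded by the finite number `Q`. -/
structure ForcingBound (σ : ℝ) (w : ℝ → ℝ → ℝ) (s : ℝ) (Q : ℝ≥0∞) : Prop where
  measurable : Measurable (Function.uncurry w)
  normTwo_ne_top : ∀ r, normTwo (w r) ≠ ⊤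
  sup_le : ∀ q ∈ Set.Icc 0 s, normTwo (w q) ^ 2 ≤ Q
  incr_le : sqNormOne σ s w ≤ Q
  ne_top : Q ≠ ⊤

lemma sqNormOne_eq (s : ℝ) : sqNormOne σ s w = ∫⁻ r in Set.Ioo 0 s, incrMass σ w r ^ 2 := rfl

lemma sqNormOne_mono {u : ℝ → ℝ → ℝ} {s t : ℝ} (h : s ≤ t) :
    sqNormOne σ s u ≤ sqNormOne σ t u :=
  lintegral_mono_set (Set.Ioo_subset_Ioo_right h)

lemma sqrt_sq (Q : ℝ≥0∞) : (Q ^ (1 / 2 : ℝ)) ^ 2 = Q := by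
  rw [← ENNReal.rpow_natCast, ← ENNReal.rpow_mul]; norm_num

lemma sq_sqrt (Q : ℝ≥0∞) : (Q ^ 2) ^ (1 / 2 : ℝ) = Q := by
  rw [← ENNReal.rpow_natCast, ← ENNReal.rpow_mul]; norm_num

lemma ForcingBound.mono {s v : ℝ} {Q : ℝ≥0∞} (h : ForcingBound σ w s Q) (hv : v ≤ s) :
    ForcingBound σ w v Q :=
  ⟨h.measurable, h.normTwo_ne_top, fun q hq => h.sup_le q ⟨hq.1, hq.2.trans hv⟩,
    (sqNormOne_mono hv).trans h.incr_le, h.ne_top⟩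

lemma ForcingBound.normTwo_le {s : ℝ} {Q : ℝ≥0∞} (h : ForcingBound σ w s Q) :
    ∀ q ∈ Set.Icc 0 s, normTwo (w q) ≤ Q ^ (1 / 2 : ℝ) := fun q hq => by
  rw [← sq_sqrt (normTwo (w q))]
  exact ENNReal.rpow_le_rpow (h.sup_le q hq) (by norm_num)

lemma add_add_sq_le (x y z : ℝ≥0∞) : (x + y + z) ^ 2 ≤ 9 * (x ^ 2 + y ^ 2 + z ^ 2) := by
  set m := max (max x y) z with hm
  have h1 : x + y + z ≤ 3 * m := by
    calc x + y + z ≤ m + m + m := by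
          gcongr
          · exact (le_max_left _ _).trans (le_max_left _ _)
          · exact (le_max_right _ _).trans (le_max_left _ _)
          · exact le_max_right _ _
      _ = 3 * m := by ring
  have h2 : m ^ 2 ≤ x ^ 2 + y ^ 2 + z ^ 2 := by
    rcases max_choice (max x y) z with h | h
    · rcases max_choice x y with h' | h'
      · rw [hm, h, h', add_assoc]; exact le_self_add
      · rw [hm, h, h', add_right_comm]; exact le_add_self
    · rw [hm, h]; exact le_add_self
  calc (x + y + z) ^ 2 ≤ (3 * m) ^ 2 := by gcongr
    _ = 9 * m ^ 2 := by ring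
    _ ≤ _ := by gcongr

/-- The time integral of the mass against the singular weight `(s-r)^(-θ)` is finite because that
weight is square integrable: this is where `σ < θ < 1/2` is needed. -/
lemma exists_lintegral_massBound_le (hσθ : σ < θ) (hθ : θ < 1 / 2) :
    ∃ c : ℝ≥0, ∀ (w : ℝ → ℝ → ℝ) (Q : ℝ≥0∞) (s : ℝ), 0 ≤ s → s ≤ T → ForcingBound σ w s Q →
      ∫⁻ r in Set.Ioo 0 s, ENNReal.ofReal ((s - r) ^ (-θ)) *
        massBound σ θ w (Q ^ (1 / 2 : ℝ)) s r ≤ c * Q ^ (1 / 2 : ℝ) := by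
  set b : ℝ≥0 := (T ^ (1 - 2 * θ) / (1 - 2 * θ)).toNNReal with hb
  set b' : ℝ≥0 := (T ^ (1 - 2 * σ) / (1 - 2 * σ)).toNNReal with hb'
  refine ⟨3 * (b' + 1 + b), fun w Q s hs0 hs h => ?_⟩
  have hsq : ∀ a p : ℝ, 0 < a →
      ENNReal.ofReal (a ^ (-p)) ^ 2 = ENNReal.ofReal (a ^ (-(2 * p))) := by
    intro a p ha
    rw [← ENNReal.ofReal_pow (by positivity), ← Real.rpow_natCast, ← Real.rpow_mul ha.le]
    congr 2
    push_cast
    ring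
  have hk : ∫⁻ r in Set.Ioo 0 s, ENNReal.ofReal ((s - r) ^ (-θ)) ^ 2 ≤ b := by
    rw [setLIntegral_congr_fun measurableSet_Ioo fun r hr => hsq (s - r) θ (sub_pos.2 hr.2),
      lintegral_rpow_Ioo' hs0 (by linarith), hb, ENNReal.ofReal]
    have : 0 < 1 - 2 * θ := by linarith
    rw [show -(2 * θ) + 1 = 1 - 2 * θ by ring, sub_zero]
    gcongr
  have hk' : ∫⁻ r in Set.Ioo 0 s, ENNReal.ofReal (r ^ (-σ)) ^ 2 ≤ b' := by
    rw [setLIntegral_congr_fun measurableSet_Ioo fun r hr => hsq r σ hr.1]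
    have := lintegral_rpow_Ioo hs0 (p := -(2 * σ)) (by linarith)
    simp only [sub_zero] at this
    rw [this, hb', ENNReal.ofReal]
    have : 0 < 1 - 2 * σ := by linarith
    rw [show -(2 * σ) + 1 = 1 - 2 * σ by ring]
    gcongr
  have hincr := measurable_incrMass (σ := σ) h.measurable
  have hm1 : Measurable fun r : ℝ => ENNReal.ofReal (r ^ (-σ)) := by fun_prop
  have hm2 : Measurable fun r : ℝ => ENNReal.ofReal ((s - r) ^ (-θ)) := by fun_prop
  have hmass : Measurable fun r => massBound σ θ w (Q ^ (1 / 2 : ℝ)) s r :=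
    ((hm1.mul_const _).add hincr).add (hm2.mul_const _)
  have hR : ∫⁻ r in Set.Ioo 0 s, massBound σ θ w (Q ^ (1 / 2 : ℝ)) s r ^ 2 ≤
      9 * (b' + 1 + b) * Q := by
    calc _ ≤ ∫⁻ r in Set.Ioo 0 s, 9 * (ENNReal.ofReal (r ^ (-σ)) ^ 2 * Q + incrMass σ w r ^ 2 +
            ENNReal.ofReal ((s - r) ^ (-θ)) ^ 2 * Q) := by
          refine lintegral_mono fun r => (add_add_sq_le _ _ _).trans (le_of_eq ?_)
          rw [mul_pow, mul_pow, sqrt_sq]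
      _ = 9 * ((∫⁻ r in Set.Ioo 0 s, ENNReal.ofReal (r ^ (-σ)) ^ 2) * Q + sqNormOne σ s w +
            (∫⁻ r in Set.Ioo 0 s, ENNReal.ofReal ((s - r) ^ (-θ)) ^ 2) * Q) := by
          have hm1' : Measurable fun r : ℝ => ENNReal.ofReal (r ^ (-σ)) ^ 2 * Q := by fun_prop
          have hm2' : Measurable fun r : ℝ => ENNReal.ofReal (r ^ (-σ)) ^ 2 * Q +
            incrMass σ w r ^ 2 := hm1'.add (hincr.pow_const 2)
          rw [lintegral_const_mul' _ _ (by finiteness), lintegral_add_left hm2',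
            lintegral_add_left hm1', lintegral_mul_const _ (hm1.pow_const 2),
            lintegral_mul_const _ (hm2.pow_const 2), sqNormOne_eq]
      _ ≤ 9 * (b' * Q + Q + b * Q) := by gcongr; exact h.incr_le
      _ = _ := by ring
  rw [← ENNReal.pow_le_pow_left_iff two_ne_zero]
  refine (lintegral_mul_sq_le _ hm2.aemeasurable hmass.aemeasurable).trans ?_
  rw [mul_pow, sqrt_sq]
  push_cast
  calc _ ≤ (b : ℝ≥0∞) * (9 * (b' + 1 + b) * Q) := by gcongr
    _ ≤ (b' + 1 + b) * (9 * (b' + 1 + b) * Q) := by gcongr; exact le_add_self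
    _ = _ := by ring

lemma lintegral_massBound_Ioo_le (hθ : 0 ≤ θ) (W : ℝ≥0∞) {v s : ℝ} (hv : 0 ≤ v) :
    ∫⁻ r in Set.Ioo v s, massBound σ θ w W s r ≤ ENNReal.ofReal ((s - v) ^ θ) *
      ∫⁻ r in Set.Ioo 0 s, ENNReal.ofReal ((s - r) ^ (-θ)) * massBound σ θ w W s r := by
  rw [← lintegral_const_mul' _ _ (by finiteness)]
  calc _ ≤ ∫⁻ r in Set.Ioo v s, ENNReal.ofReal ((s - v) ^ θ) *
        (ENNReal.ofReal ((s - r) ^ (-θ)) * massBound σ θ w W s r) := by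
        refine setLIntegral_mono' measurableSet_Ioo fun r hr => ?_
        have hsr : 0 < s - r := sub_pos.2 hr.2
        have hsv : 0 < s - v := by linarith [hr.1]
        rw [← mul_assoc, ← ENNReal.ofReal_mul (by positivity)]
        refine le_mul_of_one_le_left zero_le ?_
        rw [← ENNReal.ofReal_one]
        apply ENNReal.ofReal_le_ofReal
        rw [Real.rpow_neg hsr.le, ← div_eq_mul_inv, ← Real.div_rpow hsv.le hsr.le]
        exact Real.one_le_rpow ((one_le_div hsr).2 (by linarith [hr.1])) hθ
    _ ≤ _ := lintegral_mono_set (Set.Ioo_subset_Ioo_left hv)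

/-! ### The integral against one driving path -/

section pointwise

variable {Φ : ℝ → ℝ → ℝ} {s x : ℝ}

lemma measurable_fracDerivLeft (hΦ : Measurable (Function.uncurry Φ)) (x : ℝ) :
    Measurable fun r => fracDerivLeft σ 0 (fun q => Φ q x) r := by
  have h1 : Measurable fun r => Φ r x := hΦ.comp measurable_prodMk_right
  have h2 : Measurable fun p : ℝ × ℝ => (Φ p.1 x - Φ p.2 x) / (p.1 - p.2) ^ (1 + σ) :=
    ((h1.comp measurable_fst).sub (h1.comp measurable_snd)).div (by fun_prop)
  have h3 := measurable_intervalIntegral (X := ℝ)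
    (F := fun r y => (Φ r x - Φ y x) / (r - y) ^ (1 + σ)) h2 (measurable_const (a := (0 : ℝ)))
    measurable_id
  unfold fracDerivLeft
  exact ((h1.div (by fun_prop)).add (h3.const_mul _)).const_mul _

lemma ae_intervalIntegrable_of_leftMaj (hΦ : Measurable (Function.uncurry Φ))
    (hfin : ∫⁻ r in Set.Ioo 0 s, leftMaj σ Φ r x < ⊤) :
    ∀ᵐ r ∂(volume : Measure ℝ).restrict (Set.Ioo 0 s),
      IntervalIntegrable (fun y => (Φ r x - Φ y x) / (r - y) ^ (1 + σ)) volume 0 r := by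
  have hm : Measurable fun r => leftMaj σ Φ r x := (measurable_leftMaj hΦ).of_uncurry_right
  have h1 : Measurable fun r => Φ r x := hΦ.comp measurable_prodMk_right
  filter_upwards [ae_lt_top hm hfin.ne, ae_restrict_mem measurableSet_Ioo] with r hr hr0
  rw [intervalIntegrable_iff_integrableOn_Ioo_of_le hr0.1.le]
  refine ⟨((measurable_const.sub h1).div (by fun_prop)).aestronglyMeasurable, ?_⟩
  rw [hasFiniteIntegral_iff_enorm]
  refine lt_of_le_of_lt (le_of_eq ?_) (lt_of_le_of_lt le_add_self hr)
  refine setLIntegral_congr_fun measurableSet_Ioo fun y hy => ?_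
  rw [enorm_div_pos _ (Real.rpow_pos_of_pos (sub_pos.2 hy.2) _), add_comm]

lemma integrableOn_fracDerivLeft (hσ0 : 0 < σ) (hσ1 : σ < 1)
    (hΦ : Measurable (Function.uncurry Φ)) (hfin : ∫⁻ r in Set.Ioo 0 s, leftMaj σ Φ r x < ⊤) :
    IntegrableOn (fun r => fracDerivLeft σ 0 (fun q => Φ q x) r) (Set.Ioo 0 s) := by
  refine ⟨(measurable_fracDerivLeft hΦ x).aestronglyMeasurable, ?_⟩
  rw [hasFiniteIntegral_iff_enorm]
  calc _ ≤ ∫⁻ r in Set.Ioo 0 s, ENNReal.ofReal (1 / Real.Gamma (1 - σ)) * leftMaj σ Φ r x :=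
        setLIntegral_mono' measurableSet_Ioo fun r hr => enorm_fracDerivLeft_le hσ0 hσ1 hr.1 x
    _ < ⊤ := by
        rw [lintegral_const_mul' _ _ (by finiteness)]
        exact ENNReal.mul_lt_top (by finiteness) hfin

lemma fracDerivLeft_sub {φ₁ φ₂ : ℝ → ℝ} {r : ℝ}
    (h1 : IntervalIntegrable (fun y => (φ₁ r - φ₁ y) / (r - y) ^ (1 + σ)) volume 0 r)
    (h2 : IntervalIntegrable (fun y => (φ₂ r - φ₂ y) / (r - y) ^ (1 + σ)) volume 0 r) :
    fracDerivLeft σ 0 (fun q => φ₁ q - φ₂ q) r =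
      fracDerivLeft σ 0 φ₁ r - fracDerivLeft σ 0 φ₂ r := by
  have e : ∀ y, (φ₁ r - φ₂ r - (φ₁ y - φ₂ y)) / (r - y) ^ (1 + σ) =
      (φ₁ r - φ₁ y) / (r - y) ^ (1 + σ) - (φ₂ r - φ₂ y) / (r - y) ^ (1 + σ) :=
    fun y => by ring
  simp only [fracDerivLeft, e]
  rw [intervalIntegral.integral_sub h1 h2]
  ring

end pointwise

/-- The constant in the bounds of the generalized Lebesgue-Stieltjes integral. -/
noncomputable def glsConst (σ : ℝ) : ℝ≥0 :=
  (1 / Real.Gamma (1 - σ)).toNNReal * (2 / Real.Gamma σ).toNNReal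

section driven

variable {ψ : ℝ → ℝ} {Φ Ψ : ℝ → ℝ → ℝ} {s v x : ℝ}

lemma glsIntegral_eq (φ : ℝ → ℝ) (hs : 0 ≤ s) : glsIntegral σ 0 s φ ψ =
    ∫ r in Set.Ioo 0 s, fracDerivLeft σ 0 φ r * driverDeriv σ ψ s r := by
  rw [glsIntegral, intervalIntegral.integral_of_le hs, integral_Ioc_eq_integral_Ioo]
  rfl

lemma enorm_driverDeriv_le (hσ0 : 0 < σ) (hσ1 : σ < 1) (hψ : Continuous ψ)
    (hfin : seminormZero σ T ψ ≠ ⊤) {b r : ℝ} (hr : 0 ≤ r) (hrb : r < b) (hb : b ≤ T) :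
    ‖driverDeriv σ ψ b r‖ₑ ≤ ENNReal.ofReal (2 / Real.Gamma σ) * seminormZero σ T ψ := by
  have hG : 0 < Real.Gamma σ := Real.Gamma_pos_of_pos hσ0
  have h := ENNReal.ofReal_le_ofReal (abs_driverDeriv_le hσ0 hσ1 hψ hfin hr hrb hb)
  rwa [ENNReal.ofReal_mul (by positivity), ENNReal.ofReal_toReal hfin,
    ← Real.enorm_eq_ofReal_abs] at h

lemma integrableOn_mul_driverDeriv (hσ0 : 0 < σ) (hσ1 : σ < 1) (hψ : Continuous ψ)
    (hfin : seminormZero σ T ψ ≠ ⊤) (hs : s ≤ T) (hΦ : Measurable (Function.uncurry Φ))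
    (hΦfin : ∫⁻ r in Set.Ioo 0 s, leftMaj σ Φ r x < ⊤) :
    IntegrableOn (fun r => fracDerivLeft σ 0 (fun q => Φ q x) r * driverDeriv σ ψ s r)
      (Set.Ioo 0 s) := by
  refine (integrableOn_fracDerivLeft hσ0 hσ1 hΦ hΦfin).mul_bdd
    (c := 2 / Real.Gamma σ * (seminormZero σ T ψ).toReal) ?_ ?_
  · exact ((measurable_driverDeriv hψ).comp
      (measurable_const.prodMk measurable_id)).aestronglyMeasurable
  · exact ae_restrict_of_forall_mem measurableSet_Ioo fun r hr =>
      abs_driverDeriv_le hσ0 hσ1 hψ hfin hr.1.le hr.2 hs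

lemma lintegral_fracDerivLeft_mul_le (hσ0 : 0 < σ) (hσ1 : σ < 1) (hψ : Continuous ψ)
    (hfin : seminormZero σ T ψ ≠ ⊤) (hs : s ≤ T) (hv : 0 ≤ v) :
    ∫⁻ r in Set.Ioo v s, ‖fracDerivLeft σ 0 (fun q => Φ q x) r * driverDeriv σ ψ s r‖ₑ ≤
      glsConst σ * seminormZero σ T ψ * ∫⁻ r in Set.Ioo v s, leftMaj σ Φ r x := by
  rw [← lintegral_const_mul' _ _ (by finiteness)]
  refine setLIntegral_mono' measurableSet_Ioo fun r hr => ?_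
  rw [enorm_mul]
  calc _ ≤ ENNReal.ofReal (1 / Real.Gamma (1 - σ)) * leftMaj σ Φ r x *
        (ENNReal.ofReal (2 / Real.Gamma σ) * seminormZero σ T ψ) :=
        mul_le_mul' (enorm_fracDerivLeft_le hσ0 hσ1 (by linarith [hr.1]) x)
          (enorm_driverDeriv_le hσ0 hσ1 hψ hfin (by linarith [hr.1]) hr.2 hs)
    _ = _ := by
        rw [glsConst]; push_cast
        rw [ENNReal.ofReal, ENNReal.ofReal]
        ring

lemma enorm_glsIntegral_le (hσ0 : 0 < σ) (hσ1 : σ < 1) (hψ : Continuous ψ)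
    (hfin : seminormZero σ T ψ ≠ ⊤) (hs0 : 0 ≤ s) (hs : s ≤ T) :
    ‖glsIntegral σ 0 s (fun r => Φ r x) ψ‖ₑ ≤
      glsConst σ * seminormZero σ T ψ * ∫⁻ r in Set.Ioo 0 s, leftMaj σ Φ r x := by
  rw [glsIntegral_eq _ hs0]
  exact (enorm_integral_le_lintegral_enorm _).trans
    (lintegral_fracDerivLeft_mul_le hσ0 hσ1 hψ hfin hs le_rfl)

/-- The difference of two integrals with different integrands and different end points `v < s`.
No additivity of the integral in the interval is used: both integrals are compared on `(0, v)`
through the change of the driving derivative under the change of the end point. -/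
lemma enorm_glsIntegral_sub_le (hσ0 : 0 < σ) (hσ1 : σ < 1) (hψ : Continuous ψ)
    (hfin : seminormZero σ T ψ ≠ ⊤) (hθ0 : 0 ≤ θ) (hθ : θ ≤ 1 - σ) (hv : 0 < v) (hvs : v < s)
    (hs : s ≤ T) (hΦ : Measurable (Function.uncurry Φ)) (hΨ : Measurable (Function.uncurry Ψ))
    (hΦfin : ∫⁻ r in Set.Ioo 0 s, leftMaj σ Φ r x < ⊤)
    (hΨfin : ∫⁻ r in Set.Ioo 0 v, leftMaj σ Ψ r x < ⊤) :
    ‖glsIntegral σ 0 s (fun r => Φ r x) ψ - glsIntegral σ 0 v (fun r => Ψ r x) ψ‖ₑ ≤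
      glsConst σ * seminormZero σ T ψ *
        ((∫⁻ r in Set.Ioo 0 v, leftMaj σ (fun r x => Φ r x - Ψ r x) r x) +
          (∫⁻ r in Set.Ioo 0 v, ENNReal.ofReal ((s - v) ^ θ * (v - r) ^ (-θ)) * leftMaj σ Φ r x) +
          ∫⁻ r in Set.Ioo v s, leftMaj σ Φ r x) := by
  set D₁ := fun r => fracDerivLeft σ 0 (fun q => Φ q x) r with hD₁
  set D₂ := fun r => fracDerivLeft σ 0 (fun q => Ψ q x) r with hD₂
  set D₃ := fun r => fracDerivLeft σ 0 (fun q => Φ q x - Ψ q x) r with hD₃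
  set Es := driverDeriv σ ψ s with hEs
  set Ev := driverDeriv σ ψ v with hEv
  have hΦv : ∫⁻ r in Set.Ioo 0 v, leftMaj σ Φ r x < ⊤ :=
    (lintegral_mono_set (Set.Ioo_subset_Ioo_right hvs.le)).trans_lt hΦfin
  have hi1 : IntegrableOn (fun r => D₁ r * Es r) (Set.Ioo 0 s) :=
    integrableOn_mul_driverDeriv hσ0 hσ1 hψ hfin hs hΦ hΦfin
  have hi2 : IntegrableOn (fun r => D₂ r * Ev r) (Set.Ioo 0 v) :=
    integrableOn_mul_driverDeriv hσ0 hσ1 hψ hfin (by linarith) hΨ hΨfin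
  have hi1v : IntegrableOn (fun r => D₁ r * Es r) (Set.Ioo 0 v) :=
    hi1.mono_set (Set.Ioo_subset_Ioo_right hvs.le)
  have hsplit : ∫ r in Set.Ioo 0 s, D₁ r * Es r =
      (∫ r in Set.Ioo 0 v, D₁ r * Es r) + ∫ r in Set.Ioo v s, D₁ r * Es r := by
    simp_rw [← integral_Ioc_eq_integral_Ioo]
    rw [← Set.Ioc_union_Ioc_eq_Ioc hv.le hvs.le, setIntegral_union
      (Set.Ioc_disjoint_Ioc_of_le le_rfl) measurableSet_Ioc]
    · rw [integrableOn_Ioc_iff_integrableOn_Ioo]; exact hi1v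
    · rw [integrableOn_Ioc_iff_integrableOn_Ioo]
      exact hi1.mono_set (Set.Ioo_subset_Ioo_left hv.le)
  rw [glsIntegral_eq _ (hv.le.trans hvs.le), glsIntegral_eq _ hv.le]
  have hre : (∫ r in Set.Ioo 0 s, D₁ r * Es r) - ∫ r in Set.Ioo 0 v, D₂ r * Ev r =
      (∫ r in Set.Ioo 0 v, (D₁ r * Es r - D₂ r * Ev r)) + ∫ r in Set.Ioo v s, D₁ r * Es r := by
    rw [hsplit, integral_sub hi1v hi2]; ring
  have hG : 0 < Real.Gamma σ := Real.Gamma_pos_of_pos hσ0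
  refine (congrArg _ hre).le.trans ((enorm_add_le _ _).trans ?_)
  rw [mul_add]
  refine add_le_add ?_ ((enorm_integral_le_lintegral_enorm _).trans
    (lintegral_fracDerivLeft_mul_le hσ0 hσ1 hψ hfin hs hv.le))
  have hD3m : Measurable fun r => ‖D₃ r * Ev r‖ₑ := by
    refine (Measurable.mul ?_ ?_).enorm
    · exact measurable_fracDerivLeft (Φ := fun r x => Φ r x - Ψ r x) (hΦ.sub hΨ) x
    · exact (measurable_driverDeriv hψ).comp (measurable_const.prodMk measurable_id)
  refine (enorm_integral_le_lintegral_enorm _).trans ?_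
  calc ∫⁻ r in Set.Ioo 0 v, ‖D₁ r * Es r - D₂ r * Ev r‖ₑ
      ≤ ∫⁻ r in Set.Ioo 0 v, (‖D₃ r * Ev r‖ₑ + ‖D₁ r‖ₑ * ‖Es r - Ev r‖ₑ) := by
        refine lintegral_mono_ae ?_
        filter_upwards [ae_intervalIntegrable_of_leftMaj hΦ hΦv,
          ae_intervalIntegrable_of_leftMaj hΨ hΨfin] with r h1 h2
        have e : D₁ r * Es r - D₂ r * Ev r = D₃ r * Ev r + D₁ r * (Es r - Ev r) := by
          rw [hD₃]
          simp only
          rw [fracDerivLeft_sub h1 h2]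
          ring
        rw [e, ← enorm_mul]
        exact enorm_add_le _ _
    _ = (∫⁻ r in Set.Ioo 0 v, ‖D₃ r * Ev r‖ₑ) +
          ∫⁻ r in Set.Ioo 0 v, ‖D₁ r‖ₑ * ‖Es r - Ev r‖ₑ := lintegral_add_left hD3m _
    _ ≤ _ := by
        rw [mul_add]
        refine add_le_add (lintegral_fracDerivLeft_mul_le hσ0 hσ1 hψ hfin
          (by linarith) le_rfl) ?_
        rw [← lintegral_const_mul' _ _ (by finiteness)]
        refine setLIntegral_mono' measurableSet_Ioo fun r hr => ?_
        have hsv : 0 < s - v := sub_pos.2 hvs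
        have hvr : 0 < v - r := sub_pos.2 hr.2
        have hE := ENNReal.ofReal_le_ofReal
          (abs_driverDeriv_sub_le hσ0 hσ1 hψ hfin hθ0 hθ hr.1.le hr.2 hvs hs)
        rw [ENNReal.ofReal_mul (by positivity), ENNReal.ofReal_mul (by positivity),
          ENNReal.ofReal_toReal hfin, ← Real.enorm_eq_ofReal_abs, Real.div_rpow hsv.le hvr.le,
          div_eq_mul_inv _ ((v - r) ^ θ), ← Real.rpow_neg hvr.le] at hE
        calc _ ≤ _ := mul_le_mul' (enorm_fracDerivLeft_le hσ0 hσ1 hr.1 x) hE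
          _ = _ := by
            rw [glsConst]; push_cast
            rw [ENNReal.ofReal, ENNReal.ofReal]
            ring

end driven

end

/-! ### Bounds for the integral of the evolved forcing -/

section

variable {a₁ a₂ ρ₁ ρ₂ σ θ T : ℝ} {w : ℝ → ℝ → ℝ} {K : ℝ≥0}

/-- The integral of the evolved forcing against one driving path. -/
noncomputable def driven (σ a₁ a₂ ρ₁ ρ₂ : ℝ) (w : ℝ → ℝ → ℝ) (ψ : ℝ → ℝ) (t x : ℝ) : ℝ :=
  glsIntegral σ 0 t (fun s => evolved a₁ a₂ ρ₁ ρ₂ w t s x) ψ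

lemma measurable_driven {ψ : ℝ → ℝ} (hw : Measurable (Function.uncurry w)) (hψ : Continuous ψ) :
    Measurable (Function.uncurry (driven σ a₁ a₂ ρ₁ ρ₂ w ψ)) := by
  have hev := measurable_evolved_triple (a₁ := a₁) (a₂ := a₂) (ρ₁ := ρ₁) (ρ₂ := ρ₂) hw
  have h1 : Measurable fun p : (ℝ × ℝ) × ℝ => evolved a₁ a₂ ρ₁ ρ₂ w p.1.1 p.2 p.1.2 :=
    hev.comp (f := fun p : (ℝ × ℝ) × ℝ => (p.1.1, p.2, p.1.2)) (by fun_prop)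
  have h2 : Measurable fun p : ((ℝ × ℝ) × ℝ) × ℝ =>
      (evolved a₁ a₂ ρ₁ ρ₂ w p.1.1.1 p.1.2 p.1.1.2 - evolved a₁ a₂ ρ₁ ρ₂ w p.1.1.1 p.2 p.1.1.2) /
        (p.1.2 - p.2) ^ (1 + σ) :=
    ((h1.comp measurable_fst).sub
      (h1.comp (f := fun p : ((ℝ × ℝ) × ℝ) × ℝ => (p.1.1, p.2)) (by fun_prop))).div (by fun_prop)
  have h3 := measurable_intervalIntegral (X := (ℝ × ℝ) × ℝ) (F := fun p q =>
    (evolved a₁ a₂ ρ₁ ρ₂ w p.1.1 p.2 p.1.2 - evolved a₁ a₂ ρ₁ ρ₂ w p.1.1 q p.1.2) /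
        (p.2 - q) ^ (1 + σ)) h2 (measurable_const (a := (0 : ℝ))) measurable_snd
  have h4 : Measurable fun p : (ℝ × ℝ) × ℝ =>
      fracDerivLeft σ 0 (fun s => evolved a₁ a₂ ρ₁ ρ₂ w p.1.1 s p.1.2) p.2 := by
    unfold fracDerivLeft
    exact ((h1.div (by fun_prop)).add (h3.const_mul _)).const_mul _
  have h5 : Measurable fun p : (ℝ × ℝ) × ℝ => driverDeriv σ ψ p.1.1 p.2 :=
    (measurable_driverDeriv hψ).comp (f := fun p : (ℝ × ℝ) × ℝ => (p.1.1, p.2)) (by fun_prop)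
  exact measurable_intervalIntegral (X := ℝ × ℝ) (F := fun p r =>
    fracDerivLeft σ 0 (fun s => evolved a₁ a₂ ρ₁ ρ₂ w p.1 s p.2) r * driverDeriv σ ψ p.1 r)
    (h4.mul h5) (measurable_const (a := (0 : ℝ))) measurable_fst

lemma l2_lintegral_leftMaj_le {Φ : ℝ → ℝ → ℝ} (hΦ : Measurable (Function.uncurry Φ)) {k : ℝ → ℝ≥0∞}
    (hk : Measurable k) {v s : ℝ} (hkfin : ∀ r ∈ Set.Ioo v s, k r ≠ ⊤) (hv : 0 ≤ v) :
    l2 (fun x => ∫⁻ r in Set.Ioo v s, k r * leftMaj σ Φ r x) ≤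
      ∫⁻ r in Set.Ioo v s, k r * leftMass σ Φ r := by
  have hm : Measurable (Function.uncurry fun x r => k r * leftMaj σ Φ r x) :=
    (hk.comp measurable_snd).mul ((measurable_leftMaj hΦ).comp measurable_swap)
  refine (l2_lintegral_le _ hm).trans (setLIntegral_mono' measurableSet_Ioo fun r hr => ?_)
  rw [l2_const_mul (hkfin r hr)]
  gcongr
  exact l2_leftMaj_le hΦ (by linarith [hr.1])

lemma l2_lintegral_leftMaj_le' {Φ : ℝ → ℝ → ℝ} (hΦ : Measurable (Function.uncurry Φ)) {v s : ℝ}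
    (hv : 0 ≤ v) :
    l2 (fun x => ∫⁻ r in Set.Ioo v s, leftMaj σ Φ r x) ≤ ∫⁻ r in Set.Ioo v s, leftMass σ Φ r := by
  have h := l2_lintegral_leftMaj_le (σ := σ) hΦ (k := fun _ => 1) measurable_const
    (v := v) (s := s) (by simp) hv
  simpa only [one_mul] using h

lemma measurable_lintegral_mul_leftMaj {Φ : ℝ → ℝ → ℝ} (hΦ : Measurable (Function.uncurry Φ))
    {k : ℝ → ℝ≥0∞} (hk : Measurable k) (a b : ℝ) :
    Measurable fun x => ∫⁻ r in Set.Ioo a b, k r * leftMaj σ Φ r x := by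
  have h : Measurable fun p : ℝ × ℝ => k p.2 * leftMaj σ Φ p.2 p.1 :=
    (hk.comp measurable_snd).mul ((measurable_leftMaj hΦ).comp measurable_swap)
  exact h.lintegral_prod_right' (ν := volume.restrict (Set.Ioo a b))

lemma measurable_lintegral_leftMaj {Φ : ℝ → ℝ → ℝ} (hΦ : Measurable (Function.uncurry Φ))
    (a b : ℝ) : Measurable fun x => ∫⁻ r in Set.Ioo a b, leftMaj σ Φ r x := by
  simpa only [one_mul] using
    measurable_lintegral_mul_leftMaj (σ := σ) hΦ (k := fun _ => 1) measurable_const a b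

/-- The estimates for a single driving path: with forcing bounded by `Q`, the integral is bounded
in `L²(ℝ)` and Hölder continuous of order `θ > σ` in time. -/
lemma exists_driven_bounds (ρ₁ ρ₂ : ℝ) (ha₁ : 0 < a₁) (ha₂ : 0 < a₂) (hσ0 : 0 < σ)
    (hσθ : σ < θ) (hθ : θ < 1 / 2) :
    ∃ C : ℝ≥0, ∀ (w : ℝ → ℝ → ℝ) (Q : ℝ≥0∞) (s : ℝ), 0 ≤ s → s ≤ T → ForcingBound σ w s Q →
      (∀ᵐ x, ∫⁻ r in Set.Ioo 0 s, leftMaj σ (evolved a₁ a₂ ρ₁ ρ₂ w s) r x < ⊤) ∧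
      (∫⁻ r in Set.Ioo 0 s, leftMass σ (evolved a₁ a₂ ρ₁ ρ₂ w s) r ≤ C * Q ^ (1 / 2 : ℝ)) ∧
      ∀ ψ : ℝ → ℝ, Continuous ψ → seminormZero σ T ψ ≠ ⊤ →
        normTwo (driven σ a₁ a₂ ρ₁ ρ₂ w ψ s) ≤ C * seminormZero σ T ψ * Q ^ (1 / 2 : ℝ) ∧
        ∀ v ∈ Set.Ioo 0 s, normTwo (fun x => driven σ a₁ a₂ ρ₁ ρ₂ w ψ s x -
            driven σ a₁ a₂ ρ₁ ρ₂ w ψ v x) ≤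
          C * seminormZero σ T ψ * ENNReal.ofReal ((s - v) ^ θ) * Q ^ (1 / 2 : ℝ) := by
  have hθ0 : 0 < θ := by linarith
  have hσ1 : σ < 1 := by linarith
  obtain ⟨K, hK⟩ := exists_opBounds (a₁ := a₁) (a₂ := a₂) ρ₁ ρ₂ ha₁ ha₂ hθ0 (by linarith)
  obtain ⟨c, hc⟩ := exists_lintegral_massBound_le (T := T) hσθ hθ
  set M : ℝ≥0 := K * massConst σ θ T with hM
  set Tθ : ℝ≥0 := (T ^ θ).toNNReal with hTθ
  set g := glsConst σ with hg
  refine ⟨M * c * Tθ + g * (M * c * Tθ) + g * (3 * (M * c)), fun w Q s hs0 hs h => ?_⟩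
  set W := Q ^ (1 / 2 : ℝ) with hW
  have hWtop : W ≠ ⊤ := ENNReal.rpow_ne_top_of_nonneg (by norm_num) h.ne_top
  have hw := h.measurable
  have hfin := h.normTwo_ne_top
  have hev : ∀ s, Measurable (Function.uncurry (evolved a₁ a₂ ρ₁ ρ₂ w s)) := measurable_evolved hw
  set Φ := evolved a₁ a₂ ρ₁ ρ₂ w with hΦ
  have hmass : ∀ r s', s' ≤ s → r ∈ Set.Ioo 0 s' →
      leftMass σ (Φ s') r ≤ M * massBound σ θ w W s' r := by
    intro r s' hs' hr
    have := leftMass_evolved_le hK ha₁ ha₂ hσθ hw hfin hWtop hr.1 hr.2 (hs'.trans hs)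
      (h.mono hs').normTwo_le
    rw [hM]; push_cast
    exact this
  have hint : ∀ s', 0 ≤ s' → s' ≤ s →
      ∫⁻ r in Set.Ioo 0 s', leftMass σ (Φ s') r ≤ M * c * Tθ * W := by
    intro s' h0 hs'
    calc _ ≤ ∫⁻ r in Set.Ioo 0 s', M * massBound σ θ w W s' r :=
          setLIntegral_mono' measurableSet_Ioo fun r hr => hmass r s' hs' hr
      _ ≤ M * (ENNReal.ofReal ((s' - 0) ^ θ) * (c * W)) := by
          rw [lintegral_const_mul' _ _ (by finiteness)]
          gcongr
          exact (lintegral_massBound_Ioo_le hθ0.le W le_rfl).trans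
            (by gcongr; exact hc w Q s' h0 (hs'.trans hs) (h.mono hs'))
      _ ≤ M * (Tθ * (c * W)) := by
          gcongr
          exact ENNReal.ofReal_le_ofReal (Real.rpow_le_rpow (by linarith) (by linarith) hθ0.le)
      _ = _ := by ring
  have hae : ∀ s', 0 ≤ s' → s' ≤ s → ∀ᵐ x, ∫⁻ r in Set.Ioo 0 s', leftMaj σ (Φ s') r x < ⊤ := by
    intro s' h0 hs'
    refine ae_lt_top_of_l2 (measurable_lintegral_leftMaj (hev s') 0 s').aemeasurable
      (ne_top_of_le_ne_top ?_ ((l2_lintegral_leftMaj_le' (hev s') le_rfl).trans (hint s' h0 hs')))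
    finiteness
  refine ⟨hae s hs0 le_rfl, (hint s hs0 le_rfl).trans ?_, fun ψ hψ hψfin => ⟨?_, ?_⟩⟩
  · gcongr
    push_cast
    rw [add_assoc]
    exact le_self_add
  · set Λ := seminormZero σ T ψ
    have h1 := l2_lintegral_leftMaj_le' (σ := σ) (hev s) (v := 0) (s := s) le_rfl
    rw [normTwo_eq_l2]
    calc _ ≤ l2 (fun x => g * Λ * ∫⁻ r in Set.Ioo 0 s, leftMaj σ (Φ s) r x) :=
          l2_mono fun x => enorm_glsIntegral_le hσ0 hσ1 hψ hψfin hs0 hs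
      _ ≤ g * Λ * (M * c * Tθ * W) := by
          rw [l2_const_mul (by finiteness)]
          gcongr
          exact h1.trans (hint s hs0 le_rfl)
      _ = (g * (M * c * Tθ) : ℝ≥0) * Λ * W := by push_cast; ring
      _ ≤ _ := by
          gcongr
          rw [add_right_comm]
          exact le_add_self
  · intro v hv
    set Λ := seminormZero σ T ψ
    have hvs := hv.2
    have hsv : 0 < s - v := sub_pos.2 hvs
    have hdm : Measurable (Function.uncurry fun r x => Φ s r x - Φ v r x) := (hev s).sub (hev v)
    set k : ℝ → ℝ≥0∞ := fun r => ENNReal.ofReal ((s - v) ^ θ * (v - r) ^ (-θ)) with hk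
    have hkm : Measurable k := by fun_prop
    have hJv := hc w Q v hv.1.le (hvs.le.trans hs) (h.mono hvs.le)
    have hJs := hc w Q s hs0 hs h
    have hkJ : ∫⁻ r in Set.Ioo 0 v, k r * (M * massBound σ θ w W v r) ≤
        ENNReal.ofReal ((s - v) ^ θ) * (M * c * W) := by
      calc _ = ∫⁻ r in Set.Ioo 0 v, ENNReal.ofReal ((s - v) ^ θ) * M *
            (ENNReal.ofReal ((v - r) ^ (-θ)) * massBound σ θ w W v r) := by
            refine lintegral_congr fun r => ?_
            rw [hk]
            simp only
            rw [ENNReal.ofReal_mul (by positivity)]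
            ring
        _ ≤ ENNReal.ofReal ((s - v) ^ θ) * M * (c * W) := by
            rw [lintegral_const_mul' _ _ (by finiteness)]
            gcongr
        _ = _ := by ring
    have hA1 : l2 (fun x => ∫⁻ r in Set.Ioo 0 v, leftMaj σ (fun r x => Φ s r x - Φ v r x) r x) ≤
        ENNReal.ofReal ((s - v) ^ θ) * (M * c * W) := by
      have h1 := l2_lintegral_leftMaj_le' (σ := σ) hdm (v := 0) (s := v) le_rfl
      refine h1.trans ((setLIntegral_mono' measurableSet_Ioo fun r hr => ?_).trans hkJ)
      have := leftMass_evolved_sub_le hK ha₁ ha₂ hσθ hw hfin hWtop hr.1 hr.2 hvs hs h.normTwo_le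
      refine this.trans (le_of_eq ?_)
      rw [hM, hk]
      push_cast
      ring
    have hA2 : l2 (fun x => ∫⁻ r in Set.Ioo 0 v, k r * leftMaj σ (Φ s) r x) ≤
        ENNReal.ofReal ((s - v) ^ θ) * (M * c * W) := by
      have h1 := l2_lintegral_leftMaj_le (σ := σ) (hev s) hkm
        (v := 0) (s := v) (by simp [hk]) le_rfl
      refine h1.trans ((setLIntegral_mono' measurableSet_Ioo fun r hr => ?_).trans hkJ)
      gcongr
      refine (hmass r s le_rfl ⟨hr.1, hr.2.trans hvs⟩).trans ?_
      -- the weight `(s-r)^(-θ)` is at most `(v-r)^(-θ)`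
      have hvr : 0 < v - r := sub_pos.2 hr.2
      have hpow : (s - r) ^ (-θ) ≤ (v - r) ^ (-θ) :=
        Real.rpow_le_rpow_of_nonpos hvr (by linarith) (by linarith)
      exact mul_le_mul' le_rfl (add_le_add le_rfl
        (mul_le_mul' (ENNReal.ofReal_le_ofReal hpow) le_rfl))
    have hA3 : l2 (fun x => ∫⁻ r in Set.Ioo v s, leftMaj σ (Φ s) r x) ≤
        ENNReal.ofReal ((s - v) ^ θ) * (M * c * W) := by
      have h1 := l2_lintegral_leftMaj_le' (σ := σ) (hev s) (v := v) (s := s) hv.1.le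
      refine h1.trans ?_
      calc _ ≤ ∫⁻ r in Set.Ioo v s, M * massBound σ θ w W s r :=
            setLIntegral_mono' measurableSet_Ioo fun r hr =>
              hmass r s le_rfl ⟨hv.1.trans hr.1, hr.2⟩
        _ ≤ M * (ENNReal.ofReal ((s - v) ^ θ) * (c * W)) := by
            rw [lintegral_const_mul' _ _ (by finiteness)]
            gcongr
            exact (lintegral_massBound_Ioo_le hθ0.le W hv.1.le).trans (by gcongr)
        _ = _ := by ring
    have hm1 := measurable_lintegral_leftMaj (σ := σ) hdm 0 v
    have hm2 := measurable_lintegral_mul_leftMaj (σ := σ) (hev s) hkm 0 v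
    have hm3 := measurable_lintegral_leftMaj (σ := σ) (hev s) v s
    rw [normTwo_eq_l2]
    calc _ ≤ l2 (fun x => g * Λ *
            ((∫⁻ r in Set.Ioo 0 v, leftMaj σ (fun r x => Φ s r x - Φ v r x) r x) +
            (∫⁻ r in Set.Ioo 0 v, k r * leftMaj σ (Φ s) r x) +
            ∫⁻ r in Set.Ioo v s, leftMaj σ (Φ s) r x)) := by
          refine l2_mono_ae ?_
          filter_upwards [hae s hs0 le_rfl, hae v hv.1.le hvs.le] with x h1 h2
          exact enorm_glsIntegral_sub_le hσ0 hσ1 hψ hψfin hθ0.le (by linarith) hv.1 hvs hs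
            (hev s) (hev v) h1 h2
      _ ≤ g * Λ * (ENNReal.ofReal ((s - v) ^ θ) * (M * c * W) +
            ENNReal.ofReal ((s - v) ^ θ) * (M * c * W) +
            ENNReal.ofReal ((s - v) ^ θ) * (M * c * W)) := by
          rw [l2_const_mul (by finiteness)]
          gcongr
          exact (l2_add_le (hm1.add hm2).aemeasurable hm3.aemeasurable).trans
            (add_le_add ((l2_add_le hm1.aemeasurable hm2.aemeasurable).trans
              (add_le_add hA1 hA2)) hA3)
      _ = (g * (3 * (M * c)) : ℝ≥0) * Λ * ENNReal.ofReal ((s - v) ^ θ) * W := by push_cast; ring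
      _ ≤ _ := by
          gcongr
          exact le_add_self

/-- The mass of the evolved forcing over all of `(0, T)`. After the time `t` the evolved forcing
vanishes, and only its increments from times before `t` contribute. -/
lemma exists_lintegral_leftMass_le (ρ₁ ρ₂ : ℝ) (ha₁ : 0 < a₁) (ha₂ : 0 < a₂) (hσ0 : 0 < σ)
    (hσθ : σ < θ) (hθ : θ < 1 / 2) :
    ∃ C : ℝ≥0, ∀ (w : ℝ → ℝ → ℝ) (Q : ℝ≥0∞) (t : ℝ), 0 ≤ t → t ≤ T → ForcingBound σ w T Q →
      ∫⁻ r in Set.Ioo 0 T, leftMass σ (evolved a₁ a₂ ρ₁ ρ₂ w t) r ≤ C * Q ^ (1 / 2 : ℝ) := by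
  have hθ0 : 0 < θ := by linarith
  obtain ⟨K, hK⟩ := exists_opBounds (a₁ := a₁) (a₂ := a₂) ρ₁ ρ₂ ha₁ ha₂ hθ0 (by linarith)
  obtain ⟨C, hC⟩ := exists_driven_bounds (a₁ := a₁) (a₂ := a₂) (T := T) ρ₁ ρ₂ ha₁ ha₂ hσ0 hσθ hθ
  set b : ℝ≥0 := (T ^ (θ - σ) / (θ - σ)).toNNReal with hb
  set b' : ℝ≥0 := (T ^ (1 - θ) / (1 - θ)).toNNReal with hb'
  refine ⟨C + K * b * b', fun w Q t ht0 ht h => ?_⟩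
  have hδ : 0 < θ - σ := by linarith
  have h1θ : 0 < 1 - θ := by linarith
  set W := Q ^ (1 / 2 : ℝ) with hW
  have hWtop : W ≠ ⊤ := ENNReal.rpow_ne_top_of_nonneg (by norm_num) h.ne_top
  have hm : ∀ r, Measurable (w r) := fun r => h.measurable.comp measurable_prodMk_left
  set Φ := evolved a₁ a₂ ρ₁ ρ₂ w t with hΦ
  have hzero : ∀ r, t ≤ r → Φ r = 0 := fun r hr => by
    funext x
    exact opG_of_nonpos (by linarith) _ _
  have hlate : ∀ r ∈ Set.Ioo t T, leftMass σ Φ r ≤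
      K * b * W * ENNReal.ofReal ((r - t) ^ (-θ)) := by
    intro r hr
    have hrt : 0 < r - t := sub_pos.2 hr.1
    have e0 : normTwo (Φ r) = 0 := by rw [hzero r hr.1.le]; simp [normTwo]
    rw [leftMass, e0, ENNReal.zero_div, zero_add, incrMass]
    calc _ ≤ ∫⁻ q in Set.Ioo 0 t ∪ Set.Ico t r, normTwo (fun x => Φ r x - Φ q x) /
            ENNReal.ofReal ((r - q) ^ (σ + 1)) := by
          refine lintegral_mono_set fun q hq => ?_
          rcases lt_or_ge q t with hqt | hqt
          · exact Or.inl ⟨hq.1, hqt⟩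
          · exact Or.inr ⟨hqt, hq.2⟩
      _ ≤ (∫⁻ q in Set.Ioo 0 t, normTwo (fun x => Φ r x - Φ q x) /
            ENNReal.ofReal ((r - q) ^ (σ + 1))) +
          ∫⁻ q in Set.Ico t r, normTwo (fun x => Φ r x - Φ q x) /
            ENNReal.ofReal ((r - q) ^ (σ + 1)) := lintegral_union_le _ _ _
      _ ≤ (∫⁻ q in Set.Ioo 0 t, K * W * ENNReal.ofReal ((r - t) ^ (-θ)) *
            ENNReal.ofReal ((t - q) ^ (θ - σ - 1))) + ∫⁻ q in Set.Ico t r, 0 := by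
          refine add_le_add (setLIntegral_mono' measurableSet_Ioo fun q hq => ?_)
            (setLIntegral_mono' measurableSet_Ico fun q hq => ?_)
          · have htq : 0 < t - q := sub_pos.2 hq.2
            have hrq : 0 < r - q := by linarith
            have e1 : normTwo (fun x => Φ r x - Φ q x) = normTwo (Φ q) := by
              rw [hzero r hr.1.le]
              simp only [Pi.zero_apply, zero_sub]
              exact eLpNorm_neg (Φ q) 2 volume
            have e2 : (ENNReal.ofReal ((r - q) ^ (σ + 1)))⁻¹ ≤
                ENNReal.ofReal ((r - t) ^ (-θ)) * ENNReal.ofReal ((t - q) ^ (θ - σ - 1)) := by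
              rw [← ENNReal.ofReal_inv_of_pos (by positivity), ← Real.rpow_neg hrq.le,
                ← ENNReal.ofReal_mul (by positivity)]
              apply ENNReal.ofReal_le_ofReal
              calc (r - q) ^ (-(σ + 1)) = (r - q) ^ (-θ) * (r - q) ^ (θ - σ - 1) := by
                    rw [← Real.rpow_add hrq]; congr 1; ring
                _ ≤ _ := by
                    gcongr ?_ * ?_
                    · exact Real.rpow_le_rpow_of_nonpos hrt (by linarith [hq.2]) (by linarith)
                    · exact Real.rpow_le_rpow_of_nonpos htq (by linarith [hr.1]) (by linarith)
            rw [e1, div_eq_mul_inv, mul_assoc]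
            refine mul_le_mul' ((hK.bound _ _ (hm q) (h.normTwo_ne_top q)).trans ?_) e2
            gcongr
            exact h.normTwo_le q ⟨hq.1.le, by linarith [hq.2]⟩
          · rw [hzero r hr.1.le, hzero q hq.1]
            simp [normTwo]
      _ ≤ K * W * ENNReal.ofReal ((r - t) ^ (-θ)) * b := by
          rw [lintegral_const_mul' _ _ (by finiteness), lintegral_rpow_Ioo' ht0 (by linarith),
            lintegral_zero, add_zero, sub_zero, sub_add_cancel]
          gcongr
          rw [hb, ENNReal.ofReal]
          gcongr
      _ = _ := by ring
  calc _ ≤ ∫⁻ r in Set.Ioo 0 t ∪ Set.Ico t T, leftMass σ Φ r := by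
        refine lintegral_mono_set fun q hq => ?_
        rcases lt_or_ge q t with hqt | hqt
        · exact Or.inl ⟨hq.1, hqt⟩
        · exact Or.inr ⟨hqt, hq.2⟩
    _ ≤ (∫⁻ r in Set.Ioo 0 t, leftMass σ Φ r) + ∫⁻ r in Set.Ico t T, leftMass σ Φ r :=
        lintegral_union_le _ _ _
    _ ≤ C * W + K * b * W * b' := by
        refine add_le_add (hC w Q t ht0 ht (h.mono ht)).2.1 ?_
        rw [← setLIntegral_congr (Ioo_ae_eq_Ico (a := t) (b := T))]
        refine (setLIntegral_mono' measurableSet_Ioo hlate).trans ?_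
        rw [lintegral_const_mul' _ _ (by finiteness), lintegral_rpow_Ioo ht (by linarith)]
        gcongr
        rw [hb', ENNReal.ofReal, show -θ + 1 = 1 - θ by ring]
        have : 0 ≤ T - t := by linarith
        gcongr
        linarith
    _ = _ := by push_cast; ring

end

/-! ### Series in `L²(ℝ)` -/

/-- The sum of a series is measurable also where it diverges: there it is zero, and the set of
convergence is measurable. -/
lemma measurable_tsum_real {X : Type*} [MeasurableSpace X] {m : ℕ → X → ℝ}
    (hm : ∀ j, Measurable (m j)) : Measurable fun x => ∑' j, m j x := by
  have hsum : ∀ x, (∑' j, ‖m j x‖ₑ ≠ ⊤) ↔ Summable fun j => m j x := fun x => by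
    rw [tsum_enorm_ne_top_iff_summable_norm, summable_norm_iff]
  have hS : MeasurableSet {x | ∑' j, ‖m j x‖ₑ ≠ ⊤} :=
    (measurableSet_singleton _).compl.preimage (Measurable.tsum fun j => (hm j).enorm)
  refine measurable_of_tendsto_metrizable
    (f := fun n => {x | ∑' j, ‖m j x‖ₑ ≠ ⊤}.indicator fun x => ∑ j ∈ Finset.range n, m j x)
    (fun n => (Finset.measurable_fun_sum _ fun j _ => hm j).indicator hS) ?_
  rw [tendsto_pi_nhds]
  intro x
  by_cases hx : ∑' j, ‖m j x‖ₑ ≠ ⊤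
  · exact ((hsum x).1 hx).hasSum.tendsto_sum_nat.congr fun n =>
      (Set.indicator_of_mem (s := {x | ∑' j, ‖m j x‖ₑ ≠ ⊤}) hx _).symm
  · rw [tsum_eq_zero_of_not_summable fun h => hx ((hsum x).2 h)]
    exact tendsto_const_nhds.congr fun n =>
      (Set.indicator_of_notMem (s := {x | ∑' j, ‖m j x‖ₑ ≠ ⊤}) hx _).symm

section

variable {m : ℕ → ℝ → ℝ}

lemma normTwo_tsum_le (hm : ∀ j, Measurable (m j)) :
    normTwo (fun x => ∑' j, m j x) ≤ ∑' j, normTwo (m j) := by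
  simp_rw [normTwo_eq_l2]
  exact (l2_mono fun x => enorm_tsum_le_tsum_enorm).trans (l2_tsum_le fun j => (hm j).enorm)

lemma ae_summable_of_normTwo (hm : ∀ j, Measurable (m j)) (h : ∑' j, normTwo (m j) ≠ ⊤) :
    ∀ᵐ x, Summable fun j => m j x := by
  have hM : Measurable fun x => ∑' j, ‖m j x‖ₑ := Measurable.tsum fun j => (hm j).enorm
  have h2 : l2 (fun x => ∑' j, ‖m j x‖ₑ) ≠ ⊤ := by
    refine ne_top_of_le_ne_top h ((l2_tsum_le fun j => (hm j).enorm).trans (le_of_eq ?_))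
    simp_rw [normTwo_eq_l2]
  exact (ae_lt_top_of_l2 hM.aemeasurable h2).mono fun x hx => Summable.of_enorm hx.ne

lemma tendsto_normTwo_tsum_sub (hm : ∀ j, Measurable (m j)) (h : ∑' j, normTwo (m j) ≠ ⊤) :
    Tendsto (fun n : ℕ => normTwo fun x => ∑' j, m j x - ∑ j ∈ Finset.range n, m j x)
      atTop (𝓝 0) := by
  refine tendsto_of_tendsto_of_tendsto_of_le_of_le tendsto_const_nhds
    (ENNReal.tendsto_sum_nat_add (fun j => normTwo (m j)) h) (fun n => zero_le) fun n => ?_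
  refine le_trans (le_of_eq (eLpNorm_congr_ae ?_)) (normTwo_tsum_le fun j => hm (j + n))
  filter_upwards [ae_summable_of_normTwo hm h] with x hx
  rw [← hx.sum_add_tsum_nat_add n, add_sub_cancel_left]

lemma normTwo_const_mul (c : ℝ) (g : ℝ → ℝ) :
    normTwo (fun x => c * g x) = ENNReal.ofReal |c| * normTwo g := by
  simp_rw [normTwo_eq_l2, enorm_mul]
  rw [l2_const_mul (by finiteness), Real.enorm_eq_ofReal_abs]

end

/-! ### Borel versions -/

/-- An element of the Besov-type space has a Borel version which vanishes at the exceptional times,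
so that it inherits all bounds valid at every time. -/
lemma MemBesov.exists_borel {σ T : ℝ} {u : ℝ → ℝ → ℝ} (hu : MemBesov σ T u) :
    ∃ u' : ℝ → ℝ → ℝ, Measurable (Function.uncurry u') ∧
      (∀ᵐ s ∂(volume : Measure ℝ).restrict (Set.Icc 0 T), u s =ᵐ[volume] u' s) ∧
      ∀ s, u' s = 0 ∨ (s ∈ Set.Icc 0 T ∧ u s =ᵐ[volume] u' s) := by
  set μ := (volume : Measure ℝ).restrict (Set.Icc 0 T) with hμ
  set u₀ := hu.measurable.mk with hu₀
  have h1 : ∀ᵐ s ∂μ, ∀ᵐ x, u s x = u₀ (s, x) :=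
    Measure.ae_ae_of_ae_prod hu.measurable.ae_eq_mk
  set N := toMeasurable μ {s | ¬ ∀ᵐ x, u s x = u₀ (s, x)} with hN
  have hN0 : μ N = 0 := by rw [hN, measure_toMeasurable]; exact h1
  set S := Set.Icc 0 T \ N with hS
  have hSm : MeasurableSet S := measurableSet_Icc.diff (measurableSet_toMeasurable _ _)
  have hgood : ∀ s ∈ S, ∀ᵐ x, u s x = u₀ (s, x) := fun s hs => by
    by_contra hc
    exact hs.2 (subset_toMeasurable _ _ hc)
  have hmem : ∀ s ∈ S, u s =ᵐ[volume] fun x => S.indicator (fun s => u₀ (s, x)) s := fun s hs => by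
    filter_upwards [hgood s hs] with x hx
    rw [Set.indicator_of_mem hs, hx]
  refine ⟨fun s x => S.indicator (fun s => u₀ (s, x)) s, ?_, ?_, fun s => ?_⟩
  · have : (Function.uncurry fun s x => S.indicator (fun s => u₀ (s, x)) s) =
        (S ×ˢ (Set.univ : Set ℝ)).indicator u₀ := by
      funext ⟨s, x⟩
      by_cases hs : s ∈ S <;> simp [Function.uncurry, Set.indicator, hs]
    rw [this]
    exact hu.measurable.measurable_mk.indicator (hSm.prod MeasurableSet.univ)
  · filter_upwards [ae_restrict_mem measurableSet_Icc, measure_eq_zero_iff_ae_notMem.1 hN0]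
      with s hs hsN
    exact hmem s ⟨hs, hsN⟩
  · by_cases hs : s ∈ S
    · exact Or.inr ⟨hs.1, hmem s hs⟩
    · left
      funext x
      simp [hs]

lemma ae_restrict_Ioo_of_Icc {p : ℝ → Prop} {T t : ℝ} (ht : t ≤ T)
    (h : ∀ᵐ s ∂(volume : Measure ℝ).restrict (Set.Icc 0 T), p s) :
    ∀ᵐ s ∂(volume : Measure ℝ).restrict (Set.Ioo 0 t), p s :=
  ae_restrict_of_ae_restrict_of_subset 
    (fun s (hs : s ∈ Set.Ioo 0 t) => (⟨hs.1.le, hs.2.le.trans ht⟩ : s ∈ Set.Icc 0 T)) h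

lemma incrMass_congr {σ r : ℝ} {Φ Ψ : ℝ → ℝ → ℝ} (hr : Φ r =ᵐ[volume] Ψ r)
    (h : ∀ᵐ q ∂(volume : Measure ℝ).restrict (Set.Ioo 0 r), Φ q =ᵐ[volume] Ψ q) :
    incrMass σ Φ r = incrMass σ Ψ r := by
  unfold incrMass
  refine lintegral_congr_ae (h.mono fun q hq => ?_)
  simp only
  congr 1
  exact eLpNorm_congr_ae (hr.sub hq)

lemma leftMass_congr {σ r : ℝ} {Φ Ψ : ℝ → ℝ → ℝ} (hr : Φ r =ᵐ[volume] Ψ r)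
    (h : ∀ᵐ q ∂(volume : Measure ℝ).restrict (Set.Ioo 0 r), Φ q =ᵐ[volume] Ψ q) :
    leftMass σ Φ r = leftMass σ Ψ r := by
  rw [leftMass, leftMass, incrMass_congr hr h]
  congr 2
  exact eLpNorm_congr_ae hr

/-! ### Dependence of the integral on the integrand -/

lemma fracDerivLeft_congr {σ r : ℝ} {φ φ' : ℝ → ℝ} (hr0 : 0 ≤ r) (hr : φ r = φ' r)
    (h : ∀ᵐ q ∂(volume : Measure ℝ).restrict (Set.Ioo 0 r), φ q = φ' q) :
    fracDerivLeft σ 0 φ r = fracDerivLeft σ 0 φ' r := by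
  unfold fracDerivLeft
  rw [hr, intervalIntegral.integral_of_le hr0, intervalIntegral.integral_of_le hr0,
    integral_Ioc_eq_integral_Ioo, integral_Ioc_eq_integral_Ioo]
  congr 3
  exact integral_congr_ae (h.mono fun q hq => by simp only [hq])

lemma ae_fracDerivLeft_congr {σ t : ℝ} {φ φ' : ℝ → ℝ}
    (h : ∀ᵐ q ∂(volume : Measure ℝ).restrict (Set.Ioo 0 t), φ q = φ' q) :
    fracDerivLeft σ 0 φ =ᵐ[(volume : Measure ℝ).restrict (Set.Ioo 0 t)]
      fracDerivLeft σ 0 φ' := by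
  filter_upwards [h, ae_restrict_mem measurableSet_Ioo] with r hr hr0
  exact fracDerivLeft_congr hr0.1.le hr
    (ae_restrict_of_ae_restrict_of_subset (Set.Ioo_subset_Ioo_right hr0.2.le) h)

lemma glsIntegral_congr {σ t : ℝ} {φ φ' ψ : ℝ → ℝ} (ht : 0 ≤ t)
    (h : ∀ᵐ q ∂(volume : Measure ℝ).restrict (Set.Ioo 0 t), φ q = φ' q) :
    glsIntegral σ 0 t φ ψ = glsIntegral σ 0 t φ' ψ := by
  rw [glsIntegral_eq _ ht, glsIntegral_eq _ ht]
  exact integral_congr_ae 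
    ((ae_fracDerivLeft_congr (σ := σ) h).mono fun r hr => by simp only [hr])

/-- The integral is well defined as soon as the majorant of the left-sided derivative is
integrable. -/
lemma glsIntegrable_of_leftMaj {σ t T x : ℝ} {φ ψ : ℝ → ℝ} {Φ : ℝ → ℝ → ℝ} (hσ0 : 0 < σ)
    (hσ1 : σ < 1) (ht : t ≤ T) (hψ : Continuous ψ) (hψfin : seminormZero σ T ψ ≠ ⊤)
    (hΦ : Measurable (Function.uncurry Φ)) (hfin : ∫⁻ r in Set.Ioo 0 t, leftMaj σ Φ r x < ⊤)
    (h : ∀ᵐ q ∂(volume : Measure ℝ).restrict (Set.Ioo 0 t), φ q = Φ q x) :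
    GLSIntegrable σ 0 t φ ψ where
  left_converges := by
    filter_upwards [ae_intervalIntegrable_of_leftMaj hΦ hfin, h,
      ae_restrict_mem measurableSet_Ioo] with r hr he hr0
    rw [intervalIntegrable_iff_integrableOn_Ioo_of_le hr0.1.le] at hr ⊢
    refine (integrable_congr ?_).1 hr
    filter_upwards [ae_restrict_of_ae_restrict_of_subset (Set.Ioo_subset_Ioo_right hr0.2.le) h]
      with q hq
    rw [he, hq]
  left_memL1 := by
    rw [memLp_one_iff_integrable]
    exact (integrable_congr (ae_fracDerivLeft_congr h)).2
      (integrableOn_fracDerivLeft hσ0 hσ1 hΦ hfin)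
  right_converges := by
    refine ae_restrict_of_forall_mem measurableSet_Ioo fun r hr => ?_
    simp only [leftCentered_eq hψ, sub_sub_sub_cancel_left, show 1 + (1 - σ) = 2 - σ by ring]
    exact (integrable_driver hψ hψfin hr.1.le hr.2 ht).1
  right_memLinfty := by
    refine memLp_top_of_bound (C := 2 / Real.Gamma σ * (seminormZero σ T ψ).toReal) ?_ ?_
    · exact ((measurable_driverDeriv hψ).comp
        (measurable_const.prodMk measurable_id)).aestronglyMeasurable
    · exact ae_restrict_of_forall_mem measurableSet_Ioo fun r hr =>
        abs_driverDeriv_le hσ0 hσ1 hψ hψfin hr.1.le hr.2 ht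

/-! ### The forcing of the equation -/

/-- Multiplication by a function `e` with `‖e‖₂ = 1` and `‖e‖_∞ ≤ M` turns `h(u)` into a forcing
whose norms are controlled by those of `u`. -/
lemma forcingBound_of_memBesov {σ T t h₁ h₂ M : ℝ} {e : ℝ → ℝ} (he : Measurable e)
    (he2 : normTwo e = 1) (heM : ∀ᵐ y, |e y| ≤ M) {u u' : ℝ → ℝ → ℝ} (hu : MemBesov σ T u)
    (hu' : Measurable (Function.uncurry u'))
    (hae : ∀ᵐ s ∂(volume : Measure ℝ).restrict (Set.Icc 0 T), u s =ᵐ[volume] u' s)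
    (hcase : ∀ s, u' s = 0 ∨ (s ∈ Set.Icc 0 T ∧ u s =ᵐ[volume] u' s)) (ht : t ≤ T) :
    ForcingBound σ (fun s y => (h₁ * u' s y + h₂) * e y) t
      (9 * (((|h₁| * M).toNNReal) ^ 2 + (|h₂|.toNNReal) ^ 2) * (sqNormTwo σ t u + 1)) := by
  set w : ℝ → ℝ → ℝ := fun s y => (h₁ * u' s y + h₂) * e y with hw
  set κ : ℝ≥0 := (|h₁| * M).toNNReal with hκ
  set η : ℝ≥0 := |h₂|.toNNReal with hη
  have hm' : ∀ s, Measurable (u' s) := fun s => hu'.comp measurable_prodMk_left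
  -- multiplication by `h₁ e` has norm at most `κ` on `L²`
  have hmul : ∀ g : ℝ → ℝ, normTwo (fun y => h₁ * g y * e y) ≤ κ * normTwo g := by
    intro g
    rw [normTwo_eq_l2, normTwo_eq_l2, ← l2_const_mul (by finiteness)]
    refine l2_mono_ae (heM.mono fun y hy => ?_)
    rw [mul_right_comm, enorm_mul, Real.enorm_eq_ofReal_abs, hκ, abs_mul]
    gcongr
    exact ENNReal.ofReal_le_ofReal (by gcongr)
  have hnorm : ∀ s, normTwo (w s) ≤ κ * normTwo (u' s) + η := by
    intro s
    have e1 : w s = fun y => h₁ * u' s y * e y + h₂ * e y := by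
      funext y; simp only [hw]; ring
    rw [e1]
    refine (normTwo_add_le (((hm' s).const_mul _).mul he).aestronglyMeasurable
      (he.const_mul _).aestronglyMeasurable).trans (add_le_add (hmul _) (le_of_eq ?_))
    rw [normTwo_const_mul, he2, mul_one]
    rfl
  have hincr : ∀ s q, normTwo (fun y => w s y - w q y) ≤
      κ * normTwo (fun y => u' s y - u' q y) := by
    intro s q
    refine le_trans (le_of_eq ?_) (hmul _)
    congr 1
    funext y
    simp only [hw]
    ring
  have hle : ∀ t s, s ∈ Set.Icc 0 t → normTwo (u' s) ^ 2 ≤ sqNormTwo σ t u := by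
    intro t s hs
    rcases hcase s with h0 | ⟨-, h⟩
    · rw [h0]; simp [normTwo]
    · rw [normTwo, ← eLpNorm_congr_ae h]
      refine le_trans ?_ le_self_add
      exact le_iSup₂ (f := fun s (_ : s ∈ Set.Icc 0 t) => normTwo (u s) ^ 2) s hs
  have hSle : sqNormTwo σ t u ≤ sqNormTwo σ T u := by
    refine add_le_add ?_ (sqNormOne_mono ht)
    exact biSup_mono fun s hs => ⟨hs.1, hs.2.trans ht⟩
  have hStop : sqNormTwo σ t u ≠ ⊤ := (hSle.trans_lt hu.finite).ne
  refine ⟨((hu'.const_mul _).add_const _).mul (he.comp measurable_snd), fun r => ?_, fun q hq => ?_,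
    ?_, by finiteness⟩
  · refine ne_top_of_le_ne_top ?_ (hnorm r)
    have : normTwo (u' r) ≠ ⊤ := by
      rcases hcase r with h0 | ⟨hr, -⟩
      · rw [h0]; simp [normTwo]
      · intro hc
        have := (hle T r hr).trans_lt hu.finite
        rw [hc] at this
        simp at this
    finiteness
  · calc normTwo (w q) ^ 2 ≤ (κ * normTwo (u' q) + η + 0) ^ 2 := by
          rw [add_zero]; gcongr; exact hnorm q
      _ ≤ 9 * (κ ^ 2 * normTwo (u' q) ^ 2 + η ^ 2 * 1) := by
          refine (add_add_sq_le _ _ _).trans (le_of_eq ?_)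
          rw [mul_pow]; ring
      _ ≤ 9 * (κ ^ 2 * (sqNormTwo σ t u + 1) + η ^ 2 * (sqNormTwo σ t u + 1)) := by
          gcongr
          · exact (hle t q hq).trans le_self_add
          · exact le_add_self
      _ = _ := by ring
  · have h1 : ∀ᵐ r ∂(volume : Measure ℝ).restrict (Set.Ioo 0 t),
        incrMass σ u r = incrMass σ u' r := by
      filter_upwards [ae_restrict_Ioo_of_Icc ht hae, ae_restrict_mem measurableSet_Ioo]
        with r hr hr0
      exact incrMass_congr hr (ae_restrict_Ioo_of_Icc (hr0.2.le.trans ht) hae)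
    have h2 : ∀ r, incrMass σ w r ≤ κ * incrMass σ u' r := by
      intro r
      unfold incrMass
      rw [← lintegral_const_mul' _ _ (by finiteness)]
      refine lintegral_mono fun q => ?_
      rw [← mul_div_assoc]
      gcongr
      exact hincr r q
    calc sqNormOne σ t w ≤ ∫⁻ r in Set.Ioo 0 t, κ ^ 2 * incrMass σ u r ^ 2 := by
          rw [sqNormOne_eq]
          refine lintegral_mono_ae (h1.mono fun r hr => ?_)
          rw [← mul_pow, hr]
          gcongr
          exact h2 r
      _ = 1 * (κ ^ 2 + 0) * (sqNormOne σ t u + 0) := by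
          rw [lintegral_const_mul' _ _ (by finiteness), sqNormOne_eq]
          simp
      _ ≤ _ := by
          gcongr
          · norm_num
          · exact zero_le
          · exact le_add_self
          · exact zero_le

/-! ### The sum of the series as an element of the Besov-type space -/

lemma sqNormTwo_congr {σ t : ℝ} {u u' : ℝ → ℝ → ℝ} (h : ∀ s ∈ Set.Icc 0 t, u s = u' s) :
    sqNormTwo σ t u = sqNormTwo σ t u' := by
  unfold sqNormTwo
  congr 1
  · exact biSup_congr fun s hs => by rw [h s hs]
  · refine setLIntegral_congr_fun measurableSet_Ioo fun s hs => ?_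
    congr 1
    refine setLIntegral_congr_fun measurableSet_Ioo fun v hv => ?_
    rw [h s ⟨hs.1.le, hs.2.le⟩, h v ⟨hv.1.le, (hv.2.trans hs.2).le⟩]

/-- A series whose terms are bounded by `c j` in `L²(ℝ)`, and Hölder continuous in time of an order
`θ > σ` with the same constants, has a sum whose norm is controlled by `∑ j, c j`. -/
lemma sqNormTwo_tsum_le {σ θ t T : ℝ} {m : ℕ → ℝ → ℝ → ℝ} {c : ℕ → ℝ≥0∞} (hσθ : σ < θ)
    (ht : t ≤ T) (hm : ∀ j s, Measurable (m j s)) (hc : ∑' j, c j ≠ ⊤)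
    (hbound : ∀ j, ∀ s ∈ Set.Icc 0 t, normTwo (m j s) ≤ c j)
    (hincr : ∀ j, ∀ s ∈ Set.Icc 0 t, ∀ v ∈ Set.Ioo 0 s,
      normTwo (fun x => m j s x - m j v x) ≤ ENNReal.ofReal ((s - v) ^ θ) * c j) :
    sqNormTwo σ t (fun s x => ∑' j, m j s x) ≤
      (1 + ENNReal.ofReal (T ^ (θ - σ) / (θ - σ)) ^ 2 * ENNReal.ofReal T) * (∑' j, c j) ^ 2 := by
  have hδ : 0 < θ - σ := sub_pos.2 hσθ
  have hsum : ∀ s ∈ Set.Icc 0 t, ∑' j, normTwo (m j s) ≤ ∑' j, c j :=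
    fun s hs => ENNReal.tsum_le_tsum fun j => hbound j s hs
  have hae : ∀ s ∈ Set.Icc 0 t, ∀ᵐ x, Summable fun j => m j s x := fun s hs =>
    ae_summable_of_normTwo (fun j => hm j s) (ne_top_of_le_ne_top hc (hsum s hs))
  have hdiff : ∀ s ∈ Set.Icc 0 t, ∀ v ∈ Set.Ioo 0 s,
      normTwo (fun x => ∑' j, m j s x - ∑' j, m j v x) ≤
        ENNReal.ofReal ((s - v) ^ θ) * ∑' j, c j := by
    intro s hs v hv
    have hv' : v ∈ Set.Icc 0 t := ⟨hv.1.le, hv.2.le.trans hs.2⟩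
    calc _ = normTwo (fun x => ∑' j, (m j s x - m j v x)) := by
          refine eLpNorm_congr_ae ?_
          filter_upwards [hae s hs, hae v hv'] with x h1 h2
          rw [h1.tsum_sub h2]
      _ ≤ ∑' j, normTwo (fun x => m j s x - m j v x) :=
          normTwo_tsum_le fun j => (hm j s).sub (hm j v)
      _ ≤ ∑' j, ENNReal.ofReal ((s - v) ^ θ) * c j :=
          ENNReal.tsum_le_tsum fun j => hincr j s hs v hv
      _ = _ := ENNReal.tsum_mul_left
  rw [add_mul, one_mul]
  refine add_le_add (iSup₂_le fun s hs => ?_) ?_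
  · gcongr
    exact (normTwo_tsum_le fun j => hm j s).trans (hsum s hs)
  · have hinner : ∀ s ∈ Set.Ioo 0 t, ∫⁻ v in Set.Ioo 0 s,
        normTwo (fun x => ∑' j, m j s x - ∑' j, m j v x) /
          ENNReal.ofReal ((s - v) ^ (σ + 1)) ≤
        ENNReal.ofReal (T ^ (θ - σ) / (θ - σ)) * ∑' j, c j := by
      intro s hs
      calc _ ≤ ∫⁻ v in Set.Ioo 0 s, ENNReal.ofReal ((s - v) ^ (θ - σ - 1)) * ∑' j, c j := by
            refine setLIntegral_mono' measurableSet_Ioo fun v hv => ?_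
            have hsv : 0 < s - v := sub_pos.2 hv.2
            calc _ ≤ ENNReal.ofReal ((s - v) ^ θ) * (∑' j, c j) /
                  ENNReal.ofReal ((s - v) ^ (σ + 1)) := by
                  gcongr
                  exact hdiff s ⟨hs.1.le, hs.2.le⟩ v hv
              _ = _ := by
                  rw [ENNReal.mul_div_right_comm, ← ENNReal.ofReal_div_of_pos (by positivity),
                    ← Real.rpow_sub hsv]
                  congr 3
                  ring
        _ = ENNReal.ofReal (s ^ (θ - σ) / (θ - σ)) * ∑' j, c j := by
            rw [lintegral_mul_const' _ _ hc, lintegral_rpow_Ioo' hs.1.le (by linarith), sub_zero,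
              sub_add_cancel]
        _ ≤ _ := by
            have := hs.1.le
            have := hs.2.le.trans ht
            gcongr
    calc _ ≤ ∫⁻ _ in Set.Ioo 0 t, (ENNReal.ofReal (T ^ (θ - σ) / (θ - σ)) * ∑' j, c j) ^ 2 :=
          setLIntegral_mono' measurableSet_Ioo fun s hs => by gcongr; exact hinner s hs
      _ = (ENNReal.ofReal (T ^ (θ - σ) / (θ - σ)) * ∑' j, c j) ^ 2 * ENNReal.ofReal t := by
          rw [setLIntegral_const, Real.volume_Ioo, sub_zero]
      _ ≤ (ENNReal.ofReal (T ^ (θ - σ) / (θ - σ)) * ∑' j, c j) ^ 2 * ENNReal.ofReal T := by gcongr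
      _ = _ := by ring

/-! ### The mild operator along fixed driving paths -/

section mild

variable {σ T a₁ a₂ ρ₁ ρ₂ h₁ h₂ : ℝ} {u u' : ℝ → ℝ → ℝ}

lemma varsigma_eq_evolved (e : ℝ → ℝ) {s : ℝ} (h : u s =ᵐ[volume] u' s) (t : ℝ) :
    varsigma a₁ a₂ ρ₁ ρ₂ h₁ h₂ e u t s =
      evolved a₁ a₂ ρ₁ ρ₂ (fun s y => (h₁ * u' s y + h₂) * e y) t s := by
  funext x
  refine integral_congr_ae (h.mono fun y hy => ?_)
  simp only [hy, mul_assoc]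

lemma mildTerm_eq_driven (e ψ : ℝ → ℝ)
    (hae : ∀ᵐ s ∂(volume : Measure ℝ).restrict (Set.Icc 0 T), u s =ᵐ[volume] u' s) {t : ℝ}
    (ht : t ∈ Set.Icc 0 T) :
    mildTerm σ a₁ a₂ ρ₁ ρ₂ h₁ h₂ e ψ u t =
      driven σ a₁ a₂ ρ₁ ρ₂ (fun s y => (h₁ * u' s y + h₂) * e y) ψ t := by
  funext x
  refine glsIntegral_congr ht.1 ((ae_restrict_Ioo_of_Icc ht.2 hae).mono fun s hs => ?_)
  rw [varsigma_eq_evolved e hs]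


/-- The statement for fixed continuous driving paths with `ξ < ∞`. -/
theorem exists_mildOp_bounds (ρ₁ ρ₂ h₁ h₂ M : ℝ) (hT : 0 < T) (ha₁ : 0 < a₁) (ha₂ : 0 < a₂)
    (hσ0 : 0 < σ) (hσ : σ < 1 / 2) {lam : ℕ → ℝ} (hlam : ∀ j, 0 < lam j) {e : ℕ → ℝ → ℝ}
    (he : ∀ j, Measurable (e j)) (he2 : ∀ j, normTwo (e j) = 1)
    (heM : ∀ j, ∀ᵐ y, |e j y| ≤ M) :
    ∃ C : ℝ≥0, ∀ ψ : ℕ → ℝ → ℝ, (∀ j, Continuous (ψ j)) → xi σ T lam ψ < ⊤ →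
      ∀ u : ℝ → ℝ → ℝ, MemBesov σ T u →
        (∀ t ∈ Set.Icc 0 T, MildOpWellDefined σ T a₁ a₂ ρ₁ ρ₂ h₁ h₂ lam e ψ u t) ∧
        MemBesov σ T (mildOp σ a₁ a₂ ρ₁ ρ₂ h₁ h₂ lam e ψ u) ∧
        ∀ t ∈ Set.Ioc 0 T, sqNormTwo σ t (mildOp σ a₁ a₂ ρ₁ ρ₂ h₁ h₂ lam e ψ u) ≤
          C * xi σ T lam ψ ^ 2 * (sqNormTwo σ t u + 1) := by
  obtain ⟨θ, hσθ, hθ⟩ := exists_between hσ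
  obtain ⟨C, hC⟩ := exists_driven_bounds (a₁ := a₁) (a₂ := a₂) (T := T) ρ₁ ρ₂ ha₁ ha₂ hσ0 hσθ hθ
  obtain ⟨C', hC'⟩ := exists_lintegral_leftMass_le (a₁ := a₁) (a₂ := a₂) (T := T) ρ₁ ρ₂ ha₁ ha₂
    hσ0 hσθ hθ
  set D : ℝ≥0 := 9 * (((|h₁| * M).toNNReal) ^ 2 + (|h₂|.toNNReal) ^ 2) with hD
  set b : ℝ≥0 := 1 + (T ^ (θ - σ) / (θ - σ)).toNNReal ^ 2 * T.toNNReal with hb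
  refine ⟨b * C ^ 2 * D, fun ψ hψ hξ u hu => ?_⟩
  obtain ⟨u', hu', hae, hcase⟩ := hu.exists_borel
  set w : ℕ → ℝ → ℝ → ℝ := fun j s y => (h₁ * u' s y + h₂) * e j y with hw
  have hforce : ∀ j t, t ≤ T → ForcingBound σ (w j) t (D * (sqNormTwo σ t u + 1)) := by
    intro j t ht
    have := forcingBound_of_memBesov (h₁ := h₁) (h₂ := h₂) (he j) (he2 j) (heM j) hu hu' hae
      hcase ht
    rw [hD]
    push_cast
    exact this
  have hΛ : ∀ j, seminormZero σ T (ψ j) ≠ ⊤ := by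
    intro j hj
    have := ENNReal.ne_top_of_tsum_ne_top hξ.ne j
    rw [hj, ENNReal.mul_top (ENNReal.ofReal_pos.2 (hlam j)).ne'] at this
    exact this rfl
  set m : ℕ → ℝ → ℝ → ℝ := fun j t x => lam j * driven σ a₁ a₂ ρ₁ ρ₂ (w j) (ψ j) t x with hm
  have hterm : ∀ j, ∀ t ∈ Set.Icc 0 T, mildTerm σ a₁ a₂ ρ₁ ρ₂ h₁ h₂ (e j) (ψ j) u t =
      driven σ a₁ a₂ ρ₁ ρ₂ (w j) (ψ j) t := fun j t ht => mildTerm_eq_driven (e j) (ψ j) hae ht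
  have hop : ∀ t ∈ Set.Icc 0 T, mildOp σ a₁ a₂ ρ₁ ρ₂ h₁ h₂ lam e ψ u t =
      fun x => ∑' j, m j t x := by
    intro t ht
    funext x
    exact tsum_congr fun j => by rw [hterm j t ht]
  have hdm : ∀ j, Measurable (Function.uncurry (driven σ a₁ a₂ ρ₁ ρ₂ (w j) (ψ j))) := fun j =>
    measurable_driven (hforce j T le_rfl).measurable (hψ j)
  have hmm : ∀ j, Measurable (Function.uncurry (m j)) := fun j =>
    (hdm j).const_mul (lam j)
  have hms : ∀ j s, Measurable (m j s) := fun j s => (hmm j).of_uncurry_left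
  -- the summable constants controlling the terms up to the time `t`
  set c : ℝ → ℕ → ℝ≥0∞ := fun t j => ENNReal.ofReal (lam j) * seminormZero σ T (ψ j) *
    (C * (D * (sqNormTwo σ t u + 1)) ^ (1 / 2 : ℝ)) with hc
  have hcsum : ∀ t, ∑' j, c t j =
      xi σ T lam ψ * (C * (D * (sqNormTwo σ t u + 1)) ^ (1 / 2 : ℝ)) :=
    fun t => ENNReal.tsum_mul_right
  have hcfin : ∀ t, t ≤ T → ∑' j, c t j ≠ ⊤ := by
    intro t ht
    rw [hcsum]
    refine ENNReal.mul_ne_top hξ.ne (ENNReal.mul_ne_top (by finiteness) ?_)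
    exact ENNReal.rpow_ne_top_of_nonneg (by norm_num) (hforce 0 t ht).ne_top
  have hlamabs : ∀ j, |lam j| = lam j := fun j => abs_of_pos (hlam j)
  have hbound : ∀ j t, t ≤ T → ∀ s ∈ Set.Icc 0 t, normTwo (m j s) ≤ c t j := by
    intro j t ht s hs
    have h := ((hC (w j) _ s hs.1 (hs.2.trans ht) ((hforce j t ht).mono hs.2)).2.2
      (ψ j) (hψ j) (hΛ j)).1
    rw [hm, normTwo_const_mul, hlamabs]
    refine (mul_le_mul' le_rfl h).trans (le_of_eq ?_)
    simp only [hc]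
    ring
  have hincr : ∀ j t, t ≤ T → ∀ s ∈ Set.Icc 0 t, ∀ v ∈ Set.Ioo 0 s,
      normTwo (fun x => m j s x - m j v x) ≤ ENNReal.ofReal ((s - v) ^ θ) * c t j := by
    intro j t ht s hs v hv
    have h := ((hC (w j) _ s hs.1 (hs.2.trans ht) ((hforce j t ht).mono hs.2)).2.2
      (ψ j) (hψ j) (hΛ j)).2 v hv
    simp only [hm, ← mul_sub]
    rw [normTwo_const_mul, hlamabs]
    refine (mul_le_mul' le_rfl h).trans (le_of_eq ?_)
    simp only [hc]
    ring
  have hmain : ∀ t ∈ Set.Icc 0 T, sqNormTwo σ t (mildOp σ a₁ a₂ ρ₁ ρ₂ h₁ h₂ lam e ψ u) ≤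
      (b * C ^ 2 * D : ℝ≥0) * xi σ T lam ψ ^ 2 * (sqNormTwo σ t u + 1) := by
    intro t ht
    rw [sqNormTwo_congr fun s hs => hop s ⟨hs.1, hs.2.trans ht.2⟩]
    refine (sqNormTwo_tsum_le hσθ ht.2 hms (hcfin t ht.2) (fun j => hbound j t ht.2)
      (fun j => hincr j t ht.2)).trans (le_of_eq ?_)
    rw [hcsum, mul_pow, mul_pow, sqrt_sq, hb]
    push_cast
    rw [ENNReal.ofReal, ENNReal.ofReal]
    ring
  refine ⟨fun t ht => ?_, ⟨?_, fun s hs => ?_, ?_⟩, fun t ht => hmain t ⟨ht.1.le, ht.2⟩⟩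
  · have hev : ∀ j, ∀ᵐ s ∂(volume : Measure ℝ).restrict (Set.Icc 0 T),
        varsigma a₁ a₂ ρ₁ ρ₂ h₁ h₂ (e j) u t s = evolved a₁ a₂ ρ₁ ρ₂ (w j) t s := fun j =>
      hae.mono fun s hs => varsigma_eq_evolved (e j) hs t
    refine ⟨?_, fun j => ?_, fun j => ?_, ?_⟩
    · refine lt_of_le_of_lt (iSup_le fun j => ?_)
        (b := C' * (D * (sqNormTwo σ T u + 1)) ^ (1 / 2 : ℝ)) ?_
      · refine le_trans (le_of_eq ?_) (hC' (w j) _ t ht.1 ht.2 (hforce j T le_rfl))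
        refine lintegral_congr_ae ?_
        filter_upwards [ae_restrict_Ioo_of_Icc le_rfl (hev j), ae_restrict_mem measurableSet_Ioo]
          with s hs hs0
        change leftMass σ (varsigma a₁ a₂ ρ₁ ρ₂ h₁ h₂ (e j) u t) s =
          leftMass σ (evolved a₁ a₂ ρ₁ ρ₂ (w j) t) s
        refine leftMass_congr (Filter.EventuallyEq.of_eq hs) ?_
        exact (ae_restrict_Ioo_of_Icc hs0.2.le (hev j)).mono fun q hq =>
          Filter.EventuallyEq.of_eq hq
      · refine ENNReal.mul_lt_top (by finiteness) (lt_top_iff_ne_top.2 ?_)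
        exact ENNReal.rpow_ne_top_of_nonneg (by norm_num) (hforce 0 T le_rfl).ne_top
    · have hf := hforce j t ht.2
      refine (hC (w j) _ t ht.1 ht.2 hf).1.mono fun x hx => ?_
      refine glsIntegrable_of_leftMaj hσ0 (by linarith) ht.2 (hψ j) (hΛ j)
        (measurable_evolved hf.measurable t) hx ?_
      exact (ae_restrict_Ioo_of_Icc ht.2 (hev j)).mono fun q hq => by rw [hq]
    · rw [hterm j t ht]
      have hf := hforce j t ht.2
      refine ⟨((hdm j).comp measurable_prodMk_left).aestronglyMeasurable, ?_⟩
      refine lt_of_le_of_lt ((hC (w j) _ t ht.1 ht.2 hf).2.2 (ψ j) (hψ j) (hΛ j)).1 ?_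
      refine ENNReal.mul_lt_top (ENNReal.mul_lt_top (by finiteness) (hΛ j).lt_top) ?_
      exact (ENNReal.rpow_ne_top_of_nonneg (by norm_num) hf.ne_top).lt_top
    · have h := tendsto_normTwo_tsum_sub (m := fun j => m j t) (fun j => hms j t)
        (ne_top_of_le_ne_top (hcfin t ht.2)
          (ENNReal.tsum_le_tsum fun j => hbound j t ht.2 t ⟨ht.1, le_rfl⟩))
      refine h.congr fun n => ?_
      rw [hop t ht]
      simp only [hterm _ t ht, hm]
  · have h : Measurable fun p : ℝ × ℝ => ∑' j, m j p.1 p.2 :=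
      measurable_tsum_real fun j => hmm j
    refine h.aemeasurable.congr ?_
    filter_upwards [Measure.quasiMeasurePreserving_fst.ae
      (ae_restrict_mem (μ := (volume : Measure ℝ)) (measurableSet_Icc (a := 0) (b := T)))] with p hp
    exact (congrFun (hop p.1 hp) p.2).symm
  · rw [hop s hs]
    exact (measurable_tsum_real fun j => hms j s).aestronglyMeasurable
  · refine (hmain T ⟨hT.le, le_rfl⟩).trans_lt ?_
    have := hu.finite.ne
    have := hξ.ne
    finiteness

end mild

end FracHeat

theorem proposition11
    (T H σ : ℝ) (hT : 0 < T) (hH : H ∈ Set.Ioo (1 / 2 : ℝ) 1)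
    (hσ : σ ∈ Set.Ioo (1 - H) (1 / 2 : ℝ))
    (a₁ a₂ ρ₁ ρ₂ h₁ h₂ : ℝ) (ha₁ : 0 < a₁) (ha₂ : 0 < a₂) (hρ₁ : 0 < ρ₁) (hρ₂ : 0 < ρ₂)
    (lam : ℕ → ℝ) (hlam_pos : ∀ j, 0 < lam j) (hlam : Summable lam)
    (e : HilbertBasis ℕ ℝ (Lp ℝ 2 (volume : Measure ℝ)))
    (he : (⨆ j, eLpNorm (e j : ℝ → ℝ) ⊤ (volume : Measure ℝ)) < ⊤) :
    ∃ C : ℝ≥0, ∀ (Ω : Type*) [MeasurableSpace Ω] (P : Measure Ω) [IsProbabilityMeasure P]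
      (B : ℕ → ℝ≥0 → Ω → ℝ), (∀ j, FracHeat.IsFBM H (B j) P) →
      ∀ᵐ ω ∂P,
        FracHeat.xi σ T lam (fun j => FracHeat.path (B j) ω) < ⊤ ∧
        ∀ u : ℝ → ℝ → ℝ, FracHeat.MemBesov σ T u →
          (∀ t ∈ Set.Icc 0 T, FracHeat.MildOpWellDefined σ T a₁ a₂ ρ₁ ρ₂ h₁ h₂ lam
            (fun j => (e j : ℝ → ℝ)) (fun j => FracHeat.path (B j) ω) u t) ∧
          FracHeat.MemBesov σ T (FracHeat.mildOp σ a₁ a₂ ρ₁ ρ₂ h₁ h₂ lam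
            (fun j => (e j : ℝ → ℝ)) (fun j => FracHeat.path (B j) ω) u) ∧
          ∀ t ∈ Set.Ioc 0 T,
            FracHeat.sqNormTwo σ t (FracHeat.mildOp σ a₁ a₂ ρ₁ ρ₂ h₁ h₂ lam
              (fun j => (e j : ℝ → ℝ)) (fun j => FracHeat.path (B j) ω) u) ≤
            C * FracHeat.xi σ T lam (fun j => FracHeat.path (B j) ω) ^ 2 *
              (FracHeat.sqNormTwo σ t u + 1) := by
  obtain ⟨hH1, hH2⟩ := hH
  obtain ⟨hσ1, hσ2⟩ := hσ
  have hemeas : ∀ j, Measurable (e j : ℝ → ℝ) := fun j => (Lp.stronglyMeasurable _).measurable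
  have henorm : ∀ j, FracHeat.normTwo (e j : ℝ → ℝ) = 1 := by
    intro j
    have h := e.orthonormal.1 j
    rw [FracHeat.normTwo, ← Lp.enorm_def, ← ofReal_norm, h, ENNReal.ofReal_one]
  have hebound : ∀ j, ∀ᵐ y, |(e j : ℝ → ℝ) y| ≤
      (⨆ j, eLpNorm (e j : ℝ → ℝ) ⊤ (volume : Measure ℝ)).toReal := by
    intro j
    filter_upwards [ae_le_eLpNormEssSup (f := (e j : ℝ → ℝ)) (μ := (volume : Measure ℝ))]
      with y hy
    rw [← eLpNorm_exponent_top] at hy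
    have h := hy.trans (le_iSup (fun j => eLpNorm (e j : ℝ → ℝ) ⊤ (volume : Measure ℝ)) j)
    rw [← Real.norm_eq_abs, ← toReal_enorm]
    exact ENNReal.toReal_mono he.ne h
  obtain ⟨C, hC⟩ := FracHeat.exists_mildOp_bounds (a₁ := a₁) (a₂ := a₂) ρ₁ ρ₂ h₁ h₂ _ hT ha₁ ha₂
    (by linarith : 0 < σ) hσ2 hlam_pos hemeas henorm hebound
  refine ⟨C, fun Ω _ P _ B hB => ?_⟩
  filter_upwards [FracHeat.ae_xi_lt_top hT (by linarith : 0 < H) (by linarith : σ < 1)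
    (by linarith : 1 - σ < H) hlam hB, ae_all_iff.2 fun j => (hB j).continuous_paths]
    with ω hξ hcont
  exact ⟨hξ, hC _ (fun j => (hcont j).comp continuous_real_toNNReal) hξ⟩
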